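/- **Setting.** Let $\Gamma\subset\mathbb R^2$ be a simple closed regular $C^2$ curve separating the plane into open sets $D^+,D^-$, and let $\beta=\beta^\pm>0$ on $D^\pm$. Let $\mathcal T_h$ be a conforming triangulation of a bounded polygonal open set $\Omega\supset\Gamma$ which is shape regular with constant $\varrho>0$ (each triangle $T$ contains a disc of diameter at least $\varrho h_T$, $h_T=\operatorname{diam}T$), with mesh size $h=\max_T h_T$; put $T^\pm=T\cap D^\pm$, $\Gamma_T=\Gamma\cap T$. Let $r>0$ be such that the segments of length $2r$ centred at, and normal to $\Gamma$ at, the points of $\Gamma$ are pairwise disjoint, and let $h<r/2$. Assume (H1) $\Gamma$ meets no edge in more than two points unless the edge is part of $\Gamma$; (H2) any two points in which $\Gamma$ meets the boundary of a triangle lie on different edges of it (unless they lie on an edge that is part of $\Gamma$). *Interface elements* $\mathcal T_h^i$ are the triangles whose interior meets $\Gamma$. $\mathring{\mathcal E}_h$ are the interior edges; $\mathring{\mathcal E}_h^i$ those cut by $\Gamma$ into nonempty parts $e^\pm=e\cap D^\pm$; $\mathring{\mathcal E}_h^n$ the others; $\mathring{\mathcal E}_h^n\cap\mathcal F_h^i$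 those of the latter that belong to an interface element. On an interior edge $e$ with adjacent triangles $T_e^1,T_e^2$ put $[\![w]\!]=w|_{T_e^1}-w|_{T_e^2}$, $\{w\}=\frac12(w|_{T_e^1}+w|_{T_e^2})$, with $n$ the unit normal from $T_e^1$ to $T_e^2$; on $\Gamma$ put $[\![w]\!]=w^+-w^-$, with $n,t$ unit normal and tangent. In the terms on $\mathring{\mathcal E}_h^n$ below $\beta$ stands for $\{\beta\}$ on $e$ (which is $\beta$ if $e$ lies on one side of $\Gamma$); on interface edges and on $\Gamma$ put $\{\beta\}=\frac12(\beta^++\beta^-)$. **IFE space.** Let $p\ge1$, $\lambda\ge1$, $\omega_0,\dots,\omega_3>0$. For $T\in\mathcal T_h^i$ let $\Gamma_T^\lambda=\Gamma\cap T_\lambda$, where $T_\lambda$ is $T$ dilated by $\lambda$ about its barycentre, and for pairs $u=(u^+,u^-)$, $v=(v^+,v^-)$ of polynomials of degree at most $p$ let $$\mathcal J(u,v)=\int_{\Gamma_T^\lambda}\Big(\omega_0[\![u]\!][\![v]\!]+\omega_1h^2[\![\partial_nu]\!][\![\partial_nv]\!]+\omega_2h^4[\![\beta\partial_{nn}u]\!][\![\beta\partial_{nn}v]\!]+\omega_3h^6[\![\beta(\partial_n\Delta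 u+\partial_{ntt}u)]\!][\![\beta(\partial_n\Delta v+\partial_{ntt}v)]\!]\Big)ds .$$ The shape function $\phi_{A,T}$ of a Lagrange node $A$ of order $p$ of $T$ is a pair with nodal values $1$ at $A$ and $0$ at the other nodes (a node in $T^\pm$ is evaluated with the $\pm$ polynomial) such that $\mathcal J(\phi_{A,T},\eta)=0$ for every pair $\eta$ of degree at most $p$ with vanishing nodal values (any solution, if it is not unique). The local space $S_h^p(T)$ is the span of the $\phi_{A,T}$ if $T\in\mathcal T_h^i$, and $\mathcal P_p(T)$ otherwise. $S_h^p$ is the space of functions $v$ on $\Omega$ with $v|_T\in S_h^p(T)$ for all $T$ that are continuous on every edge in $\mathring{\mathcal E}_h^n$ and at all Lagrange nodes, and vanish on $\partial\Omega$. **Scheme.** For $\sigma_u,\sigma_F,\sigma_n>0$ let $$\begin{aligned}a_h(u,v)=&\sum_{T\in\mathcal T_h}\int_T\beta\nabla^2u:\nabla^2v-\sum_{e\in\mathring{\mathcal E}_h}\int_e\{\beta\partial_{nn}u\}[\![\partial_nv]\!]-\sum_{e\in\mathring{\mathcal E}_h}\int_e\{\beta\partial_{nn}v\}[\![\partial_nu]\!]+\sum_{e\in\mathring{\mathcal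 E}_h^n}\frac{\sigma_u}{|e|}\int_e\beta[\![\partial_nu]\!][\![\partial_nv]\!]\\&+\sum_{e\in\mathring{\mathcal E}_h^i}\sum_{s=\pm}\frac{\sigma_u\beta^s}{|e^s|}\int_{e^s}[\![\partial_nu]\!][\![\partial_nv]\!]+\sum_{T\in\mathcal T_h^i}\frac{\sigma_u\{\beta\}}{h_T}\int_{\Gamma_T}[\![\partial_nu]\!][\![\partial_nv]\!]+\sum_{e\in\mathring{\mathcal E}_h^i}\sum_{s=\pm}\sigma_F|e^s|\beta^s\int_{e^s}[\![\partial_{nn}u]\!][\![\partial_{nn}v]\!]\\&+\sum_{e\in\mathring{\mathcal E}_h^n\cap\mathcal F_h^i}\sigma_F|e|\int_e\beta[\![\partial_{nn}u]\!][\![\partial_{nn}v]\!]+\sum_{e\in\mathring{\mathcal E}_h^i}\frac{\sigma_n\{\beta\}}{|e|^3}\int_e[\![u]\!][\![v]\!]+\sum_{T\in\mathcal T_h^i}\frac{\sigma_n\{\beta\}}{h_T^3}\int_{\Gamma_T}[\![u]\!][\![v]\!],\end{aligned}$$ where second derivatives are taken piecewise on the sets $T^\pm$, and let $\|v\|_h^2$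 be the sum of all terms of $a_h(v,v)$ except the two sums over $\mathring{\mathcal E}_h$ (those containing $\{\beta\partial_{nn}\,\cdot\,\}$). **Theorem (coercivity and well-posedness).** For every $p\ge1$ and $\varrho>0$ there are constants $C>0$ and $c>0$, depending only on $p$ and $\varrho$ (in particular not on the interface, its location relative to the mesh, or $h$), such that with $\sigma_u=3C$, $\sigma_F=1$ and any $\sigma_n>0$, in every setting as above, $$a_h(v,v)\ge c\,\|v\|_h^2\qquad\text{for all }v\in S_h^p,$$ and for every $f\in L^2(\Omega)$ there is exactly one $u_h\in S_h^p$ with $a_h(u_h,v_h)=\int_\Omega f\,v_h$ for all $v_h\in S_h^p$. -/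

import Mathlib

open MeasureTheory Set Filter Topology

noncomputable section

namespace ImmersedIP

/-- The Euclidean plane. -/
abbrev Plane : Type := EuclideanSpace ℝ (Fin 2)

/-! ### Polynomials and their derivatives -/

/-- Polynomials in two variables. -/
abbrev Poly : Type := MvPolynomial (Fin 2) ℝ

/-- A piecewise polynomial on one element: `q true` is the polynomial used on the `+` side of the
interface, `q false` the one used on the `-` side. -/
abbrev Piece : Type := Bool → Poly

/-- The value of a polynomial at a point. -/
def ev (q : Poly) (x : Plane) : ℝ := MvPolynomial.eval (fun i => x i) q

/-- The derivative of a polynomial in the (constant) direction `a`. -/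
def dirD (a : Plane) (q : Poly) : Poly := ∑ i, MvPolynomial.C (a i) * MvPolynomial.pderiv i q

/-- The Laplacian of a polynomial. -/
def lapl (q : Poly) : Poly := ∑ i, MvPolynomial.pderiv i (MvPolynomial.pderiv i q)

/-- The Frobenius product of the Hessians of two polynomials at a point. -/
def hessDot (q w : Poly) (x : Plane) : ℝ :=
  ∑ i, ∑ j, ev (MvPolynomial.pderiv i (MvPolynomial.pderiv j q)) x *
    ev (MvPolynomial.pderiv i (MvPolynomial.pderiv j w)) x

/-- Rotation by a right angle. -/
def rot (a : Plane) : Plane := !₂[a 1, -a 0]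

/-! ### The interface -/

/-- A simple closed regular curve of class `C²`, parametrised by arc length, together with the two
open sets `D true` (the `+` side) and `D false` (the `-` side) into which it separates the plane.
For a domain `Ω` that contains the curve, the subdomains are `Ω ∩ D true` and `Ω ∩ D false`. -/
structure Interface where
  γ : ℝ → Plane
  len : ℝ
  len_pos : 0 < len
  contDiff : ContDiff ℝ 2 γ
  periodic : Function.Periodic γ len
  injOn : Set.InjOn γ (Set.Ico 0 len)
  unit_speed : ∀ t, ‖deriv γ t‖ = 1
  D : Bool → Set Plane
  isOpen_D : ∀ s, IsOpen (D s)
  disjoint_D : Disjoint (D true) (D false)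
  union_D : D true ∪ D false = (Set.range γ)ᶜ
  frontier_D : ∀ s, frontier (D s) = Set.range γ

namespace Interface

variable (I : Interface)

/-- The curve as a set. -/
def Γ : Set Plane := Set.range I.γ

/-- The unit tangent at `γ t`. -/
def tang (t : ℝ) : Plane := deriv I.γ t

/-- The unit normal at `γ t`. -/
def nor (t : ℝ) : Plane := rot (deriv I.γ t)

/-- The segment of length `2 r` centred at `γ t` and perpendicular to the curve. -/
def normalSegment (r t : ℝ) : Set Plane := {x | ∃ a : ℝ, |a| ≤ r ∧ x = I.γ t + a • I.nor t}

/-- `r` is a radius for which the normal segments at different points of the curve are disjoint. -/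
def IsTubularRadius (r : ℝ) : Prop :=
  0 < r ∧ ∀ s t, I.γ s ≠ I.γ t → Disjoint (I.normalSegment r s) (I.normalSegment r t)

/-- The arc-length integral over `Γ ∩ S` of a function of the curve parameter. -/
def curveInt (S : Set Plane) (f : ℝ → ℝ) : ℝ :=
  ∫ t in Set.Ico 0 I.len ∩ I.γ ⁻¹' S, f t

/-- The jump `⟦g⟧ = g⁺ - g⁻` at `γ t` of a piecewise polynomial. -/
def jumpΓ (g : Piece) (t : ℝ) : ℝ := ev (g true) (I.γ t) - ev (g false) (I.γ t)

end Interface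

/-- Differentiating both polynomials of a piece in the direction `a`. -/
def pdir (a : Plane) (g : Piece) : Piece := fun s => dirD a (g s)

/-- The product of the piecewise constant `β` with a piece. -/
def pmul (β : Bool → ℝ) (g : Piece) : Piece := fun s => MvPolynomial.C (β s) * g s

/-- `∂ₙ Δ g + ∂ₙₜₜ g`, on both sides. -/
def pthird (n t : Plane) (g : Piece) : Piece :=
  fun s => dirD n (lapl (g s)) + dirD n (dirD t (dirD t (g s)))

/-! ### The mesh -/

/-- The closed triangle (or the closed edge) with the given set of vertices. -/
def hull (T : Finset Plane) : Set Plane := convexHull ℝ (T : Set Plane)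

/-- The barycentre of a triangle. -/
def bary (T : Finset Plane) : Plane := (3 : ℝ)⁻¹ • ∑ x ∈ T, x

/-- The diameter of an element. -/
def diamT (T : Finset Plane) : ℝ := Metric.diam (hull T)

/-- The fictitious element: the dilation of the triangle about its barycentre. -/
def fict (lam : ℝ) (T : Finset Plane) : Set Plane := AffineMap.homothety (bary T) lam '' hull T

/-- The Lagrange nodes of order `p` of a triangle. -/
def nodes (p : ℕ) (T : Finset Plane) : Set Plane :=
  {A | ∃ m : Plane → ℕ, ∑ x ∈ T, m x = p ∧ A = ∑ x ∈ T, ((m x : ℝ) / (p : ℝ)) • x}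

open scoped Classical in
/-- The two end points of an edge, in some order. -/
def ends (e : Finset Plane) : Plane × Plane :=
  if h : ∃ q : Plane × Plane, q.1 ≠ q.2 ∧ e = {q.1, q.2} then h.choose else (0, 0)

/-- The affine parametrisation of an edge by `[0, 1]`. -/
def edgePt (e : Finset Plane) (t : ℝ) : Plane := AffineMap.lineMap (ends e).1 (ends e).2 t

/-- The length `|e|` of an edge. -/
def edgeLen (e : Finset Plane) : ℝ := dist (ends e).1 (ends e).2

/-- The arc-length integral of `f` over `e ∩ S`. -/
def edgeInt (e : Finset Plane) (S : Set Plane) (f : Plane → ℝ) : ℝ :=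
  edgeLen e * ∫ t in {t | t ∈ Set.Icc (0 : ℝ) 1 ∧ edgePt e t ∈ S}, f (edgePt e t)

/-- The length of `e ∩ S`. -/
def subLen (e : Finset Plane) (S : Set Plane) : ℝ :=
  edgeLen e * (volume {t | t ∈ Set.Icc (0 : ℝ) 1 ∧ edgePt e t ∈ S}).toReal

open scoped Classical in
/-- The edges of a set of triangles. -/
def edgesOf (tri : Finset (Finset Plane)) : Finset (Finset Plane) :=
  tri.biUnion fun T => T.powersetCard 2

open scoped Classical in
/-- The interior edges: those that belong to two triangles. -/
def intEdgesOf (tri : Finset (Finset Plane)) : Finset (Finset Plane) :=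
  (edgesOf tri).filter fun e => ∃ T ∈ tri, ∃ T' ∈ tri, T ≠ T' ∧ e ⊆ T ∧ e ⊆ T'

/-- A conforming triangular mesh. Triangles are given by their sets of vertices; for each interior
edge `e`, `T₁ e` and `T₂ e` are the two adjacent triangles, in an arbitrary order. -/
structure Mesh where
  tri : Finset (Finset Plane)
  card_tri : ∀ T ∈ tri, T.card = 3
  indep : ∀ T ∈ tri, AffineIndependent ℝ ((↑) : T → Plane)
  conform : ∀ T ∈ tri, ∀ T' ∈ tri,
    hull T ∩ hull T' ⊆ convexHull ℝ ((T : Set Plane) ∩ (T' : Set Plane))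
  T₁ : Finset Plane → Finset Plane
  T₂ : Finset Plane → Finset Plane
  adj : ∀ e ∈ intEdgesOf tri,
    T₁ e ∈ tri ∧ T₂ e ∈ tri ∧ T₁ e ≠ T₂ e ∧ e ⊆ T₁ e ∧ e ⊆ T₂ e

namespace Mesh

variable (M : Mesh)

/-- The domain that is triangulated. -/
def Ω : Set Plane := interior (⋃ T ∈ M.tri, hull T)

/-- The mesh size. -/
def h : ℝ := ⨆ T : M.tri, diamT T

/-- Shape regularity with constant `ρ`: every triangle contains a disc whose diameter is at least
`ρ` times the diameter of the triangle. -/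
def ShapeRegular (ρ : ℝ) : Prop :=
  ∀ T ∈ M.tri, ∃ x, Metric.closedBall x (ρ * diamT T / 2) ⊆ hull T

/-- All edges. -/
def edges : Finset (Finset Plane) := edgesOf M.tri

/-- The interior edges. -/
def intEdges : Finset (Finset Plane) := intEdgesOf M.tri

open scoped Classical in
/-- The boundary edges. -/
def bdEdges : Finset (Finset Plane) := M.edges \ M.intEdges

/-- Interface elements: the interior of the triangle meets the interface. -/
def IsInterfaceElt (I : Interface) (T : Finset Plane) : Prop :=
  T ∈ M.tri ∧ (interior (hull T) ∩ I.Γ).Nonempty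

open scoped Classical in
/-- The interface elements. -/
def ifTri (I : Interface) : Finset (Finset Plane) := M.tri.filter (M.IsInterfaceElt I)

/-- An edge that is cut by the interface into two nonempty parts `e⁺` and `e⁻`. -/
def IsCut (I : Interface) (e : Finset Plane) : Prop := ∀ s, (hull e ∩ I.D s).Nonempty

open scoped Classical in
/-- The interior interface edges. -/
def intEdgesI (I : Interface) : Finset (Finset Plane) := M.intEdges.filter (IsCut I)

open scoped Classical in
/-- The interior non-interface edges. -/
def intEdgesN (I : Interface) : Finset (Finset Plane) := M.intEdges.filter fun e => ¬ IsCut I e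

open scoped Classical in
/-- The interior non-interface edges that belong to an interface element. -/
def intEdgesNF (I : Interface) : Finset (Finset Plane) :=
  (M.intEdgesN I).filter fun e => ∃ T, M.IsInterfaceElt I T ∧ e ⊆ T

/-- The interface lies in the domain, the mesh size is less than half of a radius of a tubular
neighbourhood of the interface, the interface meets no edge in more than two points unless the edge
is part of it (`two_points`), and any two points in which the interface meets the boundary of an
element are on different edges of this element, unless they are on an edge that is part of the
interface (`diff_edges`). -/
structure Admissible (I : Interface) (r : ℝ) : Prop where
  subset : I.Γ ⊆ M.Ω
  tubular : I.IsTubularRadius r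
  small : M.h < r / 2
  two_points : ∀ e ∈ M.edges, ¬ hull e ⊆ I.Γ → (I.Γ ∩ hull e).encard ≤ 2
  diff_edges : ∀ T ∈ M.tri, ∀ x ∈ I.Γ ∩ frontier (hull T), ∀ y ∈ I.Γ ∩ frontier (hull T), x ≠ y →
    (∃ e ∈ T.powersetCard 2, ∃ e' ∈ T.powersetCard 2, e ≠ e' ∧ x ∈ hull e ∧ y ∈ hull e') ∨
    (∃ e ∈ T.powersetCard 2, x ∈ hull e ∧ y ∈ hull e ∧ hull e ⊆ I.Γ)

end Mesh

/-! ### Traces, jumps and averages -/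

open scoped Classical in
/-- The side of the interface on which the element `T` lies near its point `x`. For `x` in `D s`
this is `s`; for `x` on the interface it is decided by looking from `x` towards the barycentre. -/
def phase (I : Interface) (T : Finset Plane) (x : Plane) : Bool :=
  if ∀ᶠ ε in 𝓝[>] (0 : ℝ), AffineMap.lineMap x (bary T) ε ∈ I.D false then false else true

/-- The value at `x`, as seen from `T`, of the function on `T` given by the piece `g`. -/
def val (I : Interface) (T : Finset Plane) (g : Piece) (x : Plane) : ℝ := ev (g (phase I T x)) x

/-- A mesh function: one piece for each element. -/
abbrev MeshFun : Type := Finset Plane → Piece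

section Edge

variable (M : Mesh) (I : Interface)

open scoped Classical in
/-- The unit normal of an interior edge, oriented from `T₁ e` to `T₂ e`. -/
def edgeNormal (e : Finset Plane) : Plane :=
  let ν : Plane := (edgeLen e)⁻¹ • rot ((ends e).2 - (ends e).1)
  if 0 < inner ℝ ν (bary (M.T₂ e) - bary (M.T₁ e)) then ν else -ν

/-- The jump `⟦v⟧` on an interior edge. -/
def jump (e : Finset Plane) (v : MeshFun) (x : Plane) : ℝ :=
  val I (M.T₁ e) (v (M.T₁ e)) x - val I (M.T₂ e) (v (M.T₂ e)) x

/-- The average of `v` on an interior edge. -/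
def aver (e : Finset Plane) (v : MeshFun) (x : Plane) : ℝ :=
  (val I (M.T₁ e) (v (M.T₁ e)) x + val I (M.T₂ e) (v (M.T₂ e)) x) / 2

/-- The jump `⟦∂ₙ v⟧` on an interior edge. -/
def jumpN (e : Finset Plane) (v : MeshFun) (x : Plane) : ℝ :=
  jump M I e (fun T => pdir (edgeNormal M e) (v T)) x

/-- The jump `⟦∂ₙₙ v⟧` on an interior edge. -/
def jumpNN (e : Finset Plane) (v : MeshFun) (x : Plane) : ℝ :=
  jump M I e (fun T => pdir (edgeNormal M e) (pdir (edgeNormal M e) (v T))) x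

/-- The average of `β ∂ₙₙ v` on an interior edge. -/
def averNN (β : Bool → ℝ) (e : Finset Plane) (v : MeshFun) (x : Plane) : ℝ :=
  aver M I e (fun T => pmul β (pdir (edgeNormal M e) (pdir (edgeNormal M e) (v T)))) x

/-- The coefficient `β` on an edge, as the average of its values in the adjacent elements. On an
edge that lies on one side of the interface it is the value of `β` on this side. -/
def betaE (β : Bool → ℝ) (e : Finset Plane) (x : Plane) : ℝ :=
  (β (phase I (M.T₁ e) x) + β (phase I (M.T₂ e) x)) / 2

end Edge

/-- The average `(β⁺ + β⁻) / 2`. -/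
def betaAv (β : Bool → ℝ) : ℝ := (β true + β false) / 2

/-! ### The immersed finite element space -/

/-- Pieces both of whose polynomials have degree at most `p`. -/
def pieces (p : ℕ) : Submodule ℝ Piece :=
  Submodule.pi Set.univ fun _ => MvPolynomial.restrictTotalDegree (Fin 2) ℝ p

/-- Pieces that consist of a single polynomial of degree at most `p`. -/
def single (p : ℕ) : Submodule ℝ Piece :=
  (MvPolynomial.restrictTotalDegree (Fin 2) ℝ p).map (LinearMap.pi fun _ : Bool => LinearMap.id)

/-- The bilinear form that measures the violation of the interface conditions on `Γ ∩ S`. -/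
def jumpForm (I : Interface) (β : Bool → ℝ) (ω : Fin 4 → ℝ) (h : ℝ) (S : Set Plane)
    (u v : Piece) : ℝ :=
  ω 0 * I.curveInt S (fun t => I.jumpΓ u t * I.jumpΓ v t)
  + ω 1 * h ^ 2 * I.curveInt S (fun t =>
      I.jumpΓ (pdir (I.nor t) u) t * I.jumpΓ (pdir (I.nor t) v) t)
  + ω 2 * h ^ 4 * I.curveInt S (fun t =>
      I.jumpΓ (pmul β (pdir (I.nor t) (pdir (I.nor t) u))) t *
      I.jumpΓ (pmul β (pdir (I.nor t) (pdir (I.nor t) v))) t)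
  + ω 3 * h ^ 6 * I.curveInt S (fun t =>
      I.jumpΓ (pmul β (pthird (I.nor t) (I.tang t) u)) t *
      I.jumpΓ (pmul β (pthird (I.nor t) (I.tang t) v)) t)

open scoped Classical in
/-- `g` is the immersed shape function of the node `A` of the interface element `T`: its nodal
values are `1` at `A` and `0` at the other nodes (each node is read on the side it belongs to), and
it is orthogonal, with respect to the jump form on the fictitious interface segment, to all pieces
of degree at most `p` whose nodal values vanish. With the nodal basis `ξᵢ, ηᵢ` of the pairs of
polynomials (`ηᵢ` are those with vanishing nodal values) this is the linear system for the
coefficients of `g = ξ_A + ∑ cᵢ ηᵢ`. -/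
def IsShape (I : Interface) (β : Bool → ℝ) (ω : Fin 4 → ℝ) (lam h : ℝ) (p : ℕ)
    (T : Finset Plane) (A : Plane) (g : Piece) : Prop :=
  g ∈ pieces p ∧ (∀ B ∈ nodes p T, val I T g B = if B = A then 1 else 0) ∧
  ∀ η ∈ pieces p, (∀ B ∈ nodes p T, val I T η B = 0) →
    jumpForm I β ω h (fict lam T) g η = 0

/-- A choice of immersed shape functions on all interface elements. -/
def IsShapeFamily (M : Mesh) (I : Interface) (β : Bool → ℝ) (ω : Fin 4 → ℝ) (lam : ℝ) (p : ℕ)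
    (φ : Finset Plane → Plane → Piece) : Prop :=
  ∀ T ∈ M.ifTri I, ∀ A ∈ nodes p T, IsShape I β ω lam M.h p T A (φ T A)

open scoped Classical in
/-- The local space on an element. -/
def localSpace (M : Mesh) (I : Interface) (p : ℕ) (φ : Finset Plane → Plane → Piece)
    (T : Finset Plane) : Submodule ℝ Piece :=
  if T ∈ M.ifTri I then Submodule.span ℝ (φ T '' nodes p T) else single p

theorem val_zero (I : Interface) (T : Finset Plane) (x : Plane) : val I T 0 x = 0 := by
  simp [val, ev]

theorem val_add (I : Interface) (T : Finset Plane) (g k : Piece) (x : Plane) :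
    val I T (g + k) x = val I T g x + val I T k x := by
  simp [val, ev]

theorem val_smul (I : Interface) (T : Finset Plane) (a : ℝ) (g : Piece) (x : Plane) :
    val I T (a • g) x = a * val I T g x := by
  simp [val, ev]

/-- The global immersed finite element space. A mesh function is a member if it is zero off the
mesh (a normalisation), is in the local space on each element, is continuous on all interior
non-interface edges and at all nodes, and vanishes on the boundary. -/
def ifeSpace (M : Mesh) (I : Interface) (p : ℕ) (φ : Finset Plane → Plane → Piece) :
    Submodule ℝ MeshFun where
  carrier := {v |
    (∀ T, T ∉ M.tri → v T = 0) ∧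
    (∀ T ∈ M.tri, v T ∈ localSpace M I p φ T) ∧
    (∀ e ∈ M.intEdgesN I, ∀ᵐ t ∂(volume.restrict (Set.Icc (0 : ℝ) 1)),
      val I (M.T₁ e) (v (M.T₁ e)) (edgePt e t) = val I (M.T₂ e) (v (M.T₂ e)) (edgePt e t)) ∧
    (∀ T ∈ M.tri, ∀ T' ∈ M.tri, ∀ A ∈ nodes p T ∩ nodes p T',
      val I T (v T) A = val I T' (v T') A) ∧
    (∀ e ∈ M.bdEdges, ∀ T ∈ M.tri, e ⊆ T → ∀ x ∈ hull e, val I T (v T) x = 0)}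
  zero_mem' := by
    refine ⟨fun _ _ => rfl, fun T _ => zero_mem _, fun e _ => ?_, ?_, ?_⟩
    · exact Filter.Eventually.of_forall fun t => by simp [val_zero]
    · intro T _ T' _ A _
      simp [val_zero]
    · intro e _ T _ _ x _
      simp [val_zero]
  add_mem' := by
    rintro u v ⟨hu0, hu1, hu2, hu3, hu4⟩ ⟨hv0, hv1, hv2, hv3, hv4⟩
    refine ⟨fun T hT => ?_, fun T hT => add_mem (hu1 T hT) (hv1 T hT), fun e he => ?_, ?_, ?_⟩
    · simp [hu0 T hT, hv0 T hT]
    · filter_upwards [hu2 e he, hv2 e he] with t h1 h2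
      simp only [Pi.add_apply, val_add] at *
      rw [h1, h2]
    · intro T hT T' hT' A hA
      simp only [Pi.add_apply, val_add]
      rw [hu3 T hT T' hT' A hA, hv3 T hT T' hT' A hA]
    · intro e he T hT heT x hx
      simp only [Pi.add_apply, val_add]
      rw [hu4 e he T hT heT x hx, hv4 e he T hT heT x hx, add_zero]
  smul_mem' := by
    rintro a v ⟨hv0, hv1, hv2, hv3, hv4⟩
    refine ⟨fun T hT => ?_, fun T hT => Submodule.smul_mem _ a (hv1 T hT), fun e he => ?_, ?_, ?_⟩
    · simp [hv0 T hT]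
    · filter_upwards [hv2 e he] with t h2
      simp only [Pi.smul_apply, val_smul] at *
      rw [h2]
    · intro T hT T' hT' A hA
      simp only [Pi.smul_apply, val_smul]
      rw [hv3 T hT T' hT' A hA]
    · intro e he T hT heT x hx
      simp only [Pi.smul_apply, val_smul]
      rw [hv4 e he T hT heT x hx, mul_zero]

/-! ### The scheme -/

section Scheme

variable (M : Mesh) (I : Interface) (β : Bool → ℝ) (σu σF σn : ℝ)

/-- `∑_T ∫_T β ∇²u : ∇²v`. -/
def formA (u v : MeshFun) : ℝ :=
  ∑ T ∈ M.tri, ∑ s, β s * ∫ x in hull T ∩ I.D s, hessDot (u T s) (v T s) x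

/-- The consistency and symmetry terms and the penalties on the normal derivative. -/
def formJu (u v : MeshFun) : ℝ :=
  - (∑ e ∈ M.intEdges, edgeInt e Set.univ fun x => averNN M I β e u x * jumpN M I e v x)
  - (∑ e ∈ M.intEdges, edgeInt e Set.univ fun x => averNN M I β e v x * jumpN M I e u x)
  + (∑ e ∈ M.intEdgesN I, σu / edgeLen e *
      edgeInt e Set.univ fun x => betaE M I β e x * (jumpN M I e u x * jumpN M I e v x))
  + (∑ e ∈ M.intEdgesI I, ∑ s, σu * β s / subLen e (I.D s) *
      edgeInt e (I.D s) fun x => jumpN M I e u x * jumpN M I e v x)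
  + (∑ T ∈ M.ifTri I, σu * betaAv β / diamT T * I.curveInt (hull T) fun t =>
      I.jumpΓ (pdir (I.nor t) (u T)) t * I.jumpΓ (pdir (I.nor t) (v T)) t)

/-- The penalties on the second normal derivative and on the jump of the function. -/
def formJn (u v : MeshFun) : ℝ :=
  (∑ e ∈ M.intEdgesI I, ∑ s, σF * subLen e (I.D s) * β s *
      edgeInt e (I.D s) fun x => jumpNN M I e u x * jumpNN M I e v x)
  + (∑ e ∈ M.intEdgesNF I, σF * edgeLen e *
      edgeInt e Set.univ fun x => betaE M I β e x * (jumpNN M I e u x * jumpNN M I e v x))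
  + (∑ e ∈ M.intEdgesI I, σn * betaAv β / edgeLen e ^ 3 *
      edgeInt e Set.univ fun x => jump M I e u x * jump M I e v x)
  + (∑ T ∈ M.ifTri I, σn * betaAv β / diamT T ^ 3 *
      I.curveInt (hull T) fun t => I.jumpΓ (u T) t * I.jumpΓ (v T) t)

/-- The bilinear form `a_h` of the immersed `C⁰` interior penalty method. -/
def formAh (u v : MeshFun) : ℝ :=
  formA M I β u v + formJu M I β σu u v + formJn M I β σF σn u v

/-- The mesh-dependent norm. -/
def normH (v : MeshFun) : ℝ := Real.sqrt (
  (∑ T ∈ M.tri, ∑ s, β s * ∫ x in hull T ∩ I.D s, hessDot (v T s) (v T s) x)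
  + (∑ e ∈ M.intEdgesN I, σu / edgeLen e *
      edgeInt e Set.univ fun x => betaE M I β e x * jumpN M I e v x ^ 2)
  + (∑ T ∈ M.ifTri I, σu * betaAv β / diamT T *
      I.curveInt (hull T) fun t => I.jumpΓ (pdir (I.nor t) (v T)) t ^ 2)
  + (∑ e ∈ M.intEdgesI I, ∑ s, σu * (β s / subLen e (I.D s) *
      edgeInt e (I.D s) fun x => jumpN M I e v x ^ 2))
  + (∑ e ∈ M.intEdgesNF I, σF * edgeLen e *
      edgeInt e Set.univ fun x => betaE M I β e x * jumpNN M I e v x ^ 2)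
  + (∑ e ∈ M.intEdgesI I, ∑ s, σF * (subLen e (I.D s) * β s *
      edgeInt e (I.D s) fun x => jumpNN M I e v x ^ 2))
  + (∑ e ∈ M.intEdgesI I, σn * betaAv β / edgeLen e ^ 3 *
      edgeInt e Set.univ fun x => jump M I e v x ^ 2)
  + (∑ T ∈ M.ifTri I, σn * betaAv β / diamT T ^ 3 *
      I.curveInt (hull T) fun t => I.jumpΓ (v T) t ^ 2))

/-- The load functional `L_f v = ∫_Ω f v`. -/
def load (f : Plane → ℝ) (v : MeshFun) : ℝ :=
  ∑ T ∈ M.tri, ∑ s, ∫ x in hull T ∩ I.D s, f x * ev (v T s) x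

end Scheme

end ImmersedIP

end

open scoped Pointwise

namespace ImmersedIP

/-! ### Values of polynomials -/

/-! On the diagonal, `formAh` is the square of the norm minus twice the integrals of {β∂ₙₙv}⟦∂ₙv⟧
over the interior edges (`formAh_self`), so coercivity amounts to absorbing these integrals into
half of the norm. The usual inverse trace inequality on the adjacent elements fails at the
interface, because the part of an element on one side of it can be an arbitrarily thin sliver. Two
observations repair this.

The first is algebraic. On a part of an edge that lies on side s, both traces carry the same
coefficient β s, and the sum of the two second normal derivatives is twice either one of them plus
or minus their jump. The jump is penalised, with the length of the part as weight, so only the trace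
from one adjacent element has to be controlled, whichever is the better one (`young_single`,
`edgeInt_aver_le_of_single`).

The second is geometric: one adjacent element is always good. Over a segment of length at most r/2
that avoids one of the two sides, erect a flat triangle of base slope c ≤ 1/4 on either side of its
line. Disjoint normal segments force the interface to stay outside the balls of radius r tangent to
it (`two_mul_inner_le`), so short arcs are nearly straight (`le_inner_tang_of_arc`). If the
interface met both flat triangles, a short arc would cross the segment and leave points of both
sides on it (`not_arc_across`). Hence it misses one of them (`disjoint_flatTri_or`). By shape
regularity that flat triangle lies in the adjacent element; it lies entirely on side s and contains
a disc of radius proportional to the length of the segment (`Admissible.exists_hasDisc`). A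
polynomial is bounded near a disc by its mean square on the disc, with a constant that depends on
the degree and on the ratio of the two scales only (`exists_sq_ev_le_integral_closedBall`). The
position of the interface therefore never enters the constant.

Uncut edges are treated alike, except that an edge contained in the interface, or belonging to no
interface element, has discs on both sides and needs no penalty on the second derivative
(`Admissible.hasDisc_of_not_isCut`). Young's inequality and the fact that a triangle has three edges
then give the constants (`half_normSq_le_formAh`). About v, coercivity uses only the degree bound on
its pieces.

For well-posedness, coercivity and finite dimension leave definiteness of the norm to show. If the
norm vanishes, v is affine on each part of an element, the interface penalties merge the two parts
(`isAffineOn_of_interface`), and the edge terms together with continuity identify the polynomials of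
neighbouring elements (`NormZero.eq_of_intEdge`). Following a level line of such a polynomial to the
boundary of the mesh, where v vanishes, shows that it is zero (`eq_zero_of_vanishing_boundary`). -/

@[simp] theorem ev_zero (x : Plane) : ev 0 x = 0 := by simp [ev]

@[simp] theorem ev_one (x : Plane) : ev 1 x = 1 := by simp [ev]

@[simp] theorem ev_add (q w : Poly) (x : Plane) : ev (q + w) x = ev q x + ev w x := by simp [ev]

@[simp] theorem ev_sub (q w : Poly) (x : Plane) : ev (q - w) x = ev q x - ev w x := by simp [ev]

@[simp] theorem ev_mul (q w : Poly) (x : Plane) : ev (q * w) x = ev q x * ev w x := by simp [ev]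

@[simp] theorem ev_smul (a : ℝ) (q : Poly) (x : Plane) : ev (a • q) x = a * ev q x := by
  simp [ev, MvPolynomial.smul_eval]

@[simp] theorem ev_C (a : ℝ) (x : Plane) : ev (MvPolynomial.C a) x = a := by simp [ev]

@[simp] theorem ev_X (i : Fin 2) (x : Plane) : ev (MvPolynomial.X i) x = x i := by simp [ev]

@[simp] theorem ev_sum {ι : Type*} (s : Finset ι) (q : ι → Poly) (x : Plane) :
    ev (∑ i ∈ s, q i) x = ∑ i ∈ s, ev (q i) x := by simp [ev]

theorem ev_dirD (a : Plane) (q : Poly) (x : Plane) :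
    ev (dirD a q) x = a 0 * ev (MvPolynomial.pderiv 0 q) x
      + a 1 * ev (MvPolynomial.pderiv 1 q) x := by
  simp [dirD, Fin.sum_univ_two]

@[fun_prop]
theorem continuous_ev (q : Poly) : Continuous (ev q) := by
  unfold ev
  have h1 : Continuous fun x : Plane => (fun i => x i : Fin 2 → ℝ) := by fun_prop
  exact (MvPolynomial.continuous_eval q).comp h1

/-- The chain rule, by induction on the polynomial; it connects the formal derivative `dirD` with
calculus. -/
theorem HasDerivAt.ev {c : ℝ → Plane} {c' : Plane} {t : ℝ} (hc : HasDerivAt c c' t) (q : Poly) :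
    HasDerivAt (fun t => ImmersedIP.ev q (c t)) (ImmersedIP.ev (dirD c' q) (c t)) t := by
  have hi : ∀ i, HasDerivAt (fun t => c t i) (c' i) t := fun i =>
    (EuclideanSpace.proj i : Plane →L[ℝ] ℝ).hasFDerivAt.comp_hasDerivAt t hc
  induction q using MvPolynomial.induction_on with
  | C a => simpa [ev_dirD] using hasDerivAt_const t a
  | add q w hq hw =>
    have := hq.add hw
    simp only [ev_dirD, map_add, ev_add] at this ⊢
    refine this.congr_deriv ?_
    ring
  | mul_X q i hq =>
    have := hq.mul (hi i)
    simp only [ev_dirD, Derivation.leibniz, smul_eq_mul, ev_add, ev_mul, ev_X,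
      MvPolynomial.pderiv_X] at this ⊢
    refine this.congr_deriv ?_
    fin_cases i <;> simp <;> ring

/-- An open set contains a box, and a polynomial that vanishes on a product of infinite sets is
zero. -/
theorem eq_zero_of_ev_eq_zero_on_open {q : Poly} {U : Set Plane} (hU : IsOpen U)
    (hne : U.Nonempty) (h : ∀ x ∈ U, ev q x = 0) : q = 0 := by
  obtain ⟨x, hx⟩ := hne
  let F : (Fin 2 → ℝ) → Plane := WithLp.toLp 2
  have hF : Continuous F := PiLp.continuous_toLp 2 _
  have hV : F ⁻¹' U ∈ 𝓝 (fun i => x i : Fin 2 → ℝ) := (hU.preimage hF).mem_nhds hx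
  obtain ⟨ε, hε, hb⟩ := Metric.mem_nhds_iff.1 hV
  refine MvPolynomial.funext_set (fun i => Metric.ball (x i) ε) (fun i => ?_) fun y hy => ?_
  · exact infinite_of_mem_nhds (x i) (Metric.ball_mem_nhds _ hε)
  · have : y ∈ F ⁻¹' U := by
      apply hb
      rw [← ball_pi _ hε] at hy
      exact hy
    have := h _ this
    simpa [ev, F] using this

theorem ev_eq_of_pderiv_eq_zero {q : Poly} (h : ∀ i, MvPolynomial.pderiv i q = 0) (x y : Plane) :
    ev q x = ev q y := by
  have hd : ∀ t : ℝ, HasDerivAt (fun t : ℝ => ev q (y + t • (x - y))) 0 t := fun t => by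
    have h1 : HasDerivAt (fun t : ℝ => y + t • (x - y)) (x - y) t := by
      simpa using ((hasDerivAt_id t).smul_const (x - y)).const_add y
    simpa [ev_dirD, h] using HasDerivAt.ev h1 q
  have := is_const_of_deriv_eq_zero (fun t => (hd t).differentiableAt) (fun t => (hd t).deriv) 1 0
  simpa using this

/-- A polynomial whose second derivatives vanish is affine. -/
theorem exists_affine_of_pderiv_pderiv_eq_zero {q : Poly}
    (h : ∀ i j, MvPolynomial.pderiv i (MvPolynomial.pderiv j q) = 0) :
    ∃ (a : ℝ) (b : Plane), q = MvPolynomial.C a + MvPolynomial.C (b 0) * MvPolynomial.X 0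
      + MvPolynomial.C (b 1) * MvPolynomial.X 1 := by
  let b : Plane := !₂[ev (MvPolynomial.pderiv 0 q) 0, ev (MvPolynomial.pderiv 1 q) 0]
  have hb : ∀ j, MvPolynomial.pderiv j q = MvPolynomial.C (b j) := fun j => by
    apply MvPolynomial.funext
    intro y
    have := ev_eq_of_pderiv_eq_zero (q := MvPolynomial.pderiv j q) (fun i => h i j)
      (WithLp.toLp 2 y) 0
    fin_cases j <;> simpa [ev, b] using this
  let w : Poly := q - (MvPolynomial.C (b 0) * MvPolynomial.X 0
    + MvPolynomial.C (b 1) * MvPolynomial.X 1)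
  have hw : ∀ i, MvPolynomial.pderiv i w = 0 := fun i => by
    simp only [w, map_sub, map_add, hb, Derivation.leibniz, MvPolynomial.pderiv_X,
      MvPolynomial.pderiv_C]
    fin_cases i <;> simp
  refine ⟨ev w 0, b, ?_⟩
  apply MvPolynomial.funext
  intro y
  have := ev_eq_of_pderiv_eq_zero hw (WithLp.toLp 2 y) 0
  simp only [w, ev_sub, ev_add, ev_mul, ev_C, ev_X] at this ⊢
  simp only [ev] at this ⊢
  simp at this ⊢
  linarith

/-- Cauchy–Schwarz with the unit vector n, applied to each row of the Hessian and then to the vector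
of the results. It lets the Hessian energy control second normal derivatives. -/
theorem dirD_dirD_sq_le (n : Plane) (hn : ‖n‖ = 1) (q : Poly) (x : Plane) :
    ev (dirD n (dirD n q)) x ^ 2 ≤ hessDot q q x := by
  have hn' : n 0 ^ 2 + n 1 ^ 2 = 1 := by
    have := EuclideanSpace.real_norm_sq_eq n
    rw [hn, Fin.sum_univ_two] at this
    linarith
  have h2 : ∀ i, ev (MvPolynomial.pderiv i (dirD n q)) x =
      n 0 * ev (MvPolynomial.pderiv i (MvPolynomial.pderiv 0 q)) x
      + n 1 * ev (MvPolynomial.pderiv i (MvPolynomial.pderiv 1 q)) x := fun i => by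
    simp [dirD, Fin.sum_univ_two, Derivation.leibniz]
  rw [ev_dirD, h2, h2]
  simp only [hessDot, Fin.sum_univ_two]
  generalize ev (MvPolynomial.pderiv 0 (MvPolynomial.pderiv 0 q)) x = a
  generalize ev (MvPolynomial.pderiv 0 (MvPolynomial.pderiv 1 q)) x = b
  generalize ev (MvPolynomial.pderiv 1 (MvPolynomial.pderiv 0 q)) x = c
  generalize ev (MvPolynomial.pderiv 1 (MvPolynomial.pderiv 1 q)) x = d
  generalize n 0 = m at *
  generalize n 1 = k at *
  -- Lagrange's identity exhibits the defect in Cauchy–Schwarz as a square.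
  have e1 : (m * a + k * b) ^ 2 ≤ a ^ 2 + b ^ 2 := by
    have : (m * a + k * b) ^ 2 + (m * b - k * a) ^ 2 = (m ^ 2 + k ^ 2) * (a ^ 2 + b ^ 2) := by ring
    rw [hn'] at this
    nlinarith [sq_nonneg (m * b - k * a)]
  have e2 : (m * c + k * d) ^ 2 ≤ c ^ 2 + d ^ 2 := by
    have : (m * c + k * d) ^ 2 + (m * d - k * c) ^ 2 = (m ^ 2 + k ^ 2) * (c ^ 2 + d ^ 2) := by ring
    rw [hn'] at this
    nlinarith [sq_nonneg (m * d - k * c)]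
  generalize m * a + k * b = X at *
  generalize m * c + k * d = Y at *
  have : (m * X + k * Y) ^ 2 + (m * Y - k * X) ^ 2 = (m ^ 2 + k ^ 2) * (X ^ 2 + Y ^ 2) := by ring
  rw [hn'] at this
  nlinarith [sq_nonneg (m * Y - k * X)]

theorem hessDot_self_nonneg (q : Poly) (x : Plane) : 0 ≤ hessDot q q x :=
  Finset.sum_nonneg fun _ _ => Finset.sum_nonneg fun _ _ => mul_self_nonneg _

@[fun_prop]
theorem continuous_hessDot (q w : Poly) : Continuous (hessDot q w) := by
  unfold hessDot
  fun_prop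

theorem totalDegree_pderiv_le (i : Fin 2) (q : Poly) :
    (MvPolynomial.pderiv i q).totalDegree ≤ q.totalDegree := by
  conv_lhs => rw [q.as_sum, map_sum]
  refine MvPolynomial.totalDegree_finsetSum_le fun s hs => ?_
  rw [MvPolynomial.pderiv_monomial]
  refine (MvPolynomial.totalDegree_monomial_le _ _).trans ?_
  refine le_trans ?_ (MvPolynomial.le_totalDegree hs)
  rw [Finsupp.sum_fintype _ _ (fun _ => rfl), Finsupp.sum_fintype _ _ (fun _ => rfl)]
  exact Finset.sum_le_sum fun j _ => Nat.sub_le _ _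

theorem totalDegree_dirD_le (a : Plane) (q : Poly) : (dirD a q).totalDegree ≤ q.totalDegree := by
  have h : ∀ i, (MvPolynomial.C (a i) * MvPolynomial.pderiv i q).totalDegree ≤ q.totalDegree := by
    intro i
    refine (MvPolynomial.totalDegree_mul _ _).trans ?_
    rw [MvPolynomial.totalDegree_C, zero_add]
    exact totalDegree_pderiv_le i q
  exact MvPolynomial.totalDegree_finsetSum_le fun i _ => h i

/-! ### Bounding values of a polynomial by its mean square on a disc -/

/-- Equivalence of norms in finite dimension: the mean square on the disc is a positive definite
quadratic form in the coefficients, hence at least m‖c‖² with m its minimum on the unit sphere,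
while values are bounded linearly in c. The values are taken on the larger disc of radius 2 because
the edge on which they are needed lies outside the disc of integration. -/
theorem exists_sq_ev_le_integral (p : ℕ) {κ : ℝ} (hκ : 0 < κ) :
    ∃ C : ℝ, 0 < C ∧ ∀ q : Poly, q.totalDegree ≤ p → ∀ y : Plane, ‖y‖ ≤ 2 →
      ev q y ^ 2 ≤ C * ∫ x in Metric.closedBall (0 : Plane) κ, ev q x ^ 2 := by
  let V := MvPolynomial.restrictTotalDegree (Fin 2) ℝ p
  let b := Module.finBasis ℝ V
  let n := Module.finrank ℝ V
  let B : (Fin n → ℝ) → ℝ := fun c =>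
    ∫ x in Metric.closedBall (0 : Plane) κ, (∑ i, c i * ev (b i : Poly) x) ^ 2
  have hB : Continuous B := by
    apply continuous_parametric_integral_of_continuous _ (isCompact_closedBall _ _)
    simp only [Function.uncurry_def]
    fun_prop
  have hsum : ∀ (c : Fin n → ℝ) x, ∑ i, c i * ev (b i : Poly) x
      = ev ((∑ i, c i • b i : V) : Poly) x := fun c x => by
    simp
  have hpos : ∀ c : Fin n → ℝ, c ≠ 0 → 0 < B c := by
    intro c hc
    refine lt_of_le_of_ne (integral_nonneg fun _ => sq_nonneg _) fun h0 => hc ?_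
    have hint : IntegrableOn (fun x : Plane => (∑ i, c i * ev (b i : Poly) x) ^ 2)
        (Metric.ball 0 κ) :=
      ((Continuous.continuousOn (by fun_prop)).integrableOn_compact
        (isCompact_closedBall 0 κ)).mono_set Metric.ball_subset_closedBall
    have h1 : ∫ x in Metric.ball (0 : Plane) κ, (∑ i, c i * ev (b i : Poly) x) ^ 2 = 0 := by
      refine le_antisymm ?_ (integral_nonneg fun _ => sq_nonneg _)
      rw [h0]
      exact setIntegral_mono_set ((Continuous.continuousOn (by fun_prop)).integrableOn_compact
        (isCompact_closedBall 0 κ)) (Eventually.of_forall fun _ => sq_nonneg _)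
        (Metric.ball_subset_closedBall.eventuallyLE)
    have h2 := (setIntegral_eq_zero_iff_of_nonneg_ae
      (Eventually.of_forall fun _ => sq_nonneg _) hint).1 h1
    have h3 := Measure.eqOn_open_of_ae_eq h2 Metric.isOpen_ball
      (Continuous.continuousOn (by fun_prop)) continuousOn_const
    have h4 : ((∑ i, c i • b i : V) : Poly) = 0 :=
      eq_zero_of_ev_eq_zero_on_open Metric.isOpen_ball ⟨0, Metric.mem_ball_self hκ⟩ fun x hx => by
        have := h3 hx
        simp only [Pi.zero_apply, pow_eq_zero_iff, ne_eq, OfNat.ofNat_ne_zero,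
          not_false_eq_true] at this
        rw [← hsum, this]
    have h5 : (∑ i, c i • b i : V) = 0 := Subtype.ext h4
    funext i
    exact Fintype.linearIndependent_iff.1 b.linearIndependent c h5 i
  obtain ⟨m, hm, hmB⟩ : ∃ m > 0, ∀ c : Fin n → ℝ, m * ‖c‖ ^ 2 ≤ B c := by
    -- An empty sphere means that every coefficient vector is zero; treating this case avoids a
    -- discussion of the dimension.
    rcases (Metric.sphere (0 : Fin n → ℝ) 1).eq_empty_or_nonempty with he | hne
    · refine ⟨1, one_pos, fun c => ?_⟩
      have : c = 0 := by
        by_contra hc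
        have : ‖c‖⁻¹ • c ∈ Metric.sphere (0 : Fin n → ℝ) 1 := by
          simp [norm_smul, hc]
        rw [he] at this
        exact this
      subst this
      simp [B]
    · obtain ⟨c0, hc0, hmin⟩ := (isCompact_sphere (0 : Fin n → ℝ) 1).exists_isMinOn hne
        hB.continuousOn
      have hc0' : c0 ≠ 0 := by
        rintro rfl
        simp at hc0
      refine ⟨B c0, hpos c0 hc0', fun c => ?_⟩
      by_cases hc : c = 0
      · subst hc
        simp [B]
      have h1 : B c0 ≤ B (‖c‖⁻¹ • c) := hmin (by simp [norm_smul, hc])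
      have h2 : B c = ‖c‖ ^ 2 * B (‖c‖⁻¹ • c) := by
        simp only [B]
        rw [← integral_const_mul]
        congr 1
        funext x
        have : ∑ i, (‖c‖⁻¹ • c) i * ev (b i : Poly) x = ‖c‖⁻¹ * ∑ i, c i * ev (b i : Poly) x := by
          rw [Finset.mul_sum]
          simp [mul_assoc]
        rw [this]
        have : ‖c‖ ≠ 0 := by simpa using hc
        field_simp
      rw [h2, mul_comm]
      gcongr
  have hM : ∀ i, ∃ M : ℝ, 0 ≤ M ∧ ∀ y : Plane, ‖y‖ ≤ 2 → |ev (b i : Poly) y| ≤ M := fun i => by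
    obtain ⟨M, hM⟩ := (isCompact_closedBall (0 : Plane) 2).exists_bound_of_continuousOn
      (continuous_ev (b i : Poly)).continuousOn
    exact ⟨M, (abs_nonneg _).trans (hM 0 (by simp)), fun y hy => hM y (by simpa using hy)⟩
  choose M hM0 hM using hM
  -- The summand 1 keeps the constant positive whatever the bounds M i are.
  refine ⟨((∑ i, M i) ^ 2 + 1) / m, by positivity, fun q hq y hy => ?_⟩
  let v : V := ⟨q, (MvPolynomial.mem_restrictTotalDegree _ _ _).2 hq⟩
  have hv : ((∑ i, b.repr v i • b i : V) : Poly) = q := by rw [b.sum_repr]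
  have hq' : ∀ x, ev q x = ∑ i, b.repr v i * ev (b i : Poly) x := fun x => by
    rw [hsum, hv]
  have h1 := hmB (b.repr v)
  have h2 : B (b.repr v) = ∫ x in Metric.closedBall (0 : Plane) κ, ev q x ^ 2 := by
    simp only [B, hq']
    rfl
  have h3 : |ev q y| ≤ (∑ i, M i) * ‖(b.repr v : Fin n → ℝ)‖ := by
    rw [hq', Finset.sum_mul]
    refine (Finset.abs_sum_le_sum_abs _ _).trans (Finset.sum_le_sum fun i _ => ?_)
    rw [abs_mul, mul_comm]
    exact mul_le_mul (hM i y hy) (norm_le_pi_norm (b.repr v : Fin n → ℝ) i) (abs_nonneg _) (hM0 i)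
  rw [← h2]
  have h4 : ev q y ^ 2 ≤ (∑ i, M i) ^ 2 * ‖(b.repr v : Fin n → ℝ)‖ ^ 2 := by
    rw [← sq_abs, ← mul_pow]
    gcongr
  calc ev q y ^ 2 ≤ (∑ i, M i) ^ 2 * ‖(b.repr v : Fin n → ℝ)‖ ^ 2 := h4
    _ ≤ ((∑ i, M i) ^ 2 + 1) / m * (m * ‖(b.repr v : Fin n → ℝ)‖ ^ 2) := by
      rw [← mul_assoc, div_mul_cancel₀ _ hm.ne']
      gcongr
      linarith
    _ ≤ _ := by gcongr

/-- The polynomial `y ↦ q (z + L y)`. -/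
noncomputable def substAffine (z : Plane) (L : ℝ) (q : Poly) : Poly :=
  MvPolynomial.bind₁ (fun i => MvPolynomial.C (z i) + MvPolynomial.C L * MvPolynomial.X i) q

theorem ev_substAffine (z : Plane) (L : ℝ) (q : Poly) (y : Plane) :
    ev (substAffine z L q) y = ev q (z + L • y) := by
  simp only [ev, substAffine, MvPolynomial.eval, MvPolynomial.eval₂Hom_bind₁]
  congr 2
  funext i
  simp

theorem totalDegree_substAffine_le (z : Plane) (L : ℝ) (q : Poly) :
    (substAffine z L q).totalDegree ≤ q.totalDegree := by
  have h1 : ∀ i : Fin 2, (MvPolynomial.C (z i) + MvPolynomial.C L * MvPolynomial.X i :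
      Poly).totalDegree ≤ 1 := fun i => by
    refine (MvPolynomial.totalDegree_add _ _).trans (max_le (by simp) ?_)
    refine (MvPolynomial.totalDegree_mul _ _).trans ?_
    simp
  rw [substAffine, MvPolynomial.bind₁, MvPolynomial.aeval_def, MvPolynomial.eval₂_eq']
  refine MvPolynomial.totalDegree_finsetSum_le fun m hm => ?_
  refine (MvPolynomial.totalDegree_mul _ _).trans ?_
  rw [MvPolynomial.algebraMap_eq, MvPolynomial.totalDegree_C, zero_add]
  refine (MvPolynomial.totalDegree_finsetProd _ _).trans ?_
  refine le_trans ?_ (MvPolynomial.le_totalDegree hm)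
  rw [Finsupp.sum_fintype _ _ (fun _ => rfl)]
  refine Finset.sum_le_sum fun i _ => ?_
  refine (MvPolynomial.totalDegree_pow _ _).trans ?_
  simpa using Nat.mul_le_mul_left (m i) (h1 i)

theorem setIntegral_closedBall_eq (f : Plane → ℝ) (z : Plane) {L : ℝ} (hL : 0 < L) (κ : ℝ) :
    ∫ x in Metric.closedBall z (κ * L), f x
      = L ^ 2 * ∫ y in Metric.closedBall (0 : Plane) κ, f (z + L • y) := by
  have h1 := Measure.setIntegral_comp_smul_of_pos (μ := (volume : Measure Plane))
    (fun x => f (z + x)) (Metric.closedBall (0 : Plane) κ) hL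
  have h2 : L • Metric.closedBall (0 : Plane) κ = Metric.closedBall (0 : Plane) (κ * L) := by
    rw [smul_closedBall' hL.ne', smul_zero, Real.norm_of_nonneg hL.le, mul_comm]
  have h3 := (measurePreserving_add_left (volume : Measure Plane) z).setIntegral_preimage_emb
    (measurableEmbedding_addLeft z) f (Metric.closedBall z (κ * L))
  have h4 : (fun x => z + x) ⁻¹' Metric.closedBall z (κ * L)
      = Metric.closedBall (0 : Plane) (κ * L) := by
    ext x
    simp [dist_eq_norm]
  rw [h4] at h3
  rw [h1, h2, h3]
  simp only [finrank_euclideanSpace, Fintype.card_fin, smul_eq_mul]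
  rw [← mul_assoc, mul_inv_cancel₀ (by positivity), one_mul]

/-- Scaling to the reference disc: x = z + L y does not raise the degree, and its Jacobian in the
plane is L². The constant is thus independent of the centre and of the scale. -/
theorem exists_sq_ev_le_integral_closedBall (p : ℕ) {κ : ℝ} (hκ : 0 < κ) :
    ∃ C : ℝ, 0 < C ∧ ∀ q : Poly, q.totalDegree ≤ p → ∀ (z x : Plane) (L : ℝ), 0 < L →
      dist x z ≤ 2 * L →
      L ^ 2 * ev q x ^ 2 ≤ C * ∫ x in Metric.closedBall z (κ * L), ev q x ^ 2 := by
  obtain ⟨C, hC, h⟩ := exists_sq_ev_le_integral p hκ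
  refine ⟨C, hC, fun q hq z x L hL hx => ?_⟩
  have h1 := h (substAffine z L q) ((totalDegree_substAffine_le z L q).trans hq)
    (L⁻¹ • (x - z)) (by
      rw [norm_smul, norm_inv, Real.norm_of_nonneg hL.le, ← dist_eq_norm, inv_mul_le_iff₀ hL]
      linarith)
  simp only [ev_substAffine] at h1
  rw [smul_smul, mul_inv_cancel₀ hL.ne', one_smul, add_sub_cancel] at h1
  rw [setIntegral_closedBall_eq _ _ hL]
  nlinarith [mul_le_mul_of_nonneg_left h1 (sq_nonneg L)]

end ImmersedIP

namespace ImmersedIP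

/-! ### Plane vectors in coordinates -/

theorem inner_eq (a b : Plane) : inner ℝ a b = a 0 * b 0 + a 1 * b 1 := by
  rw [PiLp.inner_apply, Fin.sum_univ_two]
  simp [mul_comm]

theorem norm_sq_eq (a : Plane) : ‖a‖ ^ 2 = a 0 ^ 2 + a 1 ^ 2 := by
  rw [EuclideanSpace.real_norm_sq_eq, Fin.sum_univ_two]

@[simp] theorem rot_apply_zero (a : Plane) : rot a 0 = a 1 := by simp [rot]

@[simp] theorem rot_apply_one (a : Plane) : rot a 1 = -a 0 := by simp [rot]

theorem norm_rot (a : Plane) : ‖rot a‖ = ‖a‖ := by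
  rw [← sq_eq_sq₀ (norm_nonneg _) (norm_nonneg _), norm_sq_eq, norm_sq_eq]
  simp
  ring

/-- The cross product of two plane vectors. -/
def cr (a b : Plane) : ℝ := a 0 * b 1 - a 1 * b 0

theorem inner_rot (a b : Plane) : inner ℝ (rot a) b = -cr a b := by
  rw [inner_eq]
  simp [cr]
  ring

/-- Expansion in the orthogonal frame `e`, `rot e`, since `cr e v` is up to sign the component along
`rot e`. Such identities take the place of angles in what follows. -/
theorem norm_sq_mul_inner (e v w : Plane) :
    ‖e‖ ^ 2 * inner ℝ v w = inner ℝ e v * inner ℝ e w + cr e v * cr e w := by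
  rw [norm_sq_eq, inner_eq, inner_eq, inner_eq, cr, cr]
  ring

theorem norm_sq_mul_norm_sq (e v : Plane) :
    ‖e‖ ^ 2 * ‖v‖ ^ 2 = inner ℝ e v ^ 2 + cr e v ^ 2 := by
  rw [norm_sq_eq, norm_sq_eq, inner_eq, cr]
  ring

theorem abs_cr_le (e v : Plane) : |cr e v| ≤ ‖e‖ * ‖v‖ := by
  refine abs_le_of_sq_le_sq ?_ (by positivity)
  rw [mul_pow, norm_sq_mul_norm_sq]
  nlinarith [sq_nonneg (inner ℝ e v)]

@[fun_prop]
theorem continuous_rot : Continuous rot := by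
  unfold rot
  fun_prop

@[fun_prop]
theorem Continuous.cr {X : Type*} [TopologicalSpace X] {f g : X → Plane} (hf : Continuous f)
    (hg : Continuous g) : Continuous fun x => cr (f x) (g x) := by
  unfold ImmersedIP.cr
  fun_prop

/-- A point with vanishing cross product lies on the line. -/
theorem eq_add_smul_of_cr_eq_zero {e v : Plane} (he : e ≠ 0) (h : cr e v = 0) :
    v = (inner ℝ e v / ‖e‖ ^ 2) • e := by
  have hn : 0 < ‖e‖ ^ 2 := by positivity
  have h2 := norm_sq_eq e
  rw [inner_eq]
  unfold cr at h
  ext i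
  simp only [PiLp.smul_apply, smul_eq_mul]
  rw [div_mul_eq_mul_div, eq_div_iff hn.ne', h2]
  fin_cases i
  · simp
    linear_combination (-e 1) * h
  · simp
    linear_combination (e 0) * h

/-- Two vectors that are nearly opposite cannot both be close in direction to a third one. -/
theorem not_turn {e v v' w : Plane} (he : e ≠ 0) (hw : w ≠ 0)
    (hv : 0 < inner ℝ e v) (hv1 : |cr e v| ≤ 1 / 4 * inner ℝ e v)
    (hv' : inner ℝ e v' < 0) (hv1' : |cr e v'| ≤ -(1 / 4 * inner ℝ e v'))
    (h : 3 / 4 * ‖w‖ * ‖v‖ ≤ inner ℝ w v) (h' : 3 / 4 * ‖w‖ * ‖v'‖ ≤ inner ℝ w v') : False := by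
  have hL : 0 < ‖e‖ := norm_pos_iff.2 he
  have hd : 0 < ‖w‖ := norm_pos_iff.2 hw
  have hc := abs_cr_le e w
  -- A vector u with cosine at least 3/4 to w and slope at most 1/4 to e forces the e-component of w
  -- to have the sign of that of u and size at least (3/4 − 1/4)‖e‖‖w‖. For v and v' the two signs
  -- are opposite.
  have key : ∀ u : Plane, 3 / 4 * ‖w‖ * ‖u‖ ≤ inner ℝ w u →
      |cr e u| ≤ 1 / 4 * |inner ℝ e u| →
      1 / 2 * (‖e‖ * ‖w‖) * |inner ℝ e u| ≤ inner ℝ e u * inner ℝ e w := by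
    intro u hu hu1
    have h1 := norm_sq_mul_inner e u w
    rw [real_inner_comm w u] at h1
    have h2 : |inner ℝ e u| ≤ ‖e‖ * ‖u‖ := abs_real_inner_le_norm _ _
    have h3 : cr e u * cr e w ≤ 1 / 4 * |inner ℝ e u| * (‖e‖ * ‖w‖) := by
      refine (le_abs_self _).trans ?_
      rw [abs_mul]
      gcongr
    have h4 : 3 / 4 * ‖w‖ * |inner ℝ e u| * ‖e‖ ≤ ‖e‖ ^ 2 * inner ℝ w u := by
      calc 3 / 4 * ‖w‖ * |inner ℝ e u| * ‖e‖ ≤ 3 / 4 * ‖w‖ * (‖e‖ * ‖u‖) * ‖e‖ := by gcongr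
        _ = ‖e‖ ^ 2 * (3 / 4 * ‖w‖ * ‖u‖) := by ring
        _ ≤ _ := by gcongr
    nlinarith
  have k1 := key v h (by rwa [abs_of_pos hv])
  have k2 := key v' h' (by rw [abs_of_neg hv']; linarith)
  rw [abs_of_pos hv] at k1
  rw [abs_of_neg hv'] at k2
  have hp : 0 < ‖e‖ * ‖w‖ := by positivity
  have k3 : 1 / 2 * (‖e‖ * ‖w‖) ≤ inner ℝ e w := by
    by_contra hcon
    push Not at hcon
    nlinarith
  nlinarith

/-- The flat open triangle with base `A B`, on the left of the base. -/
def flatTri (c : ℝ) (A B : Plane) : Set Plane :=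
  {X | 0 < cr (B - A) (X - A) ∧ cr (B - A) (X - A) < c * inner ℝ (B - A) (X - A) ∧
    cr (B - A) (X - A) < c * inner ℝ (A - B) (X - B)}

theorem cr_swap (A B X : Plane) : cr (A - B) (X - B) = -cr (B - A) (X - A) := by
  simp [cr]
  ring

theorem inner_swap (A B X : Plane) :
    inner ℝ (A - B) (X - B) = ‖B - A‖ ^ 2 - inner ℝ (B - A) (X - A) := by
  rw [norm_sq_eq, inner_eq, inner_eq]
  simp
  ring

theorem mem_openSegment_of_cr_eq_zero {A B X : Plane} (hAB : B - A ≠ 0)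
    (h : cr (B - A) (X - A) = 0) (h0 : 0 < inner ℝ (B - A) (X - A))
    (h1 : inner ℝ (B - A) (X - A) < ‖B - A‖ ^ 2) : X ∈ openSegment ℝ A B := by
  have hn : 0 < ‖B - A‖ ^ 2 := by positivity
  rw [openSegment_eq_image']
  refine ⟨inner ℝ (B - A) (X - A) / ‖B - A‖ ^ 2, ⟨by positivity, ?_⟩, ?_⟩
  · rwa [div_lt_one hn]
  · change A + _ • (B - A) = X
    rw [← eq_add_smul_of_cr_eq_zero hAB h]
    simp

theorem of_mem_openSegment {A B X : Plane} (hAB : B - A ≠ 0) (h : X ∈ openSegment ℝ A B) :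
    cr (B - A) (X - A) = 0 ∧ 0 < inner ℝ (B - A) (X - A) ∧
      inner ℝ (B - A) (X - A) < ‖B - A‖ ^ 2 := by
  have hn : 0 < ‖B - A‖ ^ 2 := by positivity
  rw [openSegment_eq_image'] at h
  obtain ⟨θ, ⟨h0, h1⟩, rfl⟩ := h
  have : A + θ • (B - A) - A = θ • (B - A) := by simp
  simp only [this, inner_smul_right, real_inner_self_eq_norm_sq]
  refine ⟨by simp [cr]; ring, by positivity, by nlinarith⟩

/-! ### The interface -/

namespace Interface

variable (I : Interface)

theorem hasDerivAt (t : ℝ) : HasDerivAt I.γ (I.tang t) t :=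
  (I.contDiff.differentiable (by norm_num)).differentiableAt.hasDerivAt

@[fun_prop]
theorem continuous_γ : Continuous I.γ := I.contDiff.continuous

@[fun_prop]
theorem continuous_tang : Continuous I.tang := I.contDiff.continuous_deriv (by norm_num)

@[fun_prop]
theorem continuous_nor : Continuous I.nor := continuous_rot.comp I.continuous_tang

theorem norm_tang (t : ℝ) : ‖I.tang t‖ = 1 := I.unit_speed t

theorem norm_nor (t : ℝ) : ‖I.nor t‖ = 1 := by
  rw [nor, norm_rot, I.unit_speed]

theorem nor_eq (t : ℝ) : I.nor t = rot (I.tang t) := rfl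

theorem inner_nor (t : ℝ) (v : Plane) : inner ℝ v (I.nor t) = cr v (I.tang t) := by
  rw [inner_eq, nor_eq, cr]
  simp
  ring

theorem inner_nor' (t : ℝ) (v : Plane) : inner ℝ v (I.nor t) = -cr (I.tang t) v := by
  rw [inner_nor, cr, cr]
  ring

theorem sq_add_sq (t : ℝ) (v : Plane) :
    inner ℝ v (I.tang t) ^ 2 + inner ℝ v (I.nor t) ^ 2 = ‖v‖ ^ 2 := by
  have h := norm_sq_mul_norm_sq (I.tang t) v
  rw [I.norm_tang] at h
  rw [inner_nor', real_inner_comm]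
  linarith

theorem eq_smul_nor (t : ℝ) (v : Plane) (h : inner ℝ v (I.tang t) = 0) :
    v = inner ℝ v (I.nor t) • I.nor t := by
  have h2 : inner ℝ v (I.tang t) • I.tang t + inner ℝ v (I.nor t) • I.nor t = v := by
    have h1 := norm_sq_eq (I.tang t)
    rw [I.norm_tang] at h1
    rw [inner_nor, nor_eq, inner_eq, cr]
    ext i
    fin_cases i
    · simp
      linear_combination (-(v 0)) * h1
    · simp
      linear_combination (-(v 1)) * h1
  rw [h, zero_smul, zero_add] at h2
  exact h2.symm

theorem isCompact_Γ : IsCompact I.Γ := by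
  have : I.Γ = I.γ '' Set.Icc 0 (0 + I.len) := (I.periodic.image_Icc I.len_pos 0).symm
  rw [this]
  exact isCompact_Icc.image I.continuous_γ

theorem mem_Γ (t : ℝ) : I.γ t ∈ I.Γ := ⟨t, rfl⟩

theorem notMem_Γ_iff (x : Plane) : x ∉ I.Γ ↔ ∃ s, x ∈ I.D s := by
  have : x ∉ I.Γ ↔ x ∈ I.D true ∪ I.D false := by rw [I.union_D]; rfl
  rw [this]
  simp [or_comm]

theorem notMem_Γ {x : Plane} {s : Bool} (h : x ∈ I.D s) : x ∉ I.Γ := (I.notMem_Γ_iff x).2 ⟨s, h⟩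

theorem disjoint_D' {x : Plane} {s s' : Bool} (h : x ∈ I.D s) (h' : x ∈ I.D s') : s = s' := by
  have := Set.disjoint_left.1 I.disjoint_D
  cases s <;> cases s' <;> simp_all

theorem hasDerivAt_normSq (y : Plane) (t : ℝ) :
    HasDerivAt (fun t => ‖I.γ t - y‖ ^ 2) (2 * inner ℝ (I.γ t - y) (I.tang t)) t :=
  ((I.hasDerivAt t).sub_const y).norm_sq

/-- Every point has a nearest point on the interface, and is on the normal at this point. -/
theorem exists_nearest (z : Plane) : ∃ (s b : ℝ), z = I.γ s + b • I.nor s ∧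
    ∀ t, |b| ≤ ‖I.γ t - z‖ := by
  obtain ⟨y, ⟨s, rfl⟩, hmin⟩ := I.isCompact_Γ.exists_isMinOn ⟨_, I.mem_Γ 0⟩
    (f := fun y => ‖y - z‖ ^ 2) (by fun_prop)
  have h1 : IsLocalMin (fun t => ‖I.γ t - z‖ ^ 2) s :=
    Eventually.of_forall fun t => hmin (I.mem_Γ t)
  have h2 := h1.hasDerivAt_eq_zero (I.hasDerivAt_normSq z s)
  have h3 : inner ℝ (z - I.γ s) (I.tang s) = 0 := by
    rw [← neg_sub, inner_neg_left]
    linarith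
  have h4 := I.eq_smul_nor s _ h3
  refine ⟨s, inner ℝ (z - I.γ s) (I.nor s), ?_, fun t => ?_⟩
  · rw [← h4]
    simp
  · have h5 : ‖z - I.γ s‖ = |inner ℝ (z - I.γ s) (I.nor s)| := by
      conv_lhs => rw [h4]
      rw [norm_smul, I.norm_nor, mul_one, Real.norm_eq_abs]
    rw [← h5, norm_sub_rev]
    have := hmin (I.mem_Γ t)
    simp only at this
    exact (sq_le_sq₀ (norm_nonneg _) (norm_nonneg _)).1 this

variable {I} {r : ℝ}

namespace IsTubularRadius

/-- The given point lies on the normal segment at γ t and also, at distance |b| ≤ |a| ≤ r, on the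
one at its nearest interface point. Disjointness makes the two feet equal, so the distance to the
interface is exactly |a|. -/
theorem le_norm (hr : I.IsTubularRadius r) (s t : ℝ) {a : ℝ} (ha : |a| ≤ r) :
    |a| ≤ ‖I.γ s - (I.γ t + a • I.nor t)‖ := by
  obtain ⟨s0, b, hz, hb⟩ := I.exists_nearest (I.γ t + a • I.nor t)
  have h1 : ‖I.γ t - (I.γ t + a • I.nor t)‖ = |a| := by
    simp [norm_smul, I.norm_nor]
  have h2 : |b| ≤ |a| := h1 ▸ hb t
  have h3 : I.γ s0 = I.γ t := by
    by_contra hne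
    refine Set.disjoint_left.1 (hr.2 s0 t hne) ⟨b, h2.trans ha, hz⟩ ⟨a, ha, rfl⟩
  have h4 : |b| = |a| := by
    rw [← h1, hz, ← h3]
    simp [norm_smul, I.norm_nor]
  rw [← h4]
  exact hb s

/-- By `le_norm` with a = ±r, the curve stays outside the two balls of radius r tangent to it at γ
t; expanding the square gives the estimate. It serves as the curvature bound. -/
theorem two_mul_inner_le (hr : I.IsTubularRadius r) (s t : ℝ) :
    2 * r * |inner ℝ (I.γ s - I.γ t) (I.nor t)| ≤ ‖I.γ s - I.γ t‖ ^ 2 := by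
  have key : ∀ a : ℝ, |a| = r → 2 * (a * inner ℝ (I.γ s - I.γ t) (I.nor t))
      ≤ ‖I.γ s - I.γ t‖ ^ 2 := by
    intro a ha
    have h1 := hr.le_norm s t ha.le
    have h2 : ‖I.γ s - (I.γ t + a • I.nor t)‖ ^ 2
        = ‖I.γ s - I.γ t‖ ^ 2 - 2 * (a * inner ℝ (I.γ s - I.γ t) (I.nor t)) + a ^ 2 := by
      rw [← sub_sub, @norm_sub_sq ℝ, inner_smul_right, norm_smul, I.norm_nor, mul_one,
        Real.norm_eq_abs, sq_abs]
      simp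
    have h3 : |a| ^ 2 ≤ ‖I.γ s - (I.γ t + a • I.nor t)‖ ^ 2 := by gcongr
    rw [sq_abs] at h3
    linarith
  rcases abs_cases (inner ℝ (I.γ s - I.γ t) (I.nor t)) with ⟨h, -⟩ | ⟨h, -⟩
  · rw [h]
    linarith [key r (abs_of_pos hr.1)]
  · rw [h]
    linarith [key (-r) (by rw [abs_neg, abs_of_pos hr.1])]

/-- Every ball is joined to the others through the curve of centres, a continuous image of the line.
With a = ±r this places all tangent balls of one kind in the same component. -/
theorem isPreconnected_iUnion_ball {r : ℝ} (hr : 0 < r) (a : ℝ) :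
    IsPreconnected (⋃ t, Metric.ball (I.γ t + a • I.nor t) r) := by
  have hp : IsPreconnected (Set.range fun t => I.γ t + a • I.nor t) :=
    isPreconnected_range (by fun_prop)
  refine isPreconnected_of_forall (I.γ 0 + a • I.nor 0) fun y hy => ?_
  obtain ⟨t, ht⟩ := mem_iUnion.1 hy
  refine ⟨(Set.range fun t => I.γ t + a • I.nor t) ∪ Metric.ball (I.γ t + a • I.nor t) r,
    ?_, Or.inl ⟨0, rfl⟩, Or.inr ht, ?_⟩
  · refine union_subset ?_ (subset_iUnion (fun t => Metric.ball (I.γ t + a • I.nor t) r) t)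
    rintro _ ⟨s, rfl⟩
    exact mem_iUnion.2 ⟨s, Metric.mem_ball_self hr⟩
  · exact hp.union _ ⟨t, rfl⟩ (Metric.mem_ball_self hr) (convex_ball _ _).isPreconnected

theorem exists_ball_subset (hr : I.IsTubularRadius r) {a : ℝ} (ha : |a| = r) :
    ∃ s, ∀ t, Metric.ball (I.γ t + a • I.nor t) r ⊆ I.D s := by
  have h1 : (⋃ t, Metric.ball (I.γ t + a • I.nor t) r) ⊆ I.D true ∪ I.D false := by
    rw [I.union_D]
    refine iUnion_subset fun t x hx => ?_
    rintro ⟨s, rfl⟩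
    rw [Metric.mem_ball, dist_eq_norm] at hx
    exact absurd (hr.le_norm s t ha.le) (by rw [ha]; linarith)
  rcases (isPreconnected_iUnion_ball hr.1 a).subset_or_subset (I.isOpen_D true)
    (I.isOpen_D false) I.disjoint_D h1 with h | h
  · exact ⟨true, fun t => (subset_iUnion _ t).trans h⟩
  · exact ⟨false, fun t => (subset_iUnion _ t).trans h⟩

theorem mem_ball_iff {n v x : Plane} (hr : 0 < r) (hn : ‖n‖ = 1) {a : ℝ} (ha : |a| = r) :
    x + v ∈ Metric.ball (x + a • n) r ↔ ‖v‖ ^ 2 < 2 * a * inner ℝ v n := by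
  rw [Metric.mem_ball, dist_eq_norm, add_sub_add_left_eq_sub,
    ← sq_lt_sq₀ (norm_nonneg _) hr.le, @norm_sub_sq ℝ, inner_smul_right, norm_smul, hn, mul_one,
    Real.norm_eq_abs, ha]
  simp only [RCLike.re_to_real]
  constructor <;> intro h <;> linarith

/-- The two sides of the interface, in the tubular neighbourhood. -/
theorem exists_side (hr : I.IsTubularRadius r) : ∃ s, ∀ (t : ℝ) (v : Plane),
    (‖v‖ ^ 2 < 2 * r * inner ℝ v (I.nor t) → I.γ t + v ∈ I.D s) ∧
    (‖v‖ ^ 2 < -(2 * r * inner ℝ v (I.nor t)) → I.γ t + v ∈ I.D !s) := by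
  have ha : |r| = r := abs_of_pos hr.1
  have ha' : |-r| = r := by rw [abs_neg, ha]
  obtain ⟨s, hs⟩ := hr.exists_ball_subset ha
  obtain ⟨s', hs'⟩ := hr.exists_ball_subset ha'
  -- Suppose both families of tangent balls lay on one side. Since `frontier_D` makes γ 0 adherent
  -- to the other side, that side has a point closer than r to the curve; it lies on the normal
  -- through its nearest point, hence in a tangent ball.
  have hne : s' = !s := by
    by_contra hne
    have hss : s' = s := by cases s <;> cases s' <;> simp_all
    subst hss
    have h0 : I.γ 0 ∈ closure (I.D !s') := by
      have : I.γ 0 ∈ frontier (I.D !s') := by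
        rw [I.frontier_D]
        exact ⟨0, rfl⟩
      exact frontier_subset_closure this
    obtain ⟨w, hw, hd⟩ := Metric.mem_closure_iff.1 h0 r hr.1
    obtain ⟨t, b, rfl, hb⟩ := I.exists_nearest w
    have hbr : |b| < r := by
      refine (hb 0).trans_lt ?_
      rwa [← dist_eq_norm]
    have hb0 : b ≠ 0 := by
      rintro rfl
      exact I.notMem_Γ hw (by simpa using I.mem_Γ t)
    have hinner : inner ℝ (b • I.nor t) (I.nor t) = b := by
      rw [real_inner_smul_left, real_inner_self_eq_norm_sq, I.norm_nor]
      ring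
    have hnorm : ‖b • I.nor t‖ ^ 2 = |b| * |b| := by
      rw [norm_smul, I.norm_nor, mul_one, Real.norm_eq_abs, sq]
    have hw' : I.γ t + b • I.nor t ∈ I.D s' := by
      rcases lt_or_gt_of_ne hb0 with h | h
      · refine hs' t ((mem_ball_iff hr.1 (I.norm_nor t) ha').2 ?_)
        rw [hinner, hnorm]
        rw [abs_of_neg h] at hbr ⊢
        nlinarith
      · refine hs t ((mem_ball_iff hr.1 (I.norm_nor t) ha).2 ?_)
        rw [hinner, hnorm]
        rw [abs_of_pos h] at hbr ⊢
        nlinarith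
    have := I.disjoint_D' hw hw'
    cases s' <;> simp_all
  subst hne
  refine ⟨s, fun t v => ⟨fun h => hs t ?_, fun h => hs' t ?_⟩⟩
  · exact (mem_ball_iff hr.1 (I.norm_nor t) ha).2 h
  · refine (mem_ball_iff hr.1 (I.norm_nor t) ha').2 (h.trans_eq (by ring))

end IsTubularRadius

end Interface

end ImmersedIP

namespace ImmersedIP

/-! ### Arcs of the interface -/

/-- The mean value theorem produces a point of positive derivative, and a negative value elsewhere
would force a zero by the intermediate value theorem. It is applied to the squared distance from an
end of an arc. -/
theorem pos_of_ne_zero_of_lt {f f' : ℝ → ℝ} {a b : ℝ} (hf : ∀ x, HasDerivAt f (f' x) x)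
    (hc : Continuous f') (hne : ∀ x ∈ Ioc a b, f' x ≠ 0) (hlt : ∀ x ∈ Ioc a b, f a < f x) :
    ∀ x ∈ Ioc a b, 0 < f' x := by
  intro x hx
  by_contra hneg
  push Not at hneg
  obtain ⟨y, hy, hy'⟩ := exists_hasDerivAt_eq_slope f f' hx.1
    (fun z _ => (hf z).continuousAt.continuousWithinAt) fun z _ => hf z
  have hpos : 0 < f' y := by
    rw [hy']
    exact div_pos (by linarith [hlt x hx]) (by linarith [hx.1])
  obtain ⟨z, hz, hz0⟩ := intermediate_value_Icc' hy.2.le hc.continuousOn ⟨hneg, hpos.le⟩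
  exact hne z ⟨hy.1.trans_le hz.1, hz.2.trans hx.2⟩ hz0

theorem neg_of_ne_zero_of_lt {f f' : ℝ → ℝ} {a b : ℝ} (hf : ∀ x, HasDerivAt f (f' x) x)
    (hc : Continuous f') (hne : ∀ x ∈ Ico a b, f' x ≠ 0) (hlt : ∀ x ∈ Ico a b, f b < f x) :
    ∀ x ∈ Ico a b, f' x < 0 := by
  intro x hx
  have h1 : ∀ y, HasDerivAt (fun y => f (-y)) (-f' (-y)) y := fun y => by
    simpa [Function.comp_def] using (hf (-y)).scomp y (hasDerivAt_neg y)
  have h2 := pos_of_ne_zero_of_lt (a := -b) (b := -a) h1 (by fun_prop)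
    (fun y hy => neg_ne_zero.2 (hne (-y) ⟨by linarith [hy.2], by linarith [hy.1]⟩))
    (fun y hy => by
      simpa using hlt (-y) ⟨by linarith [hy.2], by linarith [hy.1]⟩) (-x)
    ⟨by linarith [hx.2], by linarith [hx.1]⟩
  simpa using h2

namespace Interface

variable {I : Interface} {r : ℝ}

/-- Shifting s into the base period brings t there as well, possibly after removing one more period;
injectivity on the base period then applies. -/
theorem γ_ne {s t : ℝ} (h : s < t) (h' : t < s + I.len) : I.γ t ≠ I.γ s := by
  intro heq
  have hl := I.len_pos
  let n : ℤ := toIcoDiv hl 0 s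
  have hs : s - n • I.len ∈ Ico 0 (0 + I.len) := sub_toIcoDiv_zsmul_mem_Ico hl 0 s
  have e1 : I.γ (s - n • I.len) = I.γ s := I.periodic.sub_zsmul_eq n
  rw [zero_add] at hs
  by_cases hc : t - n • I.len < I.len
  · have e2 : I.γ (t - n • I.len) = I.γ t := I.periodic.sub_zsmul_eq n
    have := I.injOn (show t - n • I.len ∈ Ico 0 I.len from ⟨by linarith [hs.1], hc⟩) hs (by rw [e1, e2, heq])
    linarith
  · push Not at hc
    have e2 : I.γ (t - n • I.len - I.len) = I.γ t := by
      rw [I.periodic.sub_eq, I.periodic.sub_zsmul_eq n]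
    have := I.injOn (show t - n • I.len - I.len ∈ Ico 0 I.len from
      ⟨by linarith, by linarith [hs.2]⟩) hs (by rw [e1, e2, heq])
    linarith

/-- By `two_mul_inner_le` the normal part of the chord is at most 5/8 of its length at this range,
and 1 − 25/64 ≥ (3/4)². -/
theorem inner_tang_sq_ge (hr : I.IsTubularRadius r) (s t : ℝ)
    (h : ‖I.γ s - I.γ t‖ ≤ 5 / 4 * r) :
    (3 / 4 * ‖I.γ s - I.γ t‖) ^ 2 ≤ inner ℝ (I.γ s - I.γ t) (I.tang t) ^ 2 := by
  have h1 := I.sq_add_sq t (I.γ s - I.γ t)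
  have h2 := hr.two_mul_inner_le s t
  have hr0 := hr.1
  rw [← sq_abs (inner ℝ (I.γ s - I.γ t) (I.nor t))] at h1
  have hg : 0 ≤ ‖I.γ s - I.γ t‖ := norm_nonneg _
  generalize ‖I.γ s - I.γ t‖ = g at *
  have hx0 : 0 ≤ |inner ℝ (I.γ s - I.γ t) (I.nor t)| := abs_nonneg _
  generalize |inner ℝ (I.γ s - I.γ t) (I.nor t)| = x at *
  have h3 : 2 * x ≤ 5 / 4 * g := by
    have : 2 * r * x ≤ r * (5 / 4 * g) := h2.trans (by nlinarith)
    nlinarith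
  nlinarith

theorem norm_sub_le_sub {s t : ℝ} (h : s ≤ t) : ‖I.γ t - I.γ s‖ ≤ t - s := by
  have := (convex_univ : Convex ℝ (univ : Set ℝ)).norm_image_sub_le_of_norm_hasDerivWithin_le
    (f := I.γ) (f' := I.tang) (C := 1) (fun x _ => (I.hasDerivAt x).hasDerivWithinAt)
    (fun x _ => (I.norm_tang x).le) (mem_univ s) (mem_univ t)
  rwa [one_mul, Real.norm_of_nonneg (sub_nonneg.2 h)] at this

/-- On a short arc the tangent makes a small angle with the chord. -/
theorem le_inner_tang_of_arc (hr : I.IsTubularRadius r) {t₁ t₂ : ℝ}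
    (hlen : t₂ < t₁ + I.len) (h1 : ∀ t ∈ Icc t₁ t₂, ‖I.γ t - I.γ t₁‖ ≤ 5 / 4 * r)
    (h2 : ∀ t ∈ Icc t₁ t₂, ‖I.γ t - I.γ t₂‖ ≤ 5 / 4 * r) :
    ∀ t ∈ Icc t₁ t₂, 3 / 4 * ‖I.γ t₂ - I.γ t₁‖ ≤ inner ℝ (I.γ t₂ - I.γ t₁) (I.tang t) := by
  have ne1 : ∀ t ∈ Ioc t₁ t₂, I.γ t ≠ I.γ t₁ := fun t ht => γ_ne ht.1 (ht.2.trans_lt hlen)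
  have ne2 : ∀ t ∈ Ico t₁ t₂, I.γ t ≠ I.γ t₂ := fun t ht =>
    (γ_ne ht.2 (by linarith [ht.1])).symm
  -- Within distance 5/4 r the squared distance to γ a has no critical point other than γ a itself.
  -- Along the arc it therefore increases strictly from t₁ and decreases strictly towards t₂.
  have key : ∀ a, ∀ t, I.γ t ≠ I.γ a → ‖I.γ t - I.γ a‖ ≤ 5 / 4 * r →
      2 * inner ℝ (I.γ t - I.γ a) (I.tang t) ≠ 0 := by
    intro a t hne hle h0
    have h3 := inner_tang_sq_ge hr a t (by rwa [norm_sub_rev])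
    have h4 : inner ℝ (I.γ a - I.γ t) (I.tang t) = 0 := by
      rw [← neg_sub, inner_neg_left]
      linarith
    rw [h4, norm_sub_rev] at h3
    have : 0 < ‖I.γ t - I.γ a‖ := norm_pos_iff.2 (sub_ne_zero.2 hne)
    nlinarith
  have p1 := pos_of_ne_zero_of_lt (a := t₁) (b := t₂) (I.hasDerivAt_normSq (I.γ t₁))
    (by fun_prop) (fun t ht => key _ t (ne1 t ht) (h1 t ⟨ht.1.le, ht.2⟩)) (fun t ht => by
      have : 0 < ‖I.γ t - I.γ t₁‖ := norm_pos_iff.2 (sub_ne_zero.2 (ne1 t ht))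
      simp only [sub_self, norm_zero, ne_eq, OfNat.ofNat_ne_zero, not_false_eq_true, zero_pow]
      positivity)
  have p2 := neg_of_ne_zero_of_lt (a := t₁) (b := t₂) (I.hasDerivAt_normSq (I.γ t₂))
    (by fun_prop) (fun t ht => key _ t (ne2 t ht) (h2 t ⟨ht.1, ht.2.le⟩)) (fun t ht => by
      have : 0 < ‖I.γ t - I.γ t₂‖ := norm_pos_iff.2 (sub_ne_zero.2 (ne2 t ht))
      simp only [sub_self, norm_zero, ne_eq, OfNat.ofNat_ne_zero, not_false_eq_true, zero_pow]
      positivity)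
  intro t ht
  have q1 : 3 / 4 * ‖I.γ t - I.γ t₁‖ ≤ inner ℝ (I.γ t - I.γ t₁) (I.tang t) := by
    rcases eq_or_lt_of_le ht.1 with h | h
    · simp [← h]
    · have h3 := inner_tang_sq_ge hr t₁ t (by rw [norm_sub_rev]; exact h1 t ht)
      have h4 := p1 t ⟨h, ht.2⟩
      rw [← neg_sub, norm_neg, inner_neg_left, neg_sq] at h3
      exact (sq_le_sq₀ (by positivity) (by linarith)).1 h3
  have q2 : 3 / 4 * ‖I.γ t₂ - I.γ t‖ ≤ inner ℝ (I.γ t₂ - I.γ t) (I.tang t) := by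
    rcases eq_or_lt_of_le ht.2 with h | h
    · simp [h]
    · have h3 := inner_tang_sq_ge hr t₂ t (by rw [norm_sub_rev]; exact h2 t ht)
      have h4 := p2 t ⟨ht.1, h⟩
      rw [← neg_sub, inner_neg_left] at h4
      exact (sq_le_sq₀ (by positivity) (by linarith)).1 h3
  -- The chord is cut at γ t: the tangent there makes a cosine of at least 3/4 with both pieces, and
  -- the triangle inequality recombines them.
  have e : I.γ t₂ - I.γ t₁ = (I.γ t₂ - I.γ t) + (I.γ t - I.γ t₁) := by abel
  have h5 := norm_add_le (I.γ t₂ - I.γ t) (I.γ t - I.γ t₁)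
  rw [← e] at h5
  have h6 : inner ℝ (I.γ t₂ - I.γ t₁) (I.tang t) = inner ℝ (I.γ t₂ - I.γ t) (I.tang t)
      + inner ℝ (I.γ t - I.γ t₁) (I.tang t) := by rw [← inner_add_left, ← e]
  linarith

/-- Two nearby points of the interface are joined by a short arc. -/
theorem exists_arc (hr : I.IsTubularRadius r) {y₁ y₂ : Plane} (h1 : y₁ ∈ I.Γ) (h2 : y₂ ∈ I.Γ)
    (hne : y₁ ≠ y₂) (hd : ‖y₂ - y₁‖ ≤ 5 / 8 * r) :
    ∃ t₁ t₂, t₁ < t₂ ∧ ((I.γ t₁ = y₁ ∧ I.γ t₂ = y₂) ∨ (I.γ t₁ = y₂ ∧ I.γ t₂ = y₁)) ∧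
      ∀ t ∈ Icc t₁ t₂, 3 / 4 * ‖I.γ t₂ - I.γ t₁‖ ≤ inner ℝ (I.γ t₂ - I.γ t₁) (I.tang t) := by
  have hr0 := hr.1
  have hl := I.len_pos
  obtain ⟨s, rfl⟩ := h1
  obtain ⟨t', rfl⟩ := h2
  obtain ⟨t, ⟨hst, htl⟩, htt'⟩ := I.periodic.exists_mem_Ico hl t' s
  rw [htt'] at hne hd ⊢
  have hst : s < t := lt_of_le_of_ne hst fun h => hne (by rw [h])
  have hend : I.γ (s + I.len) = I.γ s := I.periodic s
  -- One of the two arcs between the points never goes farther from γ s than γ t is. Being within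
  -- 5/8 r of γ s, it is within 5/4 r of both ends, as `le_inner_tang_of_arc` requires.
  by_cases hA : ∀ τ ∈ Icc s t, ‖I.γ τ - I.γ s‖ ≤ ‖I.γ t - I.γ s‖
  · refine ⟨s, t, hst, Or.inl ⟨rfl, rfl⟩, le_inner_tang_of_arc hr htl (fun τ hτ => ?_)
      fun τ hτ => ?_⟩
    · linarith [hA τ hτ]
    · have h3 := norm_sub_le_norm_sub_add_norm_sub (I.γ τ) (I.γ s) (I.γ t)
      rw [norm_sub_rev (I.γ s)] at h3
      linarith [hA τ hτ]
  by_cases hB : ∀ τ ∈ Icc t (s + I.len), ‖I.γ τ - I.γ s‖ ≤ ‖I.γ t - I.γ s‖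
  · refine ⟨t, s + I.len, htl, Or.inr ⟨rfl, hend⟩, le_inner_tang_of_arc hr (by linarith)
      (fun τ hτ => ?_) fun τ hτ => ?_⟩
    · have h3 := norm_sub_le_norm_sub_add_norm_sub (I.γ τ) (I.γ s) (I.γ t)
      rw [norm_sub_rev (I.γ s)] at h3
      linarith [hB τ hτ]
    · rw [hend]
      linarith [hB τ hτ]
  exfalso
  push Not at hA hB
  obtain ⟨a, ha, ha'⟩ := hA
  obtain ⟨b, hb, hb'⟩ := hB
  have hat : a < t := lt_of_le_of_ne ha.2 (by rintro rfl; exact lt_irrefl _ ha')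
  have htb : t < b := lt_of_le_of_ne hb.1 (by rintro rfl; exact lt_irrefl _ hb')
  have hsa : s < a := lt_of_le_of_ne ha.1 (by
    rintro rfl
    simp only [sub_self, norm_zero] at ha'
    exact absurd ha' (not_lt.2 (norm_nonneg _)))
  have hbs : b < s + I.len := lt_of_le_of_ne hb.2 (by
    rintro rfl
    rw [hend] at hb'
    simp only [sub_self, norm_zero] at hb'
    exact absurd hb' (not_lt.2 (norm_nonneg _)))
  -- If both arcs went farther, the distance to γ s would have an interior minimum between a and b,
  -- at a point other than γ s and within 5/8 r of it. `inner_tang_sq_ge` excludes such critical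
  -- points.
  obtain ⟨m, hm, hmin⟩ := isCompact_Icc.exists_isMinOn (s := Icc a b) ⟨t, hat.le, htb.le⟩
    (f := fun t => ‖I.γ t - I.γ s‖ ^ 2) (by fun_prop)
  have hmt : ‖I.γ m - I.γ s‖ ≤ ‖I.γ t - I.γ s‖ :=
    (sq_le_sq₀ (norm_nonneg _) (norm_nonneg _)).1 (hmin ⟨hat.le, htb.le⟩)
  have ham : a < m := lt_of_le_of_ne hm.1 (by rintro rfl; linarith)
  have hmb : m < b := lt_of_le_of_ne hm.2 (by rintro rfl; linarith)
  have h0 := (hmin.isLocalMin (Icc_mem_nhds ham hmb)).hasDerivAt_eq_zero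
    (I.hasDerivAt_normSq (I.γ s) m)
  have h3 := inner_tang_sq_ge hr s m (by rw [norm_sub_rev]; linarith)
  have h4 : inner ℝ (I.γ s - I.γ m) (I.tang m) = 0 := by
    rw [← neg_sub, inner_neg_left]
    linarith
  rw [h4, norm_sub_rev] at h3
  have : 0 < ‖I.γ m - I.γ s‖ :=
    norm_pos_iff.2 (sub_ne_zero.2 (γ_ne (hsa.trans ham) (hmb.trans hbs)))
  nlinarith

/-- The points of such an arc are in a cone with vertex at either end point. -/
theorem le_inner_sub_of_le_inner_tang {t₁ t₂ : ℝ} {w : Plane}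
    (h : ∀ t ∈ Icc t₁ t₂, 3 / 4 * ‖w‖ ≤ inner ℝ w (I.tang t)) {a b : ℝ} (ha : t₁ ≤ a)
    (hab : a ≤ b) (hb : b ≤ t₂) : 3 / 4 * ‖w‖ * ‖I.γ b - I.γ a‖ ≤ inner ℝ w (I.γ b - I.γ a) := by
  have hd : ∀ t, HasDerivAt (fun t => inner ℝ w (I.γ t)) (inner ℝ w (I.tang t)) t := fun t => by
    simpa using (hasDerivAt_const t w).inner ℝ (I.hasDerivAt t)
  have h1 : 3 / 4 * ‖w‖ * (b - a) ≤ inner ℝ w (I.γ b) - inner ℝ w (I.γ a) := by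
    refine (convex_Icc a b).mul_sub_le_image_sub_of_le_deriv
      (fun t _ => (hd t).continuousAt.continuousWithinAt)
      (fun t _ => (hd t).differentiableAt.differentiableWithinAt) (fun t ht => ?_) a
      ⟨le_rfl, hab⟩ b ⟨hab, le_rfl⟩ hab
    rw [interior_Icc] at ht
    rw [(hd t).deriv]
    exact h t ⟨ha.trans ht.1.le, ht.2.le.trans hb⟩
  rw [inner_sub_right]
  refine le_trans ?_ h1
  gcongr
  exact norm_sub_le_sub hab

/-! ### The interface near a segment -/

/-- If the curve met the segment transversally, small steps along the segment in the two directions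
would enter the two tangent balls, hence both sides of the interface. -/
theorem cr_tang_eq_zero (hr : I.IsTubularRadius r) {A B : Plane} {s : Bool}
    (hs : ∀ x ∈ openSegment ℝ A B, x ∉ I.D s) {t : ℝ} (ht : I.γ t ∈ openSegment ℝ A B)
    (hAB : B - A ≠ 0) : cr (B - A) (I.tang t) = 0 := by
  by_contra hcr
  obtain ⟨σ, hσ⟩ := hr.exists_side
  obtain ⟨h0, h1, h2⟩ := of_mem_openSegment hAB ht
  have hn : 0 < ‖B - A‖ ^ 2 := by positivity
  have hr0 := hr.1
  have hcr' : 0 < |cr (B - A) (I.tang t)| := abs_pos.2 hcr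
  have hmem : ∀ ε : ℝ, |ε| * ‖B - A‖ ^ 2 < inner ℝ (B - A) (I.γ t - A) →
      |ε| * ‖B - A‖ ^ 2 < ‖B - A‖ ^ 2 - inner ℝ (B - A) (I.γ t - A) →
      I.γ t + ε • (B - A) ∈ openSegment ℝ A B := by
    intro ε hε1 hε2
    have e1 : I.γ t + ε • (B - A) - A = (I.γ t - A) + ε • (B - A) := by abel
    have e2 : inner ℝ (B - A) (I.γ t + ε • (B - A) - A)
        = inner ℝ (B - A) (I.γ t - A) + ε * ‖B - A‖ ^ 2 := by
      rw [e1, inner_add_right, inner_smul_right, real_inner_self_eq_norm_sq]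
    have l1 : -(|ε| * ‖B - A‖ ^ 2) ≤ ε * ‖B - A‖ ^ 2 := by
      rw [← neg_mul]
      exact mul_le_mul_of_nonneg_right (neg_abs_le ε) hn.le
    have l2 : ε * ‖B - A‖ ^ 2 ≤ |ε| * ‖B - A‖ ^ 2 :=
      mul_le_mul_of_nonneg_right (le_abs_self ε) hn.le
    refine mem_openSegment_of_cr_eq_zero hAB ?_ ?_ ?_
    · rw [e1]
      have : cr (B - A) ((I.γ t - A) + ε • (B - A)) = cr (B - A) (I.γ t - A) := by
        simp [cr]
        ring
      rw [this, h0]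
    · rw [e2]
      linarith
    · rw [e2]
      linarith
  -- The first two bounds keep the step inside the open segment; the third one puts its end into a
  -- tangent ball.
  obtain ⟨ε, hε0, hε⟩ : ∃ ε > 0, ε * ‖B - A‖ ^ 2 < min (min (inner ℝ (B - A) (I.γ t - A))
      (‖B - A‖ ^ 2 - inner ℝ (B - A) (I.γ t - A))) (2 * r * |cr (B - A) (I.tang t)|) := by
    have key : ∀ M : ℝ, 0 < M → ∃ ε > 0, ε * ‖B - A‖ ^ 2 < M := fun M hM => by
      refine ⟨M / (2 * ‖B - A‖ ^ 2), div_pos hM (by positivity), ?_⟩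
      have : M / (2 * ‖B - A‖ ^ 2) * ‖B - A‖ ^ 2 = M / 2 := by field_simp
      linarith
    exact key _ (lt_min (lt_min h1 (by linarith)) (by positivity))
  obtain ⟨hε12, hε3⟩ := lt_min_iff.1 hε
  obtain ⟨hε1, hε2⟩ := lt_min_iff.1 hε12
  have hin : ∀ δ : ℝ, inner ℝ (δ • (B - A)) (I.nor t) = δ * cr (B - A) (I.tang t) := fun δ => by
    rw [real_inner_smul_left, I.inner_nor]
  have hno : ∀ δ : ℝ, ‖δ • (B - A)‖ ^ 2 = δ ^ 2 * ‖B - A‖ ^ 2 := fun δ => by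
    rw [norm_smul, mul_pow, Real.norm_eq_abs, sq_abs]
  have hboth : ∀ s', ∃ x ∈ openSegment ℝ A B, x ∈ I.D s' := by
    have hplus : ∀ δ : ℝ, |δ| = ε → 0 < δ * cr (B - A) (I.tang t) →
        I.γ t + δ • (B - A) ∈ openSegment ℝ A B ∧ I.γ t + δ • (B - A) ∈ I.D σ := by
      intro δ hδ hpos
      refine ⟨hmem δ (by rwa [hδ]) (by rwa [hδ]), (hσ t _).1 ?_⟩
      rw [hin, hno, ← sq_abs δ, hδ]
      have : δ * cr (B - A) (I.tang t) = ε * |cr (B - A) (I.tang t)| := by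
        rw [← abs_of_pos hpos, abs_mul, hδ]
      rw [this]
      nlinarith
    have hminus : ∀ δ : ℝ, |δ| = ε → δ * cr (B - A) (I.tang t) < 0 →
        I.γ t + δ • (B - A) ∈ openSegment ℝ A B ∧ I.γ t + δ • (B - A) ∈ I.D !σ := by
      intro δ hδ hneg
      refine ⟨hmem δ (by rwa [hδ]) (by rwa [hδ]), (hσ t _).2 ?_⟩
      rw [hin, hno, ← sq_abs δ, hδ]
      have : δ * cr (B - A) (I.tang t) = -(ε * |cr (B - A) (I.tang t)|) := by
        rw [← hδ, ← abs_mul, abs_of_neg hneg, neg_neg]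
      rw [this]
      nlinarith
    have ha : |ε| = ε := abs_of_pos hε0
    have ha' : |-ε| = ε := by rw [abs_neg, ha]
    have hσ' : ∃ x ∈ openSegment ℝ A B, x ∈ I.D σ := by
      rcases lt_or_gt_of_ne hcr with h | h
      · exact ⟨_, hplus (-ε) ha' (by nlinarith)⟩
      · exact ⟨_, hplus ε ha (by positivity)⟩
    have hσ'' : ∃ x ∈ openSegment ℝ A B, x ∈ I.D !σ := by
      rcases lt_or_gt_of_ne hcr with h | h
      · exact ⟨_, hminus ε ha (by nlinarith)⟩
      · exact ⟨_, hminus (-ε) ha' (by nlinarith)⟩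
    intro s'
    cases s' <;> cases σ <;> simp_all
  obtain ⟨x, hx, hx'⟩ := hboth s
  exact hs x hx hx'

theorem inner_smul_rot_nor (e : Plane) (t : ℝ) (a : ℝ) :
    inner ℝ (a • rot e) (I.nor t) = a * inner ℝ e (I.tang t) := by
  rw [real_inner_smul_left, nor_eq, inner_eq, inner_eq]
  simp only [rot_apply_zero, rot_apply_one]
  ring

/-- For t near t₀, project γ t perpendicularly onto the line AB. The foot is in the open segment,
and the displacement η is so short, and so nearly normal to the curve, that the foot is in a tangent
ball at γ t. The side of the foot is decided by the sign of εη, that is, by the side of the line on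
which γ t is. -/
theorem eventually_side {σ : Bool} (hr0 : 0 < r) (hσ : ∀ (t : ℝ) (v : Plane),
    (‖v‖ ^ 2 < 2 * r * inner ℝ v (I.nor t) → I.γ t + v ∈ I.D σ) ∧
    (‖v‖ ^ 2 < -(2 * r * inner ℝ v (I.nor t)) → I.γ t + v ∈ I.D !σ))
    {A B : Plane} (hAB : B - A ≠ 0) {t₀ : ℝ} (h₀ : I.γ t₀ ∈ openSegment ℝ A B) {ε : ℝ}
    (hε : |ε| = 1) (hpos : 0 < ε * inner ℝ (B - A) (I.tang t₀)) :
    ∀ᶠ t in 𝓝 t₀, (0 < ε * cr (B - A) (I.γ t - A) → ∃ x ∈ openSegment ℝ A B, x ∈ I.D σ) ∧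
      (ε * cr (B - A) (I.γ t - A) < 0 → ∃ x ∈ openSegment ℝ A B, x ∈ I.D !σ) := by
  obtain ⟨h0, h1, h2⟩ := of_mem_openSegment hAB h₀
  have hn : 0 < ‖B - A‖ ^ 2 := by positivity
  have c1 : ∀ᶠ t in 𝓝 t₀, 0 < inner ℝ (B - A) (I.γ t - A) :=
    (by fun_prop : Continuous fun t => inner ℝ (B - A) (I.γ t - A)).continuousAt.eventually_const_lt h1
  have c2 : ∀ᶠ t in 𝓝 t₀, inner ℝ (B - A) (I.γ t - A) < ‖B - A‖ ^ 2 :=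
    (by fun_prop : Continuous fun t => inner ℝ (B - A) (I.γ t - A)).continuousAt.eventually_lt_const h2
  have c3 : ∀ᶠ t in 𝓝 t₀, |cr (B - A) (I.γ t - A)|
      < 2 * r * (ε * inner ℝ (B - A) (I.tang t)) := by
    refine ContinuousAt.eventually_lt (Continuous.continuousAt (by fun_prop))
      (Continuous.continuousAt (by fun_prop)) ?_
    rw [h0, abs_zero]
    positivity
  filter_upwards [c1, c2, c3] with t ht1 ht2 ht3
  set η := cr (B - A) (I.γ t - A)
  have hε2 : ε * ε = 1 := by rw [← abs_mul_abs_self, hε, one_mul]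
  have hmem : I.γ t + (η / ‖B - A‖ ^ 2) • rot (B - A) ∈ openSegment ℝ A B := by
    have e1 : inner ℝ (B - A) (I.γ t + (η / ‖B - A‖ ^ 2) • rot (B - A) - A)
        = inner ℝ (B - A) (I.γ t - A) := by
      rw [inner_eq, inner_eq]
      simp
      ring
    refine mem_openSegment_of_cr_eq_zero hAB ?_ (by rwa [e1]) (by rwa [e1])
    have e2 : cr (B - A) (I.γ t + (η / ‖B - A‖ ^ 2) • rot (B - A) - A)
        = η - (η / ‖B - A‖ ^ 2) * ‖B - A‖ ^ 2 := by
      rw [norm_sq_eq]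
      simp only [η, cr]
      simp
      ring
    rw [e2, div_mul_cancel₀ _ hn.ne', sub_self]
  have hno : ‖(η / ‖B - A‖ ^ 2) • rot (B - A)‖ ^ 2 = η ^ 2 / ‖B - A‖ ^ 2 := by
    rw [norm_smul, mul_pow, norm_rot, Real.norm_eq_abs, sq_abs, div_pow]
    field_simp
  have hη : η ^ 2 = |η| * |η| := by rw [← sq_abs, sq]
  refine ⟨fun h => ⟨_, hmem, (hσ t _).1 ?_⟩, fun h => ⟨_, hmem, (hσ t _).2 ?_⟩⟩
  · rw [inner_smul_rot_nor, hno, div_mul_eq_mul_div, mul_div_assoc', div_lt_div_iff_of_pos_right hn]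
    have e : |η| = ε * η := by rw [← abs_of_pos h, abs_mul, hε, one_mul]
    rw [e] at ht3
    have := mul_lt_mul_of_pos_left ht3 h
    linear_combination this + (2 * r * η * inner ℝ (B - A) (I.tang t) - η ^ 2) * hε2
  · rw [inner_smul_rot_nor, hno, div_mul_eq_mul_div, mul_div_assoc', ← neg_div,
      div_lt_div_iff_of_pos_right hn]
    have e : |η| = -(ε * η) := by rw [← abs_of_neg h, abs_mul, hε, one_mul]
    rw [e] at ht3
    have := mul_lt_mul_of_pos_left ht3 (neg_pos.2 h)
    linear_combination this - (2 * r * η * inner ℝ (B - A) (I.tang t) + η ^ 2) * hε2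

end Interface

end ImmersedIP

/-! ### Arcs that cross a segment -/

namespace ImmersedIP

theorem cr_add_smul_rot (e y A : Plane) (k : ℝ) :
    cr e (y + k • rot e - A) = cr e (y - A) - k * ‖e‖ ^ 2 := by
  rw [norm_sq_eq, cr, cr]
  simp only [PiLp.add_apply, PiLp.sub_apply, PiLp.smul_apply, smul_eq_mul, rot_apply_zero,
    rot_apply_one]
  ring

namespace Interface

variable {I : Interface} {r : ℝ}

/-- Relative to the base, the feet of the two points differ by at most 1 and their heights by at
most 1/8 + 1/8, and 1 + 1/16 ≤ (5/4)². For a base of length at most r/2 this gives the 5/8 r of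
`exists_arc`. -/
theorem norm_sub_le_of_mem_flatTri {c : ℝ} (hc : c ≤ 1 / 4) {A B y₁ y₂ : Plane}
    (h1 : y₁ ∈ flatTri c A B) (h2 : y₂ ∈ flatTri c B A) : ‖y₂ - y₁‖ ≤ 5 / 4 * ‖B - A‖ := by
  obtain ⟨a1, a2, a3⟩ := h1
  obtain ⟨b1, b2, b3⟩ := h2
  rw [inner_swap] at a3 b2
  rw [cr_swap] at b1 b2 b3
  have hx1 : cr (B - A) (y₁ - A) < 1 / 8 * ‖B - A‖ ^ 2 := by nlinarith
  have hx2 : -cr (B - A) (y₂ - A) < 1 / 8 * ‖B - A‖ ^ 2 := by nlinarith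
  have hc0 : 0 < c := by
    by_contra h
    push Not at h
    nlinarith [sq_nonneg ‖B - A‖]
  have p1 : 0 < inner ℝ (B - A) (y₁ - A) := by
    by_contra h
    push Not at h
    nlinarith
  have p2 : 0 < inner ℝ (B - A) (y₂ - A) := by
    by_contra h
    push Not at h
    nlinarith
  have p3 : inner ℝ (B - A) (y₁ - A) < ‖B - A‖ ^ 2 := by
    by_contra h
    push Not at h
    nlinarith
  have p4 : inner ℝ (B - A) (y₂ - A) < ‖B - A‖ ^ 2 := by
    by_contra h
    push Not at h
    nlinarith
  have e : y₂ - y₁ = (y₂ - A) - (y₁ - A) := by abel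
  have e1 : inner ℝ (B - A) (y₂ - y₁) = inner ℝ (B - A) (y₂ - A) - inner ℝ (B - A) (y₁ - A) := by
    rw [e, inner_sub_right]
  have e2 : cr (B - A) (y₂ - y₁) = cr (B - A) (y₂ - A) - cr (B - A) (y₁ - A) := by
    simp only [cr, PiLp.sub_apply]
    ring
  have h := norm_sq_mul_norm_sq (B - A) (y₂ - y₁)
  rw [e1, e2] at h
  have hn : 0 < ‖B - A‖ ^ 2 := by linarith
  have hL : 0 < ‖B - A‖ := by
    rcases (norm_nonneg (B - A)).eq_or_lt with h | h
    · rw [← h] at hn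
      norm_num at hn
    · exact h
  have hf : (‖B - A‖ * ‖y₂ - y₁‖) ^ 2 ≤ (‖B - A‖ * (5 / 4 * ‖B - A‖)) ^ 2 := by
    have q1 : (inner ℝ (B - A) (y₂ - A) - inner ℝ (B - A) (y₁ - A)) ^ 2
        ≤ (‖B - A‖ ^ 2) ^ 2 := by
      apply sq_le_sq' <;> linarith
    have q2 : (cr (B - A) (y₂ - A) - cr (B - A) (y₁ - A)) ^ 2 ≤ (1 / 4 * ‖B - A‖ ^ 2) ^ 2 := by
      apply sq_le_sq' <;> linarith
    rw [mul_pow, h]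
    nlinarith
  have := (sq_le_sq₀ (by positivity) (by positivity)).1 hf
  exact le_of_mul_le_mul_left this hL

/-- The arc must cross the line AB, and it can do so only within the open segment. There its tangent
is along the segment, directed like the chord. Just before the first crossing the arc is above the
line, just after the last one it is below, so `eventually_side` produces points of both sides of the
interface on the segment. -/
theorem not_arc_across (hr : I.IsTubularRadius r) {c : ℝ} (hc : c ≤ 1 / 4) {A B : Plane}
    (hAB : B - A ≠ 0) {s : Bool} (hs : ∀ x ∈ openSegment ℝ A B, x ∉ I.D s) {t₁ t₂ : ℝ}
    (h12 : t₁ < t₂) (h1 : I.γ t₁ ∈ flatTri c A B) (h2 : I.γ t₂ ∈ flatTri c B A)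
    (harc : ∀ t ∈ Icc t₁ t₂,
      3 / 4 * ‖I.γ t₂ - I.γ t₁‖ ≤ inner ℝ (I.γ t₂ - I.γ t₁) (I.tang t)) : False := by
  obtain ⟨a1, a2, a3⟩ := h1
  obtain ⟨b1, b2, b3⟩ := h2
  rw [inner_swap] at a3 b2
  rw [cr_swap] at b1 b2 b3
  have hn : 0 < ‖B - A‖ ^ 2 := by positivity
  have hw : I.γ t₂ - I.γ t₁ ≠ 0 := by
    intro h
    rw [sub_eq_zero.1 h] at b1
    linarith
  have hc0 : 0 < c := by
    by_contra h
    push Not at h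
    nlinarith
  have hcont : Continuous fun t => cr (B - A) (I.γ t - A) := by fun_prop
  -- To cross beyond an end of the segment the arc would have to leave the first flat triangle
  -- outwards and come back into the second one, both times with slope at most 1/4 to the base;
  -- `not_turn` forbids this.
  have hopen : ∀ t ∈ Icc t₁ t₂, cr (B - A) (I.γ t - A) = 0 → I.γ t ∈ openSegment ℝ A B := by
    intro t ht h0
    have g1 := le_inner_sub_of_le_inner_tang harc le_rfl ht.1 ht.2
    have g2 := le_inner_sub_of_le_inner_tang harc ht.1 ht.2 le_rfl
    have e1 : I.γ t - I.γ t₁ = (I.γ t - A) - (I.γ t₁ - A) := by abel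
    have e2 : I.γ t₂ - I.γ t = (I.γ t₂ - A) - (I.γ t - A) := by abel
    have c1 : cr (B - A) (I.γ t - I.γ t₁) = -cr (B - A) (I.γ t₁ - A) := by
      rw [← zero_sub, ← h0]
      simp only [cr, PiLp.sub_apply]
      ring
    have c2 : cr (B - A) (I.γ t₂ - I.γ t) = cr (B - A) (I.γ t₂ - A) := by
      rw [← sub_zero (cr (B - A) (I.γ t₂ - A)), ← h0]
      simp only [cr, PiLp.sub_apply]
      ring
    have i1 : inner ℝ (B - A) (I.γ t - I.γ t₁)
        = inner ℝ (B - A) (I.γ t - A) - inner ℝ (B - A) (I.γ t₁ - A) := by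
      rw [e1, inner_sub_right]
    have i2 : inner ℝ (B - A) (I.γ t₂ - I.γ t)
        = inner ℝ (B - A) (I.γ t₂ - A) - inner ℝ (B - A) (I.γ t - A) := by
      rw [e2, inner_sub_right]
    have n1 : |cr (B - A) (I.γ t - I.γ t₁)| = cr (B - A) (I.γ t₁ - A) := by
      rw [c1, abs_neg, abs_of_pos a1]
    have n2 : |cr (B - A) (I.γ t₂ - I.γ t)| = -cr (B - A) (I.γ t₂ - A) := by
      rw [c2, abs_of_neg (by linarith)]
    refine mem_openSegment_of_cr_eq_zero hAB h0 ?_ ?_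
    · by_contra hcon
      push Not at hcon
      have k1 : ∀ u, inner ℝ (A - B) u = -inner ℝ (B - A) u := fun u => by
        rw [← neg_sub, inner_neg_left]
      have k2 : ∀ u, |cr (A - B) u| = |cr (B - A) u| := fun u => by
        rw [← abs_neg]
        congr 1
        simp only [cr, PiLp.sub_apply]
        ring
      refine not_turn (e := A - B) (v := I.γ t - I.γ t₁) (v' := I.γ t₂ - I.γ t)
        (sub_ne_zero.2 (sub_ne_zero.1 hAB).symm) hw ?_ ?_ ?_ ?_ g1 g2
      · rw [k1, i1]
        nlinarith
      · rw [k1, k2, n1, i1]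
        nlinarith
      · rw [k1, i2]
        nlinarith
      · rw [k1, k2, n2, i2]
        nlinarith
    · by_contra hcon
      push Not at hcon
      refine not_turn (e := B - A) (v := I.γ t - I.γ t₁) (v' := I.γ t₂ - I.γ t) hAB hw
        ?_ ?_ ?_ ?_ g1 g2
      · rw [i1]
        nlinarith
      · rw [n1, i1]
        nlinarith
      · rw [i2]
        nlinarith
      · rw [n2, i2]
        nlinarith
  -- p is the first time at or below the line and q the last time at or above it. Two times are used
  -- because the curve may touch the segment repeatedly or run along it.
  obtain ⟨p, hp, hpl⟩ := (isCompact_Icc.inter_right (isClosed_le hcont continuous_const) :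
    IsCompact (Icc t₁ t₂ ∩ {t | cr (B - A) (I.γ t - A) ≤ 0})).exists_isLeast
    ⟨t₂, ⟨h12.le, le_rfl⟩, by simp only [mem_ofPred_eq]; linarith⟩
  obtain ⟨q, hq, hql⟩ := (isCompact_Icc.inter_right (isClosed_le continuous_const hcont) :
    IsCompact (Icc t₁ t₂ ∩ {t | 0 ≤ cr (B - A) (I.γ t - A)})).exists_isGreatest
    ⟨t₁, ⟨le_rfl, h12.le⟩, by simp only [mem_ofPred_eq]; linarith⟩
  have hp0 : cr (B - A) (I.γ p - A) = 0 := by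
    obtain ⟨t, ht, ht0⟩ := intermediate_value_Icc' hp.1.1 hcont.continuousOn ⟨hp.2, a1.le⟩
    have := hpl ⟨⟨ht.1, ht.2.trans hp.1.2⟩, le_of_eq ht0⟩
    rwa [le_antisymm ht.2 this] at ht0
  have hq0 : cr (B - A) (I.γ q - A) = 0 := by
    obtain ⟨t, ht, ht0⟩ := intermediate_value_Icc' hq.1.2 hcont.continuousOn
      ⟨by linarith, hq.2⟩
    have := hql ⟨⟨hq.1.1.trans ht.1, ht.2⟩, ge_of_eq ht0⟩
    rwa [le_antisymm this ht.1] at ht0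
  have hp1 : t₁ < p := lt_of_le_of_ne hp.1.1 (by rintro rfl; linarith)
  have hq2 : q < t₂ := lt_of_le_of_ne hq.1.2 (by rintro rfl; linarith)
  have hpo := hopen p hp.1 hp0
  have hqo := hopen q hq.1 hq0
  obtain ⟨σ, hσ⟩ := hr.exists_side
  have hd : 0 < ‖I.γ t₂ - I.γ t₁‖ := norm_pos_iff.2 hw
  -- At points of the segment the tangent is parallel to it, so it points along the base in the same
  -- direction as the chord. One sign ε thus serves at both p and q.
  have hdir : ∀ t ∈ Icc t₁ t₂, I.γ t ∈ openSegment ℝ A B →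
      0 < inner ℝ (B - A) (I.γ t₂ - I.γ t₁) * inner ℝ (B - A) (I.tang t) := by
    intro t ht hto
    have h3 := harc t ht
    have h4 := norm_sq_mul_inner (B - A) (I.γ t₂ - I.γ t₁) (I.tang t)
    rw [cr_tang_eq_zero hr hs hto hAB, mul_zero, add_zero] at h4
    rw [← h4]
    have : 0 < inner ℝ (I.γ t₂ - I.γ t₁) (I.tang t) := by linarith
    positivity
  obtain ⟨ε, hε, hε'⟩ : ∃ ε : ℝ, (ε = 1 ∨ ε = -1) ∧
      0 < ε * inner ℝ (B - A) (I.γ t₂ - I.γ t₁) := by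
    rcases lt_trichotomy (inner ℝ (B - A) (I.γ t₂ - I.γ t₁)) 0 with h | h | h
    · exact ⟨-1, Or.inr rfl, by linarith⟩
    · have := hdir p hp.1 hpo
      rw [h, zero_mul] at this
      exact absurd this (lt_irrefl _)
    · exact ⟨1, Or.inl rfl, by linarith⟩
  have hεa : |ε| = 1 := by rcases hε with rfl | rfl <;> simp
  have hpos : ∀ t ∈ Icc t₁ t₂, I.γ t ∈ openSegment ℝ A B →
      0 < ε * inner ℝ (B - A) (I.tang t) := by
    intro t ht hto
    have h3 := hdir t ht hto
    rcases hε with rfl | rfl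
    · rw [one_mul] at hε' ⊢
      exact (mul_pos_iff_of_pos_left hε').1 h3
    · nlinarith
  have evp := eventually_side hr.1 hσ hAB hpo hεa (hpos p hp.1 hpo)
  have evq := eventually_side hr.1 hσ hAB hqo hεa (hpos q hq.1 hqo)
  obtain ⟨t, ht, ht'⟩ := ((evp.filter_mono nhdsWithin_le_nhds).and
    (Ioo_mem_nhdsLT hp1)).exists
  obtain ⟨u, hu, hu'⟩ := ((evq.filter_mono nhdsWithin_le_nhds).and
    (Ioo_mem_nhdsGT hq2)).exists
  have htpos : 0 < cr (B - A) (I.γ t - A) := by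
    by_contra h
    push Not at h
    linarith [hpl ⟨⟨ht'.1.le, ht'.2.le.trans hp.1.2⟩, h⟩, ht'.2]
  have huneg : cr (B - A) (I.γ u - A) < 0 := by
    by_contra h
    push Not at h
    linarith [hql ⟨⟨hq.1.1.trans hu'.1.le, hu'.2.le⟩, h⟩, hu'.1]
  have hboth : (∃ x ∈ openSegment ℝ A B, x ∈ I.D σ) ∧ ∃ x ∈ openSegment ℝ A B, x ∈ I.D !σ := by
    rcases hε with rfl | rfl
    · exact ⟨ht.1 (by linarith), hu.2 (by linarith)⟩
    · exact ⟨hu.1 (by linarith), ht.2 (by linarith)⟩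
  obtain ⟨⟨x, hx, hx'⟩, y, hy, hy'⟩ := hboth
  by_cases h : s = σ
  · subst h
    exact hs x hx hx'
  · have : s = !σ := by revert h; cases s <;> cases σ <;> simp
    subst this
    exact hs y hy hy'

/-- If an open segment does not meet one of the sides of the interface, then the interface misses
one of the two flat triangles over the segment. -/
theorem disjoint_flatTri_or (hr : I.IsTubularRadius r) {c : ℝ} (hc : c ≤ 1 / 4) {A B : Plane}
    (hAB : A ≠ B) (hL : ‖B - A‖ ≤ r / 2) {s : Bool}
    (hs : ∀ x ∈ openSegment ℝ A B, x ∉ I.D s) :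
    Disjoint (flatTri c A B) I.Γ ∨ Disjoint (flatTri c B A) I.Γ := by
  by_contra hcon
  rw [not_or, Set.not_disjoint_iff, Set.not_disjoint_iff] at hcon
  obtain ⟨⟨y₁, h1, h1'⟩, y₂, h2, h2'⟩ := hcon
  have hd := norm_sub_le_of_mem_flatTri hc h1 h2
  have hne : y₁ ≠ y₂ := by
    rintro rfl
    have a := h1.1
    have b := h2.1
    rw [cr_swap] at b
    linarith
  obtain ⟨t₁, t₂, h12, ⟨rfl, rfl⟩ | ⟨rfl, rfl⟩, harc⟩ := exists_arc hr h1' h2' hne (by linarith)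
  · exact not_arc_across hr hc (sub_ne_zero.2 hAB.symm) hs h12 h1 h2 harc
  · exact not_arc_across hr hc (sub_ne_zero.2 hAB) (by rwa [openSegment_symm]) h12 h2 h1 harc

/-- The interface misses the flat triangles over a segment that is part of it. -/
theorem disjoint_flatTri_of_subset (hr : I.IsTubularRadius r) {c : ℝ} (hc : c ≤ 1 / 4)
    {A B : Plane} (hAB : A ≠ B) (hL : ‖B - A‖ ≤ r / 2) (h : openSegment ℝ A B ⊆ I.Γ) :
    Disjoint (flatTri c A B) I.Γ := by
  rw [Set.disjoint_left]
  rintro y ⟨a1, a2, a3⟩ hy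
  have hAB' : B - A ≠ 0 := sub_ne_zero.2 hAB.symm
  have hLpos : 0 < ‖B - A‖ := norm_pos_iff.2 hAB'
  have hn : 0 < ‖B - A‖ ^ 2 := by positivity
  rw [inner_swap] at a3
  have hc0 : 0 < c := by
    by_contra h
    push Not at h
    nlinarith
  have p1 : 0 < inner ℝ (B - A) (y - A) := by
    by_contra h
    push Not at h
    nlinarith
  have p2 : inner ℝ (B - A) (y - A) < ‖B - A‖ ^ 2 := by
    by_contra h
    push Not at h
    nlinarith
  set η := cr (B - A) (y - A)
  have hη : η < 1 / 8 * ‖B - A‖ ^ 2 := by nlinarith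
  -- v is the perpendicular from the base to y. Its foot is on the interface, whose normal there is
  -- perpendicular to the base, and v is short compared with r, so y lies in a tangent ball at the
  -- foot.
  set v : Plane := (-(η / ‖B - A‖ ^ 2)) • rot (B - A)
  have hm : y - v ∈ openSegment ℝ A B := by
    have e1 : inner ℝ (B - A) (y - v - A) = inner ℝ (B - A) (y - A) := by
      rw [inner_eq, inner_eq]
      simp [v]
      ring
    refine mem_openSegment_of_cr_eq_zero hAB' ?_ (by rwa [e1]) (by rwa [e1])
    have e2 : cr (B - A) (y - v - A) = η - (η / ‖B - A‖ ^ 2) * ‖B - A‖ ^ 2 := by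
      simp only [v, neg_smul, sub_neg_eq_add]
      exact cr_add_smul_rot _ _ _ _
    rw [e2, div_mul_cancel₀ _ hn.ne', sub_self]
  obtain ⟨t, ht⟩ := h hm
  have hD : ∀ x ∈ openSegment ℝ A B, x ∉ I.D true := fun x hx hx' => I.notMem_Γ hx' (h hx)
  have hcr := cr_tang_eq_zero hr hD (by rw [ht]; exact hm) hAB'
  have hin := norm_sq_mul_norm_sq (B - A) (I.tang t)
  rw [hcr, I.norm_tang] at hin
  have hin' : |inner ℝ (B - A) (I.tang t)| = ‖B - A‖ := by
    rw [← abs_of_pos hLpos, ← sq_eq_sq_iff_abs_eq_abs]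
    linarith
  obtain ⟨σ, hσ⟩ := hr.exists_side
  have hyv : I.γ t + v = y := by rw [ht]; abel
  have hno : ‖v‖ ^ 2 = η ^ 2 / ‖B - A‖ ^ 2 := by
    simp only [v]
    rw [norm_smul, mul_pow, norm_rot, Real.norm_eq_abs, sq_abs, neg_sq, div_pow]
    field_simp
  have hlt : ‖v‖ ^ 2 < 2 * r * |inner ℝ v (I.nor t)| := by
    rw [inner_smul_rot_nor, hno, abs_mul, hin', abs_neg, abs_of_pos (by positivity)]
    rw [div_mul_eq_mul_div, mul_div_assoc', div_lt_div_iff_of_pos_right hn]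
    have : η < 2 * r * ‖B - A‖ := by nlinarith
    nlinarith
  rcases abs_cases (inner ℝ v (I.nor t)) with ⟨h1, -⟩ | ⟨h1, -⟩
  · rw [h1] at hlt
    exact I.notMem_Γ (hyv ▸ (hσ t v).1 hlt) hy
  · rw [h1] at hlt
    exact I.notMem_Γ (hyv ▸ (hσ t v).2 (by linarith)) hy

end Interface

end ImmersedIP

namespace ImmersedIP

/-! ### Flat triangles -/

theorem norm_sq_mul_cr (e v u : Plane) :
    ‖e‖ ^ 2 * cr v u = inner ℝ e v * cr e u - cr e v * inner ℝ e u := by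
  rw [norm_sq_eq, inner_eq, inner_eq, cr, cr, cr]
  ring

theorem convex_flatTri (c : ℝ) (A B : Plane) : Convex ℝ (flatTri c A B) := by
  have h1 : ∀ u v w : ℝ, Convex ℝ {X : Plane | u * X 0 + v * X 1 < w} := fun u v w => by
    have hl : IsLinearMap ℝ (fun X : Plane => u * X 0 + v * X 1) :=
      ⟨fun x y => by simp; ring, fun a x => by simp; ring⟩
    exact convex_halfSpace_lt hl w
  have e : flatTri c A B =
      {X : Plane | (B - A) 1 * X 0 + -(B - A) 0 * X 1 < (B - A) 1 * A 0 - (B - A) 0 * A 1} ∩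
      ({X : Plane | (-(B - A) 1 - c * (B - A) 0) * X 0 + ((B - A) 0 - c * (B - A) 1) * X 1
        < (-(B - A) 1 - c * (B - A) 0) * A 0 + ((B - A) 0 - c * (B - A) 1) * A 1} ∩
      {X : Plane | (-(B - A) 1 + c * (B - A) 0) * X 0 + ((B - A) 0 + c * (B - A) 1) * X 1
        < (-(B - A) 1) * A 0 + ((B - A) 0) * A 1 + c * ((B - A) 0 * B 0 + (B - A) 1 * B 1)}) := by
    ext X
    simp only [flatTri, mem_inter_iff, mem_ofPred_eq, cr, inner_eq, PiLp.sub_apply]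
    refine and_congr ?_ (and_congr ?_ ?_) <;> constructor <;> intro h <;> linarith
  rw [e]
  exact (h1 _ _ _).inter ((h1 _ _ _).inter (h1 _ _ _))

/-- Points just to the left of the base are in the flat triangle. -/
theorem eventually_mem_flatTri {c : ℝ} (hc : 0 < c) {A B x v : Plane} (hAB : A ≠ B)
    (hx : x ∈ openSegment ℝ A B) (hv : 0 < cr (B - A) v) :
    ∀ᶠ ε in 𝓝[>] (0 : ℝ), x + ε • v ∈ flatTri c A B := by
  obtain ⟨h0, h1, h2⟩ := of_mem_openSegment (sub_ne_zero.2 hAB.symm) hx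
  have k1 : ∀ᶠ ε in 𝓝 (0 : ℝ), cr (B - A) (x + ε • v - A)
      < c * inner ℝ (B - A) (x + ε • v - A) := by
    refine ContinuousAt.eventually_lt (Continuous.continuousAt (by fun_prop))
      (Continuous.continuousAt (by fun_prop)) ?_
    simp only [zero_smul, add_zero, h0]
    positivity
  have k2 : ∀ᶠ ε in 𝓝 (0 : ℝ), cr (B - A) (x + ε • v - A)
      < c * inner ℝ (A - B) (x + ε • v - B) := by
    refine ContinuousAt.eventually_lt (Continuous.continuousAt (by fun_prop))
      (Continuous.continuousAt (by fun_prop)) ?_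
    simp only [zero_smul, add_zero, h0]
    rw [inner_swap]
    exact mul_pos hc (by linarith)
  filter_upwards [k1.filter_mono nhdsWithin_le_nhds, k2.filter_mono nhdsWithin_le_nhds,
    self_mem_nhdsWithin] with ε h3 h4 h5
  refine ⟨?_, h3, h4⟩
  have : cr (B - A) (x + ε • v - A) = cr (B - A) (x - A) + ε * cr (B - A) v := by
    simp only [cr, PiLp.add_apply, PiLp.sub_apply, PiLp.smul_apply, smul_eq_mul]
    ring
  rw [this, h0, zero_add]
  exact mul_pos h5 hv

theorem cr_neg_rot_pos {e : Plane} (he : e ≠ 0) : 0 < cr e (-rot e) := by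
  have : cr e (-rot e) = ‖e‖ ^ 2 := by
    rw [norm_sq_eq, cr]
    simp
    ring
  rw [this]
  positivity

/-- The centre is above the midpoint of the base at half the height of the apex, which is c/2 times
the base length. -/
theorem exists_closedBall_subset_flatTri {c : ℝ} (hc : 0 < c) (hc' : c ≤ 1 / 4) {A B : Plane}
    (hAB : A ≠ B) : ∃ z, Metric.closedBall z (c / 16 * ‖B - A‖) ⊆ flatTri c A B ∧
      ∀ x ∈ segment ℝ A B, dist x z ≤ 2 * ‖B - A‖ := by
  have hL : 0 < ‖B - A‖ := norm_pos_iff.2 (sub_ne_zero.2 hAB.symm)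
  set E := B - A with hE
  have hn : 0 < ‖E‖ ^ 2 := by positivity
  refine ⟨A + ((1 / 2 : ℝ) • E + (-(c / 4)) • rot E), fun X hX => ?_, fun x hx => ?_⟩
  · rw [Metric.mem_closedBall, dist_eq_norm] at hX
    set v := X - (A + ((1 / 2 : ℝ) • E + (-(c / 4)) • rot E)) with hv
    have e1 : X - A = v + ((1 / 2 : ℝ) • E + (-(c / 4)) • rot E) := by
      rw [hv]
      abel
    have h1 : cr E (X - A) = cr E v + c / 4 * ‖E‖ ^ 2 := by
      rw [e1, norm_sq_eq]
      simp only [cr, PiLp.add_apply, PiLp.smul_apply, smul_eq_mul, rot_apply_zero, rot_apply_one]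
      ring
    have h2 : inner ℝ E (X - A) = inner ℝ E v + 1 / 2 * ‖E‖ ^ 2 := by
      rw [e1, norm_sq_eq, inner_eq, inner_eq]
      simp only [PiLp.add_apply, PiLp.smul_apply, smul_eq_mul, rot_apply_zero, rot_apply_one]
      ring
    have h3 : |cr E v| ≤ c / 16 * ‖E‖ ^ 2 := by
      refine (abs_cr_le E v).trans ?_
      nlinarith
    have h4 : |inner ℝ E v| ≤ c / 16 * ‖E‖ ^ 2 := by
      refine (abs_real_inner_le_norm E v).trans ?_
      nlinarith
    rw [abs_le] at h3 h4
    have hcn : 0 < c * ‖E‖ ^ 2 := by positivity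
    have h5 : c * inner ℝ E v ≤ 1 / 64 * (c * ‖E‖ ^ 2) := by nlinarith
    have h6 : -(1 / 64 * (c * ‖E‖ ^ 2)) ≤ c * inner ℝ E v := by nlinarith
    refine ⟨?_, ?_, ?_⟩
    · rw [← hE, h1]
      linarith
    · rw [← hE, h1, h2]
      linarith
    · rw [inner_swap, ← hE, h1, h2]
      linarith
  · rw [segment_eq_image'] at hx
    obtain ⟨θ, ⟨h0, h1⟩, rfl⟩ := hx
    rw [dist_eq_norm]
    have e1 : A + θ • (B - A) - (A + ((1 / 2 : ℝ) • E + (-(c / 4)) • rot E))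
        = (θ - 1 / 2) • E + (c / 4) • rot E := by
      rw [← hE]
      module
    rw [e1]
    refine (norm_add_le _ _).trans ?_
    rw [norm_smul, norm_smul, norm_rot, Real.norm_eq_abs, Real.norm_eq_abs]
    have a1 : |θ - 1 / 2| ≤ 1 := by
      rw [abs_le]
      constructor <;> linarith
    have a2 : |c / 4| ≤ 1 := by
      rw [abs_le]
      constructor <;> linarith
    nlinarith

/-- The two flat triangles have equal base slopes, and the ends of the subsegment are closer to any
foot than those of the segment, so the height constraints over the subsegment are the stronger ones.
-/
theorem flatTri_lineMap_subset {c : ℝ} (hc : 0 < c) {A B : Plane} {a b : ℝ} (ha : 0 ≤ a)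
    (hab : a < b) (hb : b ≤ 1) :
    flatTri c (AffineMap.lineMap A B a) (AffineMap.lineMap A B b) ⊆ flatTri c A B := by
  intro X hX
  have e0 : (AffineMap.lineMap A B b : Plane) - AffineMap.lineMap A B a = (b - a) • (B - A) := by
    simp only [AffineMap.lineMap_apply, vsub_eq_sub, vadd_eq_add]
    module
  obtain ⟨h1, h2, h3⟩ := hX
  rw [inner_swap, e0, norm_smul, mul_pow, Real.norm_eq_abs, sq_abs] at h3
  rw [e0] at h1 h2
  have e1 : cr ((b - a) • (B - A)) (X - (AffineMap.lineMap A B a : Plane))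
      = (b - a) * cr (B - A) (X - A) := by
    simp only [AffineMap.lineMap_apply, vsub_eq_sub, vadd_eq_add, cr, PiLp.add_apply,
      PiLp.sub_apply, PiLp.smul_apply, smul_eq_mul]
    ring
  have e2 : inner ℝ ((b - a) • (B - A)) (X - (AffineMap.lineMap A B a : Plane))
      = (b - a) * (inner ℝ (B - A) (X - A) - a * ‖B - A‖ ^ 2) := by
    rw [inner_eq, inner_eq, norm_sq_eq]
    simp only [AffineMap.lineMap_apply, vsub_eq_sub, vadd_eq_add, PiLp.add_apply,
      PiLp.sub_apply, PiLp.smul_apply, smul_eq_mul]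
    ring
  have hba : 0 < b - a := sub_pos.2 hab
  rw [e1] at h1 h2 h3
  rw [e2] at h2 h3
  have g1 : 0 < cr (B - A) (X - A) := (mul_pos_iff_of_pos_left hba).1 h1
  have g2 : cr (B - A) (X - A) < c * (inner ℝ (B - A) (X - A) - a * ‖B - A‖ ^ 2) := by
    refine lt_of_mul_lt_mul_left (a := b - a) ?_ hba.le
    linarith
  have g3 : cr (B - A) (X - A) < c * (b * ‖B - A‖ ^ 2 - inner ℝ (B - A) (X - A)) := by
    refine lt_of_mul_lt_mul_left (a := b - a) ?_ hba.le
    refine h3.trans_eq ?_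
    ring
  have hn : 0 ≤ ‖B - A‖ ^ 2 := by positivity
  refine ⟨g1, g2.trans_le ?_, g3.trans_le ?_⟩
  · gcongr
    nlinarith
  · rw [inner_swap A B]
    gcongr
    nlinarith

/-! ### Triangles -/

theorem hull_pair (A B : Plane) : hull {A, B} = segment ℝ A B := by
  rw [hull, Finset.coe_pair, convexHull_pair (𝕜 := ℝ)]

theorem isCompact_hull (T : Finset Plane) : IsCompact (hull T) :=
  T.finite_toSet.isCompact_convexHull ℝ

theorem convex_hull (T : Finset Plane) : Convex ℝ (hull T) := convex_convexHull ℝ _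

theorem subset_hull (T : Finset Plane) : (T : Set Plane) ⊆ hull T := subset_convexHull ℝ _

theorem dist_le_diamT {T : Finset Plane} {x y : Plane} (hx : x ∈ hull T) (hy : y ∈ hull T) :
    dist x y ≤ diamT T :=
  Metric.dist_le_diam_of_mem (isCompact_hull T).isBounded hx hy

/-- Divided by twice the area of the triangle, the three cross products are the barycentric
coordinates of X. -/
theorem mem_hull_iff {A B C X : Plane} (hD : 0 < cr (B - A) (C - A)) :
    X ∈ hull {A, B, C} ↔ 0 ≤ cr (B - A) (X - A) ∧ 0 ≤ cr (C - B) (X - B) ∧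
      0 ≤ cr (A - C) (X - C) := by
  constructor
  · intro h
    have hconv : ∀ u P : Plane, Convex ℝ {X : Plane | 0 ≤ cr u (X - P)} := fun u P => by
      have hl : IsLinearMap ℝ (fun X : Plane => cr u X) :=
        ⟨fun x y => by simp [cr]; ring, fun a x => by simp [cr]; ring⟩
      have : {X : Plane | 0 ≤ cr u (X - P)} = {X | cr u P ≤ cr u X} := by
        ext X
        simp only [mem_ofPred_eq, cr, PiLp.sub_apply]
        constructor <;> intro h <;> linarith
      rw [this]
      exact convex_halfSpace_ge hl _
    have hsub : hull {A, B, C} ⊆ {X | 0 ≤ cr (B - A) (X - A)} ∩ ({X | 0 ≤ cr (C - B) (X - B)} ∩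
        {X | 0 ≤ cr (A - C) (X - C)}) := by
      refine convexHull_min ?_ ((hconv _ _).inter ((hconv _ _).inter (hconv _ _)))
      intro Y hY
      simp only [Finset.coe_insert, Finset.coe_singleton, mem_insert_iff, mem_singleton_iff] at hY
      simp only [cr, PiLp.sub_apply] at hD
      simp only [mem_inter_iff, mem_ofPred_eq, cr, PiLp.sub_apply]
      rcases hY with rfl | rfl | rfl <;> refine ⟨?_, ?_, ?_⟩ <;> linarith
    exact hsub h
  · rintro ⟨h1, h2, h3⟩
    have hA : A ∈ hull {A, B, C} := subset_hull _ (by simp)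
    have hB : B ∈ hull {A, B, C} := subset_hull _ (by simp)
    have hC : C ∈ hull {A, B, C} := subset_hull _ (by simp)
    have hs : cr (C - B) (X - B) + cr (A - C) (X - C) + cr (B - A) (X - A)
        = cr (B - A) (C - A) := by
      simp only [cr, PiLp.sub_apply]
      ring
    have hX : X = ∑ i : Fin 3, (![cr (C - B) (X - B) / cr (B - A) (C - A),
        cr (A - C) (X - C) / cr (B - A) (C - A), cr (B - A) (X - A) / cr (B - A) (C - A)] i) •
        (![A, B, C] i) := by
      simp only [Fin.sum_univ_three, Matrix.cons_val_zero, Matrix.cons_val_one, Matrix.cons_val]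
      ext i
      simp only [PiLp.add_apply, PiLp.smul_apply, smul_eq_mul]
      rw [div_mul_eq_mul_div, div_mul_eq_mul_div, div_mul_eq_mul_div, ← add_div, ← add_div,
        eq_div_iff hD.ne']
      fin_cases i
      · simp only [cr, PiLp.sub_apply, Fin.zero_eta]
        ring
      · simp only [cr, PiLp.sub_apply, Fin.mk_one]
        ring
    rw [hX]
    refine (convex_hull _).sum_mem (fun i _ => ?_) ?_ (fun i _ => ?_)
    · fin_cases i <;> simp <;> positivity
    · simp only [Fin.sum_univ_three, Matrix.cons_val_zero, Matrix.cons_val_one, Matrix.cons_val]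
      rw [← add_div, ← add_div, hs, div_self hD.ne']
    · fin_cases i <;> simp [hA, hB, hC]

theorem mem_interior_hull {A B C X : Plane} (hD : 0 < cr (B - A) (C - A))
    (h1 : 0 < cr (B - A) (X - A)) (h2 : 0 < cr (C - B) (X - B)) (h3 : 0 < cr (A - C) (X - C)) :
    X ∈ interior (hull {A, B, C}) := by
  have ho : IsOpen ({X : Plane | 0 < cr (B - A) (X - A)} ∩ ({X | 0 < cr (C - B) (X - B)} ∩
      {X | 0 < cr (A - C) (X - C)})) := by
    refine (isOpen_lt ?_ ?_).inter ((isOpen_lt ?_ ?_).inter (isOpen_lt ?_ ?_)) <;> fun_prop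
  refine mem_interior.2 ⟨_, fun Y hY => ?_, ho, ⟨h1, h2, h3⟩⟩
  exact (mem_hull_iff hD).2 ⟨hY.1.le, hY.2.1.le, hY.2.2.le⟩

/-- An interior point can be moved a little towards the line AB without leaving the triangle, which
strictly lowers a cross product that stays nonnegative. -/
theorem cr_pos_of_mem_interior {A B C X : Plane} (hD : 0 < cr (B - A) (C - A))
    (h : X ∈ interior (hull {A, B, C})) : 0 < cr (B - A) (X - A) := by
  have hAB : B - A ≠ 0 := by
    intro h0
    simp [h0, cr] at hD
  have h1 : ∀ᶠ ε in 𝓝 (0 : ℝ), X + ε • rot (B - A) ∈ interior (hull {A, B, C}) := by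
    have hc : Continuous fun ε : ℝ => X + ε • rot (B - A) := by fun_prop
    exact hc.continuousAt.eventually_mem (isOpen_interior.mem_nhds (by simpa using h))
  obtain ⟨ε, h2, h3⟩ := ((h1.filter_mono (nhdsWithin_le_nhds (s := Ioi 0))).and
    self_mem_nhdsWithin).exists
  have h4 := ((mem_hull_iff hD).1 (interior_subset h2)).1
  rw [cr_add_smul_rot] at h4
  have h5 : 0 < ε * ‖B - A‖ ^ 2 := mul_pos h3 (by positivity)
  linarith

theorem cr_le_of_mem_hull {A B C X : Plane} (hD : 0 < cr (B - A) (C - A))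
    (h : X ∈ hull {A, B, C}) : cr (B - A) (X - A) ≤ cr (B - A) (C - A) := by
  obtain ⟨h1, h2, h3⟩ := (mem_hull_iff hD).1 h
  have hs : cr (C - B) (X - B) + cr (A - C) (X - C) + cr (B - A) (X - A)
      = cr (B - A) (C - A) := by
    simp only [cr, PiLp.sub_apply]
    ring
  linarith

/-- The height of a shape regular triangle. -/
theorem le_cr_of_closedBall_subset {A B C x : Plane} {δ : ℝ} (hδ : 0 ≤ δ)
    (hD : 0 < cr (B - A) (C - A)) (h : Metric.closedBall x (δ / 2) ⊆ hull {A, B, C}) :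
    δ * ‖B - A‖ ≤ cr (B - A) (C - A) := by
  have hAB : B - A ≠ 0 := by
    intro h0
    simp [h0, cr] at hD
  have hL : 0 < ‖B - A‖ := norm_pos_iff.2 hAB
  -- The two points of the disc on its diameter perpendicular to AB; their heights over AB differ by
  -- δ.
  have hmem : ∀ k : ℝ, |k| = δ / 2 / ‖B - A‖ → x + k • rot (B - A) ∈ hull {A, B, C} := by
    intro k hk
    apply h
    rw [Metric.mem_closedBall, dist_eq_norm, add_sub_cancel_left, norm_smul, norm_rot,
      Real.norm_eq_abs, hk, div_mul_cancel₀ _ hL.ne']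
  have hk0 : 0 ≤ δ / 2 / ‖B - A‖ := by positivity
  have h1 := ((mem_hull_iff hD).1 (hmem _ (abs_of_nonneg hk0))).1
  have h2 := cr_le_of_mem_hull hD (hmem (-(δ / 2 / ‖B - A‖)) (by rw [abs_neg, abs_of_nonneg hk0]))
  rw [cr_add_smul_rot] at h1 h2
  have : δ / 2 / ‖B - A‖ * ‖B - A‖ ^ 2 = δ / 2 * ‖B - A‖ := by field_simp
  nlinarith

/-- The height over AB is at least ρ times the diameter, while C is horizontally at most a diameter
away from A and B. The other two sides therefore rise with slope at least ρ, and a flat triangle of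
slope c ≤ ρ stays below them. -/
theorem flatTri_subset_interior_hull {A B C x : Plane} {ρ c : ℝ} (hρ : 0 ≤ ρ) (hc : c ≤ ρ)
    (hD : 0 < cr (B - A) (C - A))
    (h : Metric.closedBall x (ρ * diamT {A, B, C} / 2) ⊆ hull {A, B, C}) :
    flatTri c A B ⊆ interior (hull {A, B, C}) := by
  rintro X ⟨h1, h2, h3⟩
  have hd : 0 ≤ diamT {A, B, C} := Metric.diam_nonneg
  have hh := le_cr_of_closedBall_subset (by positivity) hD h
  have hA : A ∈ hull {A, B, C} := subset_hull _ (by simp)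
  have hB : B ∈ hull {A, B, C} := subset_hull _ (by simp)
  have hC : C ∈ hull {A, B, C} := subset_hull _ (by simp)
  have hAB : B - A ≠ 0 := by
    intro h0
    simp [h0, cr] at hD
  have hL : 0 < ‖B - A‖ := norm_pos_iff.2 hAB
  have hn : 0 < ‖B - A‖ ^ 2 := by positivity
  have d1 : inner ℝ (B - A) (C - A) ≤ ‖B - A‖ * diamT {A, B, C} := by
    refine (real_inner_le_norm _ _).trans ?_
    gcongr
    rw [← dist_eq_norm]
    exact dist_le_diamT hC hA
  have d2 : inner ℝ (B - A) (B - C) ≤ ‖B - A‖ * diamT {A, B, C} := by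
    refine (real_inner_le_norm _ _).trans ?_
    gcongr
    rw [← dist_eq_norm]
    exact dist_le_diamT hB hC
  rw [inner_swap] at h3
  set d := diamT {A, B, C}
  set L := ‖B - A‖
  set D := cr (B - A) (C - A)
  set ξ := inner ℝ (B - A) (X - A)
  set η := cr (B - A) (X - A)
  have hcpos : 0 < c := by
    by_contra hc0
    push Not at hc0
    nlinarith
  have p1 : 0 < ξ := by
    by_contra h
    push Not at h
    nlinarith
  have p2 : 0 < L ^ 2 - ξ := by
    by_contra h
    push Not at h
    nlinarith
  have q1 : η < ρ * ξ := h2.trans_le (by gcongr)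
  have q2 : η < ρ * (L ^ 2 - ξ) := h3.trans_le (by gcongr)
  refine mem_interior_hull hD h1 ?_ ?_
  · have e := norm_sq_mul_cr (B - A) (C - B) (X - B)
    have e1 : cr (B - A) (X - B) = η := by
      simp only [η, cr, PiLp.sub_apply]
      ring
    have e2 : cr (B - A) (C - B) = D := by
      simp only [D, cr, PiLp.sub_apply]
      ring
    have e3 : inner ℝ (B - A) (X - B) = ξ - L ^ 2 := by
      simp only [ξ, L]
      rw [norm_sq_eq, inner_eq, inner_eq]
      simp only [PiLp.sub_apply]
      ring
    have e4 : inner ℝ (B - A) (C - B) = -inner ℝ (B - A) (B - C) := by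
      rw [← neg_sub B C, inner_neg_right]
    rw [e1, e2, e3, e4] at e
    have h6 : inner ℝ (B - A) (B - C) * η < D * (L ^ 2 - ξ) := by
      -- If the angle at B is not acute, the side BC imposes nothing on points whose feet are
      -- between A and B.
      rcases le_or_gt (inner ℝ (B - A) (B - C)) 0 with hneg | hpos
      · nlinarith [mul_pos hD p2]
      · calc inner ℝ (B - A) (B - C) * η < inner ℝ (B - A) (B - C) * (ρ * (L ^ 2 - ξ)) := by gcongr
          _ ≤ (L * d) * (ρ * (L ^ 2 - ξ)) := by gcongr
          _ = (ρ * d * L) * (L ^ 2 - ξ) := by ring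
          _ ≤ _ := by gcongr
    have : 0 < L ^ 2 * cr (C - B) (X - B) := by
      rw [e]
      linarith
    exact (mul_pos_iff_of_pos_left hn).1 this
  · have e := norm_sq_mul_cr (B - A) (A - C) (X - C)
    have e1 : cr (B - A) (X - C) = η - D := by
      simp only [η, D, cr, PiLp.sub_apply]
      ring
    have e2 : cr (B - A) (A - C) = -D := by
      simp only [D, cr, PiLp.sub_apply]
      ring
    have e3 : inner ℝ (B - A) (X - C) = ξ - inner ℝ (B - A) (C - A) := by
      rw [← inner_sub_right]
      congr 1
      abel
    have e4 : inner ℝ (B - A) (A - C) = -inner ℝ (B - A) (C - A) := by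
      rw [← neg_sub C A, inner_neg_right]
    rw [e1, e2, e3, e4] at e
    have h6 : inner ℝ (B - A) (C - A) * η < D * ξ := by
      rcases le_or_gt (inner ℝ (B - A) (C - A)) 0 with hneg | hpos
      · nlinarith [mul_pos hD p1]
      · calc inner ℝ (B - A) (C - A) * η < inner ℝ (B - A) (C - A) * (ρ * ξ) := by gcongr
          _ ≤ (L * d) * (ρ * ξ) := by gcongr
          _ = (ρ * d * L) * ξ := by ring
          _ ≤ _ := by gcongr
    have : 0 < L ^ 2 * cr (A - C) (X - C) := by
      rw [e]
      linarith
    exact (mul_pos_iff_of_pos_left hn).1 this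

end ImmersedIP

namespace ImmersedIP

/-! ### Edges -/

theorem ends_spec {e : Finset Plane} (he : e.card = 2) :
    (ends e).1 ≠ (ends e).2 ∧ e = {(ends e).1, (ends e).2} := by
  have h : ∃ q : Plane × Plane, q.1 ≠ q.2 ∧ e = {q.1, q.2} := by
    obtain ⟨x, y, hxy, rfl⟩ := Finset.card_eq_two.1 he
    exact ⟨(x, y), hxy, rfl⟩
  have h1 : ends e = h.choose := by
    unfold ends
    rw [dif_pos]
  rw [h1]
  have := h.choose_spec
  convert this

theorem ends_fst_mem {e : Finset Plane} (he : e.card = 2) : (ends e).1 ∈ e :=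
  (Finset.ext_iff.1 (ends_spec he).2 _).2 (by simp)

theorem ends_snd_mem {e : Finset Plane} (he : e.card = 2) : (ends e).2 ∈ e :=
  (Finset.ext_iff.1 (ends_spec he).2 _).2 (by simp)

theorem edgePt_injective {e : Finset Plane} (he : e.card = 2) :
    Function.Injective (edgePt e) :=
  AffineMap.lineMap_injective ℝ (ends_spec he).1

@[fun_prop]
theorem continuous_edgePt (e : Finset Plane) : Continuous (edgePt e) :=
  AffineMap.lineMap_continuous

theorem hull_edge {e : Finset Plane} (he : e.card = 2) : hull e = edgePt e '' Icc 0 1 := by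
  conv_lhs => rw [(ends_spec he).2]
  rw [hull_pair, segment_eq_image_lineMap]
  rfl

theorem edgePt_mem_hull {e : Finset Plane} (he : e.card = 2) {t : ℝ} (ht : t ∈ Icc (0 : ℝ) 1) :
    edgePt e t ∈ hull e := by
  rw [hull_edge he]
  exact mem_image_of_mem _ ht

theorem edgePt_mem_openSegment (e : Finset Plane) {t : ℝ} (ht : t ∈ Ioo (0 : ℝ) 1) :
    edgePt e t ∈ openSegment ℝ (ends e).1 (ends e).2 := by
  rw [openSegment_eq_image_lineMap]
  exact mem_image_of_mem _ ht

theorem edgePt_sub (e : Finset Plane) (a b : ℝ) :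
    edgePt e b - edgePt e a = (b - a) • ((ends e).2 - (ends e).1) := by
  simp only [edgePt, AffineMap.lineMap_apply, vsub_eq_sub, vadd_eq_add]
  module

theorem edgeLen_eq (e : Finset Plane) : edgeLen e = ‖(ends e).2 - (ends e).1‖ := by
  rw [edgeLen, dist_eq_norm, norm_sub_rev]

theorem edgeLen_pos {e : Finset Plane} (he : e.card = 2) : 0 < edgeLen e :=
  dist_pos.2 (ends_spec he).1

theorem norm_edgePt_sub (e : Finset Plane) {a b : ℝ} (hab : a ≤ b) :
    ‖edgePt e b - edgePt e a‖ = (b - a) * edgeLen e := by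
  rw [edgePt_sub, norm_smul, edgeLen_eq, Real.norm_of_nonneg (sub_nonneg.2 hab)]

theorem openSegment_edgePt (e : Finset Plane) {a b : ℝ} (hab : a < b) :
    openSegment ℝ (edgePt e a) (edgePt e b) = edgePt e '' Ioo a b := by
  rw [edgePt, edgePt, ← image_openSegment ℝ (AffineMap.lineMap (ends e).1 (ends e).2),
    openSegment_eq_Ioo hab]
  rfl

theorem segment_edgePt (e : Finset Plane) {a b : ℝ} (hab : a ≤ b) :
    segment ℝ (edgePt e a) (edgePt e b) = edgePt e '' Icc a b := by
  rw [edgePt, edgePt, ← image_segment ℝ (AffineMap.lineMap (ends e).1 (ends e).2),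
    segment_eq_Icc hab]
  rfl

/-- The triangle `T` has the edge `A B` and is on its left. -/
def OnLeft (A B : Plane) (T : Finset Plane) : Prop :=
  ∃ C, T = {A, B, C} ∧ 0 < cr (B - A) (C - A)

theorem OnLeft.cr_bary {A B : Plane} {T : Finset Plane} (h : OnLeft A B T) :
    0 < cr (B - A) (bary T - A) := by
  obtain ⟨C, rfl, hD⟩ := h
  have hAB : A ≠ B := by
    rintro rfl
    simp [cr] at hD
  have hAC : A ≠ C := by
    rintro rfl
    simp [cr] at hD
  have hBC : B ≠ C := by
    rintro rfl
    simp [cr, mul_comm] at hD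
  have hs : ∑ x ∈ ({A, B, C} : Finset Plane), x = A + (B + C) := by
    rw [Finset.sum_insert (by simp [hAB, hAC]), Finset.sum_insert (by simp [hBC]),
      Finset.sum_singleton]
  rw [bary, hs]
  have : cr (B - A) ((3 : ℝ)⁻¹ • (A + (B + C)) - A) = 3⁻¹ * cr (B - A) (C - A) := by
    simp only [cr, PiLp.sub_apply, PiLp.smul_apply, PiLp.add_apply, smul_eq_mul]
    ring
  rw [this]
  positivity

theorem OnLeft.cr_pos {A B X : Plane} {T : Finset Plane} (h : OnLeft A B T)
    (hX : X ∈ interior (hull T)) : 0 < cr (B - A) (X - A) := by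
  obtain ⟨C, rfl, hD⟩ := h
  exact cr_pos_of_mem_interior hD hX

theorem cr_ne_zero_of_affineIndependent {T : Finset Plane} {A B C : Plane} (hT : T = {A, B, C})
    (hcard : T.card = 3) (h : AffineIndependent ℝ ((↑) : T → Plane)) :
    cr (B - A) (C - A) ≠ 0 := by
  intro h0
  subst hT
  have hinj : Function.Injective ![(⟨A, by simp⟩ : ({A, B, C} : Finset Plane)), ⟨B, by simp⟩,
      ⟨C, by simp⟩] := by
    have h1 : A ≠ B := by
      rintro rfl
      have := Finset.card_le_two (a := A) (b := C)
      simp only [Finset.mem_insert_self, Finset.insert_eq_of_mem] at hcard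
      omega
    have h2 : A ≠ C := by
      rintro rfl
      have := Finset.card_le_two (a := A) (b := B)
      rw [Finset.insert_eq_of_mem (by simp)] at hcard
      rw [Finset.pair_comm] at hcard
      omega
    have h3 : B ≠ C := by
      rintro rfl
      have := Finset.card_le_two (a := A) (b := B)
      simp only [Finset.mem_singleton, Finset.insert_eq_of_mem] at hcard
      omega
    intro i j
    fin_cases i <;> fin_cases j <;> simp [h1, h2, h3, Ne.symm h1, Ne.symm h2, Ne.symm h3]
  have h1 := h.comp_embedding ⟨_, hinj⟩
  have h2 : AffineIndependent ℝ ![A, B, C] := by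
    convert h1 using 1
    funext i
    fin_cases i <;> rfl
  rw [affineIndependent_iff_not_collinear_set] at h2
  apply h2
  by_cases hAB : B - A = 0
  · rw [sub_eq_zero.1 hAB]
    simpa using collinear_pair ℝ A C
  · rw [collinear_iff_of_mem (p₀ := A) (by simp)]
    refine ⟨B - A, fun p hp => ?_⟩
    rcases hp with rfl | rfl | rfl
    · exact ⟨0, by simp⟩
    · exact ⟨1, by simp⟩
    · refine ⟨inner ℝ (B - A) (p - A) / ‖B - A‖ ^ 2, ?_⟩
      rw [← eq_add_smul_of_cr_eq_zero hAB h0]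
      simp

namespace Mesh

variable {M : Mesh} {ρ : ℝ}

theorem mem_edges {e : Finset Plane} : e ∈ M.edges ↔ ∃ T ∈ M.tri, e ⊆ T ∧ e.card = 2 := by
  simp [edges, edgesOf, Finset.mem_powersetCard]

theorem mem_intEdges {e : Finset Plane} : e ∈ M.intEdges ↔
    e ∈ M.edges ∧ ∃ T ∈ M.tri, ∃ T' ∈ M.tri, T ≠ T' ∧ e ⊆ T ∧ e ⊆ T' := by
  simp [intEdges, intEdgesOf, edges]

theorem card_of_mem_edges {e : Finset Plane} (he : e ∈ M.edges) : e.card = 2 := by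
  obtain ⟨T, -, -, h⟩ := mem_edges.1 he
  exact h

theorem card_of_mem_intEdges {e : Finset Plane} (he : e ∈ M.intEdges) : e.card = 2 :=
  card_of_mem_edges (mem_intEdges.1 he).1

theorem onLeft_or {T : Finset Plane} (hT : T ∈ M.tri) {A B : Plane} (hAB : A ≠ B)
    (hA : A ∈ T) (hB : B ∈ T) : OnLeft A B T ∨ OnLeft B A T := by
  classical
  have hsub : ({A, B} : Finset Plane) ⊆ T := by
    intro x hx
    rcases Finset.mem_insert.1 hx with rfl | hx
    · exact hA
    · rwa [Finset.mem_singleton.1 hx]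
  have h1 : (T \ {A, B}).card = 1 := by
    rw [Finset.card_sdiff_of_subset hsub, M.card_tri T hT, Finset.card_pair hAB]
  obtain ⟨C, hC⟩ := Finset.card_eq_one.1 h1
  have hT' : T = {A, B, C} := by
    rw [← Finset.union_sdiff_of_subset hsub, hC]
    ext x
    simp
  have hT'' : T = {B, A, C} := by
    rw [hT']
    ext x
    simp only [Finset.mem_insert, Finset.mem_singleton]
    tauto
  have hne := cr_ne_zero_of_affineIndependent hT' (M.card_tri T hT) (M.indep T hT)
  rcases lt_or_gt_of_ne hne with h | h
  · right
    refine ⟨C, hT'', ?_⟩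
    rw [cr_swap]
    linarith
  · exact Or.inl ⟨C, hT', h⟩

theorem ShapeRegular.flatTri_subset (hM : M.ShapeRegular ρ) (hρ : 0 ≤ ρ) {T : Finset Plane}
    (hT : T ∈ M.tri) {A B : Plane} (h : OnLeft A B T) {c : ℝ} (hc : c ≤ ρ) :
    flatTri c A B ⊆ interior (hull T) := by
  obtain ⟨C, rfl, hD⟩ := h
  obtain ⟨x, hx⟩ := hM _ hT
  exact flatTri_subset_interior_hull hρ hc hD hx

/-- Both triangles contain the flat triangle over AB. If they were different, conformity would put
their intersection into the segment AB, yet the flat triangle lies strictly to the left of it. -/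
theorem ShapeRegular.eq_of_onLeft (hM : M.ShapeRegular ρ) (hρ : 0 < ρ) {T T' : Finset Plane}
    (hT : T ∈ M.tri) (hT' : T' ∈ M.tri) {A B : Plane} (h : OnLeft A B T) (h' : OnLeft A B T') :
    T = T' := by
  by_contra hne
  have hAB : A ≠ B := by
    rintro rfl
    obtain ⟨C, -, hD⟩ := h
    simp [cr] at hD
  have hc : 0 < min ρ (1 / 4) := lt_min hρ (by norm_num)
  obtain ⟨z, hz, -⟩ := exists_closedBall_subset_flatTri hc (min_le_right _ _) hAB
  have hz' : z ∈ flatTri (min ρ (1 / 4)) A B := hz (Metric.mem_closedBall_self (by positivity))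
  have h1 := interior_subset (hM.flatTri_subset hρ.le hT h (min_le_left _ _) hz')
  have h2 := interior_subset (hM.flatTri_subset hρ.le hT' h' (min_le_left _ _) hz')
  have h3 := M.conform T hT T' hT' ⟨h1, h2⟩
  obtain ⟨C, rfl, hD⟩ := h
  obtain ⟨C', rfl, hD'⟩ := h'
  have hCC : C ≠ C' := by
    rintro rfl
    exact hne rfl
  have hsub : (({A, B, C} : Finset Plane) : Set Plane) ∩ (({A, B, C'} : Finset Plane) : Set Plane)
      ⊆ (({A, B} : Finset Plane) : Set Plane) := by
    rintro x ⟨hx, hx'⟩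
    simp only [Finset.coe_insert, Finset.coe_singleton, mem_insert_iff, mem_singleton_iff]
      at hx hx' ⊢
    rcases hx with h | h | h
    · exact Or.inl h
    · exact Or.inr h
    · rcases hx' with h' | h' | h'
      · exact Or.inl h'
      · exact Or.inr h'
      · exact absurd (h.symm.trans h') hCC
  have h4 : z ∈ hull {A, B} := convexHull_mono hsub h3
  rw [hull_pair, segment_eq_image'] at h4
  obtain ⟨θ, -, rfl⟩ := h4
  have h5 := hz'.1
  have : cr (B - A) (A + θ • (B - A) - A) = 0 := by
    simp [cr]
    ring
  linarith

/-- One of the triangles of an interior edge is on its left, the other one on its right. -/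
theorem ShapeRegular.exists_left_right (hM : M.ShapeRegular ρ) (hρ : 0 < ρ) {e : Finset Plane}
    (he : e ∈ M.intEdges) : ∃ L R, OnLeft (ends e).1 (ends e).2 L ∧
      OnLeft (ends e).2 (ends e).1 R ∧ L ∈ M.tri ∧ R ∈ M.tri ∧
      ((L = M.T₁ e ∧ R = M.T₂ e) ∨ (L = M.T₂ e ∧ R = M.T₁ e)) := by
  obtain ⟨h1, h2, hne, hs1, hs2⟩ := M.adj e he
  obtain ⟨hAB, -⟩ := ends_spec (card_of_mem_intEdges he)
  have hA := ends_fst_mem (card_of_mem_intEdges he)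
  have hB := ends_snd_mem (card_of_mem_intEdges he)
  rcases onLeft_or h1 hAB (hs1 hA) (hs1 hB) with k1 | k1 <;>
    rcases onLeft_or h2 hAB (hs2 hA) (hs2 hB) with k2 | k2
  · exact absurd (hM.eq_of_onLeft hρ h1 h2 k1 k2) hne
  · exact ⟨_, _, k1, k2, h1, h2, Or.inl ⟨rfl, rfl⟩⟩
  · exact ⟨_, _, k2, k1, h2, h1, Or.inr ⟨rfl, rfl⟩⟩
  · exact absurd (hM.eq_of_onLeft hρ h1 h2 k1 k2) hne

theorem diamT_le_h {T : Finset Plane} (hT : T ∈ M.tri) : diamT T ≤ M.h :=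
  le_ciSup (f := fun T : M.tri => diamT T) (Set.finite_range _).bddAbove ⟨T, hT⟩

theorem edgeLen_le_h {e : Finset Plane} (he : e ∈ M.edges) : edgeLen e ≤ M.h := by
  obtain ⟨T, hT, hsub, hcard⟩ := mem_edges.1 he
  refine le_trans ?_ (diamT_le_h hT)
  exact dist_le_diamT (subset_hull T (hsub (ends_fst_mem hcard)))
    (subset_hull T (hsub (ends_snd_mem hcard)))

end Mesh

/-! ### Edges and the interface -/

theorem phase_eq_of_eventually {I : Interface} {T : Finset Plane} {x : Plane} {s : Bool}
    (h : ∀ᶠ ε in 𝓝[>] (0 : ℝ), AffineMap.lineMap x (bary T) ε ∈ I.D s) : phase I T x = s := by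
  unfold phase
  cases s
  · rw [if_pos h]
  · rw [if_neg]
    intro h'
    obtain ⟨ε, h1, h2⟩ := (h.and h').exists
    exact absurd (I.disjoint_D' h1 h2) (by simp)

theorem phase_eq_of_mem {I : Interface} {T : Finset Plane} {x : Plane} {s : Bool}
    (h : x ∈ I.D s) : phase I T x = s := by
  refine phase_eq_of_eventually ?_
  have hc : Continuous fun ε : ℝ => (AffineMap.lineMap x (bary T) ε : Plane) :=
    AffineMap.lineMap_continuous
  have h1 := hc.continuousAt (x := 0).eventually_mem
    ((I.isOpen_D s).mem_nhds (by simpa using h))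
  exact h1.filter_mono nhdsWithin_le_nhds

/-- The barycentre is to the left of AB, so the ray that defines `phase` enters the flat triangle.
This determines the phase even at points of the edge that are on the interface. -/
theorem phase_eq_of_flatTri_subset {I : Interface} {T : Finset Plane} {A B x : Plane} {s : Bool}
    {c : ℝ} (hc : 0 < c) (hT : OnLeft A B T) (hx : x ∈ openSegment ℝ A B)
    (h : flatTri c A B ⊆ I.D s) : phase I T x = s := by
  refine phase_eq_of_eventually ?_
  have hAB : A ≠ B := by
    rintro rfl
    obtain ⟨C, -, hD⟩ := hT
    simp [cr] at hD
  have hv : 0 < cr (B - A) (bary T - x) := by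
    have h1 := (of_mem_openSegment (sub_ne_zero.2 hAB.symm) hx).1
    have h2 := hT.cr_bary
    have : cr (B - A) (bary T - x) = cr (B - A) (bary T - A) - cr (B - A) (x - A) := by
      simp only [cr, PiLp.sub_apply]
      ring
    rw [this, h1, sub_zero]
    exact h2
  filter_upwards [eventually_mem_flatTri hc hAB hx hv] with ε hε
  rw [AffineMap.lineMap_apply, vsub_eq_sub, vadd_eq_add, add_comm]
  exact h hε

theorem exists_flatTri_subset {I : Interface} {c : ℝ} {A B : Plane}
    (h : Disjoint (flatTri c A B) I.Γ) : ∃ s, flatTri c A B ⊆ I.D s := by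
  have h1 : flatTri c A B ⊆ I.D true ∪ I.D false := by
    rw [I.union_D]
    exact fun x hx hx' => Set.disjoint_left.1 h hx hx'
  rcases (convex_flatTri c A B).isPreconnected.subset_or_subset (I.isOpen_D true)
    (I.isOpen_D false) I.disjoint_D h1 with h | h
  · exact ⟨true, h⟩
  · exact ⟨false, h⟩

/-- The flat triangle is connected and misses the interface, so one of its points settles its side;
points close to x are already in the open set `I.D s`. -/
theorem flatTri_subset_of_mem {I : Interface} {c : ℝ} (hc : 0 < c) {A B x : Plane} (hAB : A ≠ B)
    {s : Bool} (h : Disjoint (flatTri c A B) I.Γ) (hx : x ∈ openSegment ℝ A B) (hs : x ∈ I.D s) :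
    flatTri c A B ⊆ I.D s := by
  obtain ⟨s', h'⟩ := exists_flatTri_subset h
  have h1 := eventually_mem_flatTri hc hAB hx (cr_neg_rot_pos (sub_ne_zero.2 hAB.symm))
  have hcont : Continuous fun ε : ℝ => x + ε • (-rot (B - A)) := by fun_prop
  have h2 := (hcont.continuousAt (x := 0).eventually_mem
    ((I.isOpen_D s).mem_nhds (by simpa using hs))).filter_mono
    (nhdsWithin_le_nhds (s := Ioi (0 : ℝ)))
  obtain ⟨ε, h3, h4⟩ := (h1.and h2).exists
  rwa [I.disjoint_D' h4 (h' h3)]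

end ImmersedIP

/-! ### Cut and uncut edges, and the elements next to them -/

namespace ImmersedIP
namespace Mesh

variable {M : Mesh} {ρ r : ℝ} {I : Interface}

/-- A point in the relative interior of an edge is on no other edge of the triangle. -/
theorem eq_of_mem_openSegment {T : Finset Plane} (hT : T ∈ M.tri) {A B x : Plane} (hAB : A ≠ B)
    (hA : A ∈ T) (hB : B ∈ T) (hx : x ∈ openSegment ℝ A B) {e : Finset Plane} (he : e ⊆ T)
    (hcard : e.card = 2) (hxe : x ∈ hull e) : e = {A, B} := by
  wlog h : OnLeft A B T generalizing A B
  · have h' := (onLeft_or hT hAB hA hB).resolve_left h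
    rw [this hAB.symm hB hA (by rwa [openSegment_symm]) h', Finset.pair_comm]
  obtain ⟨C, rfl, hD⟩ := h
  obtain ⟨h0, h1, h2⟩ := of_mem_openSegment (sub_ne_zero.2 hAB.symm) hx
  by_cases hC : C ∈ e
  · exfalso
    obtain ⟨Y, hY⟩ : ∃ Y, e = {C, Y} := by
      obtain ⟨u, w, -, rfl⟩ := Finset.card_eq_two.1 hcard
      rcases Finset.mem_insert.1 hC with h | h
      · exact ⟨w, by rw [h]⟩
      · rw [Finset.mem_singleton.1 h]
        exact ⟨u, Finset.pair_comm _ _⟩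
    have hne : C ≠ Y := by
      rintro rfl
      rw [hY] at hcard
      simp at hcard
    have hY' : Y = A ∨ Y = B := by
      have : Y ∈ ({A, B, C} : Finset Plane) := he (by rw [hY]; simp)
      simp only [Finset.mem_insert, Finset.mem_singleton] at this
      rcases this with h | h | h
      · exact Or.inl h
      · exact Or.inr h
      · exact absurd h.symm hne
    rw [hY, hull_pair, segment_eq_image'] at hxe
    obtain ⟨θ, -, rfl⟩ := hxe
    have hY0 : cr (B - A) (Y - A) = 0 := by
      rcases hY' with rfl | rfl <;> simp [cr]
      ring
    have e1 : cr (B - A) (C + θ • (Y - C) - A)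
        = (1 - θ) * cr (B - A) (C - A) + θ * cr (B - A) (Y - A) := by
      simp only [cr, PiLp.sub_apply, PiLp.add_apply, PiLp.smul_apply, smul_eq_mul]
      ring
    rw [e1, hY0, mul_zero, add_zero] at h0
    have hθ : θ = 1 := by
      rcases mul_eq_zero.1 h0 with h | h
      · linarith
      · exact absurd h hD.ne'
    simp only [hθ, one_smul, add_sub_cancel] at h1 h2
    rcases hY' with rfl | rfl
    · simp at h1
    · rw [real_inner_self_eq_norm_sq] at h2
      exact lt_irrefl _ h2
  · refine Finset.eq_of_subset_of_card_le (fun y hy => ?_) (by rw [hcard, Finset.card_pair hAB])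
    have := he hy
    simp only [Finset.mem_insert, Finset.mem_singleton] at this ⊢
    rcases this with h | h | h
    · exact Or.inl h
    · exact Or.inr h
    · exact absurd (h ▸ hy) hC

theorem mem_frontier_of_mem_openSegment {T : Finset Plane} (hT : T ∈ M.tri) {A B x : Plane}
    (hAB : A ≠ B) (hA : A ∈ T) (hB : B ∈ T) (hx : x ∈ openSegment ℝ A B) :
    x ∈ frontier (hull T) := by
  wlog h : OnLeft A B T generalizing A B
  · exact this hAB.symm hB hA (by rwa [openSegment_symm]) ((onLeft_or hT hAB hA hB).resolve_left h)
  have h0 := (of_mem_openSegment (sub_ne_zero.2 hAB.symm) hx).1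
  refine ⟨subset_closure ?_, fun hint => ?_⟩
  · exact (convex_hull T).openSegment_subset (subset_hull T hA) (subset_hull T hB) hx
  · have := h.cr_pos hint
    linarith

/-- The open edge has at most one point on the interface, unless it is part of the interface. -/
theorem Admissible.edge_subset_or (hI : M.Admissible I r) {e : Finset Plane} (he : e ∈ M.edges) :
    hull e ⊆ I.Γ ∨ ∃ τ ∈ Ioo (0 : ℝ) 1, ∃ s₁ s₂, (∀ t ∈ Ioo 0 τ, edgePt e t ∈ I.D s₁) ∧
      ∀ t ∈ Ioo τ 1, edgePt e t ∈ I.D s₂ := by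
  by_cases hsub : hull e ⊆ I.Γ
  · exact Or.inl hsub
  right
  have hcard := card_of_mem_edges he
  obtain ⟨T, hT, heT, -⟩ := mem_edges.1 he
  obtain ⟨hAB, heq⟩ := ends_spec hcard
  have hA := heT (ends_fst_mem hcard)
  have hB := heT (ends_snd_mem hcard)
  -- A point in the relative interior of e is on no other edge of T, so two such points of the
  -- interface leave only the second alternative of `diff_edges`, which has been excluded.
  have huniq : ∀ t ∈ Ioo (0 : ℝ) 1, ∀ u ∈ Ioo (0 : ℝ) 1, edgePt e t ∈ I.Γ → edgePt e u ∈ I.Γ →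
      t = u := by
    intro t ht u hu htΓ huΓ
    by_contra hne
    have hto := edgePt_mem_openSegment e ht
    have huo := edgePt_mem_openSegment e hu
    have key : ∀ x ∈ openSegment ℝ (ends e).1 (ends e).2, ∀ e' ∈ T.powersetCard 2, x ∈ hull e' →
        e' = e := by
      intro x hx e' he' hxe'
      rw [Finset.mem_powersetCard] at he'
      exact (eq_of_mem_openSegment hT hAB hA hB hx he'.1 he'.2 hxe').trans heq.symm
    rcases hI.diff_edges T hT _ ⟨htΓ, mem_frontier_of_mem_openSegment hT hAB hA hB hto⟩ _
      ⟨huΓ, mem_frontier_of_mem_openSegment hT hAB hA hB huo⟩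
      (fun h => hne (edgePt_injective hcard h)) with
      ⟨e₁, he₁, e₂, he₂, h12, h1, h2⟩ | ⟨e₁, he₁, h1, -, h3⟩
    · exact h12 ((key _ hto _ he₁ h1).trans (key _ huo _ he₂ h2).symm)
    · rw [key _ hto _ he₁ h1] at h3
      exact hsub h3
  -- If the open edge misses the interface, any τ will do, and 1/2 is taken.
  obtain ⟨τ, hτ, hτ'⟩ : ∃ τ ∈ Ioo (0 : ℝ) 1, ∀ t ∈ Ioo (0 : ℝ) 1, t ≠ τ → edgePt e t ∉ I.Γ := by
    by_cases h : ∃ τ ∈ Ioo (0 : ℝ) 1, edgePt e τ ∈ I.Γ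
    · obtain ⟨τ, hτ, hτΓ⟩ := h
      exact ⟨τ, hτ, fun t ht hne htΓ => hne (huniq t ht τ hτ htΓ hτΓ)⟩
    · push Not at h
      exact ⟨1 / 2, by norm_num, fun t ht _ => h t ht⟩
  have hconn : ∀ a b : ℝ, (∀ t ∈ Ioo a b, edgePt e t ∉ I.Γ) → ∃ s, ∀ t ∈ Ioo a b,
      edgePt e t ∈ I.D s := by
    intro a b hab
    have h1 : edgePt e '' Ioo a b ⊆ I.D true ∪ I.D false := by
      rw [I.union_D]
      rintro _ ⟨t, ht, rfl⟩
      exact hab t ht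
    have h2 : IsPreconnected (edgePt e '' Ioo a b) :=
      isPreconnected_Ioo.image _ (continuous_edgePt e).continuousOn
    rcases h2.subset_or_subset (I.isOpen_D true) (I.isOpen_D false) I.disjoint_D h1 with h | h
    · exact ⟨true, fun t ht => h (mem_image_of_mem _ ht)⟩
    · exact ⟨false, fun t ht => h (mem_image_of_mem _ ht)⟩
  obtain ⟨s₁, hs₁⟩ := hconn 0 τ fun t ht => hτ' t ⟨ht.1, ht.2.trans hτ.2⟩ ht.2.ne
  obtain ⟨s₂, hs₂⟩ := hconn τ 1 fun t ht => hτ' t ⟨hτ.1.trans ht.1, ht.2⟩ ht.1.ne'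
  exact ⟨τ, hτ, s₁, s₂, hs₁, hs₂⟩

/-- If the end point of an open interval of the edge is on one side, so is a part of it. -/
theorem exists_Ioo_mem_D {e : Finset Plane} {a b t : ℝ} (hab : a < b) (ht : t ∈ Icc a b) {s : Bool}
    (h : edgePt e t ∈ I.D s) : ∃ u ∈ Ioo a b, edgePt e u ∈ I.D s := by
  have ho : IsOpen (edgePt e ⁻¹' I.D s) := (I.isOpen_D s).preimage (continuous_edgePt e)
  have hcl : t ∈ closure (Ioo a b) := by rwa [closure_Ioo hab.ne]
  obtain ⟨u, hu, hu'⟩ := mem_closure_iff.1 hcl _ ho h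
  exact ⟨u, hu', hu⟩

/-- The two parts of a cut edge are intervals. -/
theorem Admissible.exists_Ioo_of_isCut (hI : M.Admissible I r) {e : Finset Plane}
    (he : e ∈ M.edges) (hcut : IsCut I e) (s : Bool) :
    ∃ a b, 0 ≤ a ∧ a < b ∧ b ≤ 1 ∧ (∀ t ∈ Ioo a b, edgePt e t ∈ I.D s) ∧
      (∀ t ∈ Icc (0 : ℝ) 1, edgePt e t ∈ I.D s → t ∈ Icc a b) ∧
      ∃ τ ∈ Ioo (0 : ℝ) 1, ∀ t ∈ Ioo (0 : ℝ) 1, t ≠ τ → edgePt e t ∉ I.Γ := by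
  rcases hI.edge_subset_or he with h | ⟨τ, hτ, s₁, s₂, h1, h2⟩
  · obtain ⟨x, hx, hx'⟩ := hcut true
    exact absurd (h hx) (I.notMem_Γ hx')
  have hcard := card_of_mem_edges he
  have hΓ : ∀ t ∈ Ioo (0 : ℝ) 1, t ≠ τ → edgePt e t ∉ I.Γ := by
    intro t ht hne
    rcases lt_or_gt_of_ne hne with h | h
    · exact I.notMem_Γ (h1 t ⟨ht.1, h⟩)
    · exact I.notMem_Γ (h2 t ⟨h, ht.2⟩)
  have hpart : ∀ s', ∀ t ∈ Icc (0 : ℝ) 1, edgePt e t ∈ I.D s' →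
      (t ≤ τ ∧ s' = s₁) ∨ (τ ≤ t ∧ s' = s₂) := by
    intro s' t ht hts
    rcases le_total t τ with h | h
    · obtain ⟨u, hu, hu'⟩ := exists_Ioo_mem_D hτ.1 ⟨ht.1, h⟩ hts
      exact Or.inl ⟨h, I.disjoint_D' hu' (h1 u hu)⟩
    · obtain ⟨u, hu, hu'⟩ := exists_Ioo_mem_D hτ.2 ⟨h, ht.2⟩ hts
      exact Or.inr ⟨h, I.disjoint_D' hu' (h2 u hu)⟩
  have hany : ∀ s', s' = s₁ ∨ s' = s₂ := by
    intro s'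
    obtain ⟨x, hx, hx'⟩ := hcut s'
    rw [hull_edge hcard] at hx
    obtain ⟨t, ht, rfl⟩ := hx
    rcases hpart s' t ht hx' with h | h
    · exact Or.inl h.2
    · exact Or.inr h.2
  have hne : s₁ ≠ s₂ := by
    rintro rfl
    have := hany !s₁
    cases s₁ <;> simp at this
  rcases hany s with rfl | rfl
  · refine ⟨0, τ, le_rfl, hτ.1, hτ.2.le, h1, fun t ht hts => ⟨ht.1, ?_⟩, τ, hτ, hΓ⟩
    rcases hpart s t ht hts with h | h
    · exact h.1
    · exact absurd h.2 hne
  · refine ⟨τ, 1, hτ.1.le, hτ.2, le_rfl, h2, fun t ht hts => ⟨?_, ht.2⟩, τ, hτ, hΓ⟩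
    rcases hpart s t ht hts with h | h
    · exact absurd h.2.symm hne
    · exact h.1

/-- An edge that is not cut is part of the interface or on one side of it. -/
theorem Admissible.exists_of_not_isCut (hI : M.Admissible I r) {e : Finset Plane}
    (he : e ∈ M.edges) (hcut : ¬ IsCut I e) (hsub : ¬ hull e ⊆ I.Γ) :
    ∃ s, (∀ t ∈ Icc (0 : ℝ) 1, edgePt e t ∉ I.D !s) ∧
      ∃ τ ∈ Ioo (0 : ℝ) 1, ∀ t ∈ Ioo (0 : ℝ) 1, t ≠ τ → edgePt e t ∈ I.D s := by
  obtain ⟨τ, hτ, s₁, s₂, h1, h2⟩ := (hI.edge_subset_or he).resolve_left hsub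
  have hcard := card_of_mem_edges he
  have hin : ∀ t ∈ Icc (0 : ℝ) 1, edgePt e t ∈ hull e := fun t ht => edgePt_mem_hull hcard ht
  have h12 : s₁ = s₂ := by
    by_contra hne
    apply hcut
    obtain ⟨t, ht⟩ := exists_between hτ.1
    obtain ⟨u, hu⟩ := exists_between hτ.2
    intro s
    by_cases hs : s = s₁
    · exact ⟨_, hin t ⟨ht.1.le, (ht.2.trans hτ.2).le⟩, hs ▸ h1 t ht⟩
    · have : s = s₂ := by
        revert hs hne
        cases s <;> cases s₁ <;> cases s₂ <;> simp
      exact ⟨_, hin u ⟨(hτ.1.trans hu.1).le, hu.2.le⟩, this ▸ h2 u hu⟩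
  subst h12
  refine ⟨s₁, fun t ht hts => ?_, τ, hτ, fun t ht hne => ?_⟩
  · have key : ∀ s', edgePt e t ∈ I.D s' → s' = s₁ := by
      intro s' hs'
      rcases le_total t τ with h | h
      · obtain ⟨u, hu, hu'⟩ := exists_Ioo_mem_D hτ.1 ⟨ht.1, h⟩ hs'
        exact I.disjoint_D' hu' (h1 u hu)
      · obtain ⟨u, hu, hu'⟩ := exists_Ioo_mem_D hτ.2 ⟨h, ht.2⟩ hs'
        exact I.disjoint_D' hu' (h2 u hu)
    have := key _ hts
    cases s₁ <;> simp at this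
  · rcases lt_or_gt_of_ne hne with h | h
    · exact h1 t ⟨ht.1, h⟩
    · exact h2 t ⟨h, ht.2⟩

/-! ### Discs in the parts of the triangles -/

/-- The disc of radius `κ L` about `z` is in the part of `T` on the side `s` of the interface, and
its centre is near to the points of `S`. -/
def HasDisc (I : Interface) (κ L : ℝ) (T : Finset Plane) (s : Bool) (S : Set Plane) : Prop :=
  ∃ z, Metric.closedBall z (κ * L) ⊆ hull T ∩ I.D s ∧ ∀ x ∈ S, dist x z ≤ 2 * L

theorem ShapeRegular.hasDisc (hM : M.ShapeRegular ρ) {T : Finset Plane} (hT : T ∈ M.tri)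
    {A B : Plane} (hl : OnLeft A B T) {c : ℝ} (hc : 0 < c) (hcρ : c ≤ ρ) (hc4 : c ≤ 1 / 4)
    {a b : ℝ} (ha : 0 ≤ a) (hab : a < b) (hb : b ≤ 1) {s : Bool}
    (h : flatTri c (AffineMap.lineMap A B a) (AffineMap.lineMap A B b) ⊆ I.D s) :
    HasDisc I (c / 16) ‖(AffineMap.lineMap A B b : Plane) - AffineMap.lineMap A B a‖ T s
      (segment ℝ (AffineMap.lineMap A B a) (AffineMap.lineMap A B b)) := by
  have hAB : A ≠ B := by
    rintro rfl
    obtain ⟨C, -, hD⟩ := hl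
    simp [cr] at hD
  have hne : (AffineMap.lineMap A B a : Plane) ≠ AffineMap.lineMap A B b := fun h' =>
    hab.ne (AffineMap.lineMap_injective ℝ hAB h')
  obtain ⟨z, hz, hz'⟩ := exists_closedBall_subset_flatTri hc hc4 hne
  refine ⟨z, fun x hx => ⟨?_, h (hz hx)⟩, hz'⟩
  exact interior_subset (hM.flatTri_subset (hc.le.trans hcρ) hT hl hcρ
    (flatTri_lineMap_subset hc ha hab hb (hz hx)))

theorem ShapeRegular.hasDisc_edge (hM : M.ShapeRegular ρ) {T : Finset Plane} (hT : T ∈ M.tri)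
    {e : Finset Plane} (hl : OnLeft (ends e).1 (ends e).2 T) {c : ℝ} (hc : 0 < c) (hcρ : c ≤ ρ)
    (hc4 : c ≤ 1 / 4) {a b : ℝ} (ha : 0 ≤ a) (hab : a < b) (hb : b ≤ 1) {s : Bool}
    (h : flatTri c (edgePt e a) (edgePt e b) ⊆ I.D s) :
    HasDisc I (c / 16) ((b - a) * edgeLen e) T s (edgePt e '' Icc a b) := by
  rw [← norm_edgePt_sub e hab.le, ← segment_edgePt e hab.le]
  exact hM.hasDisc hT hl hc hcρ hc4 ha hab hb h

theorem ShapeRegular.hasDisc_edge' (hM : M.ShapeRegular ρ) {T : Finset Plane} (hT : T ∈ M.tri)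
    {e : Finset Plane} (hl : OnLeft (ends e).2 (ends e).1 T) {c : ℝ} (hc : 0 < c) (hcρ : c ≤ ρ)
    (hc4 : c ≤ 1 / 4) {a b : ℝ} (ha : 0 ≤ a) (hab : a < b) (hb : b ≤ 1) {s : Bool}
    (h : flatTri c (edgePt e b) (edgePt e a) ⊆ I.D s) :
    HasDisc I (c / 16) ((b - a) * edgeLen e) T s (edgePt e '' Icc a b) := by
  rw [← norm_edgePt_sub e hab.le, ← segment_edgePt e hab.le, norm_sub_rev, segment_symm]
  -- The triangle on the right of the edge is on the left of the reversed edge, whose parameters are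
  -- 1 − b and 1 − a.
  have := hM.hasDisc (I := I) (s := s) hT hl hc hcρ hc4 (a := 1 - b) (b := 1 - a) (by linarith)
    (by linarith) (by linarith)
  rw [AffineMap.lineMap_apply_one_sub, AffineMap.lineMap_apply_one_sub] at this
  exact this h

theorem Admissible.edgeLen_le (hI : M.Admissible I r) {e : Finset Plane} (he : e ∈ M.edges)
    {a b : ℝ} (ha : 0 ≤ a) (hab : a ≤ b) (hb : b ≤ 1) :
    ‖edgePt e b - edgePt e a‖ ≤ r / 2 := by
  rw [norm_edgePt_sub e hab]
  have h1 := (edgeLen_le_h he).trans hI.small.le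
  have h2 := edgeLen_pos (card_of_mem_edges he)
  nlinarith

/-- A part of an edge on one side of the interface has a disc in one of the adjacent triangles. -/
theorem Admissible.exists_hasDisc (hI : M.Admissible I r) (hM : M.ShapeRegular ρ) {c : ℝ}
    (hc : 0 < c) (hcρ : c ≤ ρ) (hc4 : c ≤ 1 / 4) {e : Finset Plane} (he : e ∈ M.intEdges)
    {a b : ℝ} (ha : 0 ≤ a) (hab : a < b) (hb : b ≤ 1) {s : Bool}
    (hs : ∀ t ∈ Ioo a b, edgePt e t ∉ I.D !s) (hs' : ∃ t ∈ Ioo a b, edgePt e t ∈ I.D s) :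
    ∃ T, (T = M.T₁ e ∨ T = M.T₂ e) ∧
      HasDisc I (c / 16) ((b - a) * edgeLen e) T s (edgePt e '' Icc a b) := by
  have hcard := card_of_mem_intEdges he
  have hee := (mem_intEdges.1 he).1
  obtain ⟨L, R, hL, hR, hLt, hRt, hLR⟩ := hM.exists_left_right (hc.trans_le hcρ) he
  have hL12 : L = M.T₁ e ∨ L = M.T₂ e := hLR.imp And.left And.left
  have hR12 : R = M.T₁ e ∨ R = M.T₂ e := hLR.symm.imp And.right And.right
  have hne : edgePt e a ≠ edgePt e b := fun h => hab.ne (edgePt_injective hcard h)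
  obtain ⟨t, ht, hts⟩ := hs'
  have hto : edgePt e t ∈ openSegment ℝ (edgePt e a) (edgePt e b) := by
    rw [openSegment_edgePt e hab]
    exact mem_image_of_mem _ ht
  -- The flat triangle that the interface misses decides which of the adjacent elements provides the
  -- disc.
  rcases Interface.disjoint_flatTri_or hI.tubular hc4 hne (hI.edgeLen_le hee ha hab.le hb)
    (s := !s) (by
      rw [openSegment_edgePt e hab]
      rintro _ ⟨u, hu, rfl⟩
      exact hs u hu) with h | h
  · exact ⟨L, hL12, hM.hasDisc_edge hLt hL hc hcρ hc4 ha hab hb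
      (flatTri_subset_of_mem hc hne h hto hts)⟩
  · exact ⟨R, hR12, hM.hasDisc_edge' hRt hR hc hcρ hc4 ha hab hb
      (flatTri_subset_of_mem hc hne.symm h (by rwa [openSegment_symm]) hts)⟩

/-- If the interface misses the flat triangles on both sides of an edge, then both adjacent
triangles have a disc. -/
theorem ShapeRegular.hasDisc_both (hM : M.ShapeRegular ρ) {c : ℝ}
    (hc : 0 < c) (hcρ : c ≤ ρ) (hc4 : c ≤ 1 / 4) {e : Finset Plane} (he : e ∈ M.intEdges)
    (h1 : Disjoint (flatTri c (ends e).1 (ends e).2) I.Γ)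
    (h2 : Disjoint (flatTri c (ends e).2 (ends e).1) I.Γ) :
    ∃ s₁ s₂, (∀ t ∈ Ioo (0 : ℝ) 1, phase I (M.T₁ e) (edgePt e t) = s₁ ∧
        phase I (M.T₂ e) (edgePt e t) = s₂) ∧
      HasDisc I (c / 16) (edgeLen e) (M.T₁ e) s₁ (edgePt e '' Icc 0 1) ∧
      HasDisc I (c / 16) (edgeLen e) (M.T₂ e) s₂ (edgePt e '' Icc 0 1) := by
  obtain ⟨L, R, hL, hR, hLt, hRt, hLR⟩ := hM.exists_left_right (hc.trans_le hcρ) he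
  obtain ⟨sL, hsL⟩ := exists_flatTri_subset h1
  obtain ⟨sR, hsR⟩ := exists_flatTri_subset h2
  have e0 : edgePt e 0 = (ends e).1 := AffineMap.lineMap_apply_zero _ _
  have e1 : edgePt e 1 = (ends e).2 := AffineMap.lineMap_apply_one _ _
  have dL := hM.hasDisc_edge (a := 0) (b := 1) (s := sL) hLt hL hc hcρ hc4 le_rfl one_pos le_rfl
    (by rwa [e0, e1])
  have dR := hM.hasDisc_edge' (a := 0) (b := 1) (s := sR) hRt hR hc hcρ hc4 le_rfl one_pos le_rfl
    (by rwa [e0, e1])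
  rw [sub_zero, one_mul] at dL dR
  have pL : ∀ t ∈ Ioo (0 : ℝ) 1, phase I L (edgePt e t) = sL := fun t ht =>
    phase_eq_of_flatTri_subset hc hL (edgePt_mem_openSegment e ht) hsL
  have pR : ∀ t ∈ Ioo (0 : ℝ) 1, phase I R (edgePt e t) = sR := fun t ht =>
    phase_eq_of_flatTri_subset hc hR (by
      rw [openSegment_symm]
      exact edgePt_mem_openSegment e ht) hsR
  rcases hLR with ⟨rfl, rfl⟩ | ⟨rfl, rfl⟩
  · exact ⟨sL, sR, fun t ht => ⟨pL t ht, pR t ht⟩, dL, dR⟩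
  · exact ⟨sR, sL, fun t ht => ⟨pR t ht, pL t ht⟩, dR, dL⟩

theorem mem_intEdgesI {e : Finset Plane} : e ∈ M.intEdgesI I ↔ e ∈ M.intEdges ∧ IsCut I e := by
  simp [intEdgesI]

theorem mem_intEdgesN {e : Finset Plane} : e ∈ M.intEdgesN I ↔ e ∈ M.intEdges ∧ ¬ IsCut I e := by
  simp [intEdgesN]

theorem mem_intEdgesNF {e : Finset Plane} : e ∈ M.intEdgesNF I ↔
    e ∈ M.intEdgesN I ∧ ∃ T, M.IsInterfaceElt I T ∧ e ⊆ T := by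
  simp [intEdgesNF]

/-- On an edge that is not cut there are discs in both adjacent triangles, or the edge belongs to
an interface element and there is a disc in one of the adjacent triangles. -/
theorem Admissible.hasDisc_of_not_isCut (hI : M.Admissible I r) (hM : M.ShapeRegular ρ) {c : ℝ}
    (hc : 0 < c) (hcρ : c ≤ ρ) (hc4 : c ≤ 1 / 4) {e : Finset Plane} (he : e ∈ M.intEdgesN I) :
    (∃ s₁ s₂, (∀ t ∈ Ioo (0 : ℝ) 1, phase I (M.T₁ e) (edgePt e t) = s₁ ∧
        phase I (M.T₂ e) (edgePt e t) = s₂) ∧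
      HasDisc I (c / 16) (edgeLen e) (M.T₁ e) s₁ (edgePt e '' Icc 0 1) ∧
      HasDisc I (c / 16) (edgeLen e) (M.T₂ e) s₂ (edgePt e '' Icc 0 1)) ∨
    (e ∈ M.intEdgesNF I ∧ ∃ s, (∃ τ, ∀ t ∈ Ioo (0 : ℝ) 1, t ≠ τ → edgePt e t ∈ I.D s) ∧
      ∃ T, (T = M.T₁ e ∨ T = M.T₂ e) ∧
        HasDisc I (c / 16) (edgeLen e) T s (edgePt e '' Icc 0 1)) := by
  obtain ⟨hei, hcut⟩ := mem_intEdgesN.1 he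
  have hcard := card_of_mem_intEdges hei
  have hee := (mem_intEdges.1 hei).1
  have e0 : edgePt e 0 = (ends e).1 := AffineMap.lineMap_apply_zero _ _
  have e1 : edgePt e 1 = (ends e).2 := AffineMap.lineMap_apply_one _ _
  have hAB := (ends_spec hcard).1
  have hlen := hI.edgeLen_le hee le_rfl zero_le_one le_rfl
  rw [e0, e1] at hlen
  by_cases hsub : hull e ⊆ I.Γ
  · left
    -- An edge contained in the interface may have different phases and coefficients on its two
    -- sides, so one disc would not do; here both flat triangles are free of the interface.
    have ho : openSegment ℝ (ends e).1 (ends e).2 ⊆ I.Γ := by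
      refine Subset.trans ?_ hsub
      rw [hull_edge hcard, ← e0, ← e1, openSegment_edgePt e one_pos]
      exact image_mono Ioo_subset_Icc_self
    refine hM.hasDisc_both hc hcρ hc4 hei ?_ ?_
    · exact Interface.disjoint_flatTri_of_subset hI.tubular hc4 hAB hlen ho
    · rw [norm_sub_rev] at hlen
      rw [openSegment_symm] at ho
      exact Interface.disjoint_flatTri_of_subset hI.tubular hc4 hAB.symm hlen ho
  · obtain ⟨s, hs, τ, hτ, hτ'⟩ := hI.exists_of_not_isCut hee hcut hsub
    by_cases hNF : e ∈ M.intEdgesNF I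
    · right
      refine ⟨hNF, s, ⟨τ, hτ'⟩, ?_⟩
      obtain ⟨t, ht⟩ := exists_between hτ.1
      have := hI.exists_hasDisc hM hc hcρ hc4 hei le_rfl one_pos le_rfl (s := s)
        (fun t ht => hs t (Ioo_subset_Icc_self ht))
        ⟨t, ⟨ht.1, ht.2.trans hτ.2⟩, hτ' t ⟨ht.1, ht.2.trans hτ.2⟩ ht.2.ne⟩
      rwa [sub_zero, one_mul] at this
    · left
      obtain ⟨L, R, hL, hR, hLt, hRt, hLR⟩ := hM.exists_left_right (hc.trans_le hcρ) hei
      obtain ⟨-, -, -, hs1, hs2⟩ := M.adj e hei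
      -- The edge belongs to no interface element, so the interiors of both adjacent triangles, and
      -- with them the flat triangles, miss the interface.
      have hdis : ∀ T ∈ M.tri, e ⊆ T → ∀ x ∈ interior (hull T), x ∉ I.Γ := by
        intro T hT heT x hx hxΓ
        exact hNF (mem_intEdgesNF.2 ⟨he, T, ⟨hT, x, hx, hxΓ⟩, heT⟩)
      have hLe : e ⊆ L := by rcases hLR with ⟨rfl, -⟩ | ⟨rfl, -⟩ <;> assumption
      have hRe : e ⊆ R := by rcases hLR with ⟨-, rfl⟩ | ⟨-, rfl⟩ <;> assumption
      refine hM.hasDisc_both hc hcρ hc4 hei ?_ ?_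
      · exact Set.disjoint_left.2 fun x hx =>
          hdis L hLt hLe x (hM.flatTri_subset (hc.le.trans hcρ) hLt hL hcρ hx)
      · exact Set.disjoint_left.2 fun x hx =>
          hdis R hRt hRe x (hM.flatTri_subset (hc.le.trans hcρ) hRt hR hcρ hx)

end Mesh

end ImmersedIP

namespace ImmersedIP

/-! ### Integrability of traces -/

/-- "Eventually" is written with countably many compact ranges of ε, and on each of them compactness
makes the condition on x open. This makes `phase` measurable, so that traces are integrable and edge
integrals additive. -/
theorem measurableSet_eventually_mem {D : Set Plane} (hD : IsOpen D) (b : Plane) :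
    MeasurableSet {x : Plane | ∀ᶠ ε in 𝓝[>] (0 : ℝ), AffineMap.lineMap x b ε ∈ D} := by
  have h1 : {x : Plane | ∀ᶠ ε in 𝓝[>] (0 : ℝ), AffineMap.lineMap x b ε ∈ D} =
      ⋃ n : ℕ, ⋂ m : ℕ, {x | ∀ ε ∈ Icc (1 / ((m : ℝ) + 1)) (1 / ((n : ℝ) + 1)),
        AffineMap.lineMap x b ε ∈ D} := by
    ext x
    simp only [mem_ofPred_eq, mem_iUnion, mem_iInter]
    constructor
    · intro h
      obtain ⟨u, hu, hsub⟩ := mem_nhdsGT_iff_exists_Ioo_subset.1 h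
      obtain ⟨n, hn⟩ := exists_nat_one_div_lt (show 0 < u from hu)
      refine ⟨n, fun m ε hε => hsub ⟨lt_of_lt_of_le ?_ hε.1, hε.2.trans_lt hn⟩⟩
      positivity
    · rintro ⟨n, hn⟩
      have hpos : (0 : ℝ) < 1 / ((n : ℝ) + 1) := by positivity
      filter_upwards [Ioc_mem_nhdsGT hpos] with ε hε
      obtain ⟨m, hm⟩ := exists_nat_one_div_lt (show 0 < ε from hε.1)
      exact hn m ε ⟨hm.le, hε.2⟩
  rw [h1]
  refine MeasurableSet.iUnion fun n => MeasurableSet.iInter fun m => IsOpen.measurableSet ?_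
  rw [isOpen_iff_eventually]
  intro x hx
  refine isCompact_Icc.eventually_forall_of_forall_eventually fun ε hε => ?_
  have hc : Continuous fun z : Plane × ℝ => (AffineMap.lineMap z.1 b z.2 : Plane) := by
    simp only [AffineMap.lineMap_apply, vsub_eq_sub, vadd_eq_add]
    fun_prop
  exact hc.continuousAt.eventually_mem (hD.mem_nhds (hx ε hε))

theorem measurable_phase (I : Interface) (T : Finset Plane) : Measurable (phase I T) := by
  classical
  unfold phase
  exact Measurable.ite (measurableSet_eventually_mem (I.isOpen_D false) _) measurable_const
    measurable_const

/-- A function on the parameter interval of an edge that is measurable and bounded. -/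
def BddMeas (f : ℝ → ℝ) : Prop := Measurable f ∧ ∃ C, ∀ t ∈ Icc (0 : ℝ) 1, |f t| ≤ C

namespace BddMeas

variable {f g : ℝ → ℝ}

theorem of_continuous (hf : Continuous f) : BddMeas f :=
  ⟨hf.measurable, isCompact_Icc.exists_bound_of_continuousOn hf.continuousOn⟩

theorem add (hf : BddMeas f) (hg : BddMeas g) : BddMeas fun t => f t + g t := by
  obtain ⟨C, hC⟩ := hf.2
  obtain ⟨C', hC'⟩ := hg.2
  exact ⟨hf.1.add hg.1, C + C', fun t ht =>
    (abs_add_le _ _).trans (add_le_add (hC t ht) (hC' t ht))⟩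

theorem mul (hf : BddMeas f) (hg : BddMeas g) : BddMeas fun t => f t * g t := by
  obtain ⟨C, hC⟩ := hf.2
  obtain ⟨C', hC'⟩ := hg.2
  refine ⟨hf.1.mul hg.1, C * C', fun t ht => ?_⟩
  rw [abs_mul]
  exact mul_le_mul (hC t ht) (hC' t ht) (abs_nonneg _) ((abs_nonneg _).trans (hC t ht))

theorem const_mul (hf : BddMeas f) (a : ℝ) : BddMeas fun t => a * f t :=
  (of_continuous continuous_const).mul hf

theorem sub (hf : BddMeas f) (hg : BddMeas g) : BddMeas fun t => f t - g t := by
  have := hf.add (hg.const_mul (-1))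
  simpa [sub_eq_add_neg] using this

theorem div_const (hf : BddMeas f) (a : ℝ) : BddMeas fun t => f t / a := by
  have := hf.const_mul a⁻¹
  simpa [div_eq_inv_mul] using this

theorem sq (hf : BddMeas f) : BddMeas fun t => f t ^ 2 := by
  simpa only [_root_.sq] using hf.mul hf

theorem integrableOn (hf : BddMeas f) {S : Set ℝ} (hS : S ⊆ Icc 0 1) : IntegrableOn f S := by
  obtain ⟨C, hC⟩ := hf.2
  refine IntegrableOn.mono_set ?_ hS
  refine Measure.integrableOn_of_bounded (M := C) (by simp) hf.1.aestronglyMeasurable ?_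
  exact (ae_restrict_iff' measurableSet_Icc).2 (Eventually.of_forall hC)

end BddMeas

/-- The parameters of the points of an edge that are in `S`. -/
def edgeSet (e : Finset Plane) (S : Set Plane) : Set ℝ :=
  {t | t ∈ Icc (0 : ℝ) 1 ∧ edgePt e t ∈ S}

theorem edgeSet_subset (e : Finset Plane) (S : Set Plane) : edgeSet e S ⊆ Icc 0 1 := fun _ h => h.1

theorem edgeSet_univ (e : Finset Plane) : edgeSet e univ = Icc 0 1 := by
  ext t
  simp [edgeSet]

theorem measurableSet_edgeSet (e : Finset Plane) {S : Set Plane} (hS : MeasurableSet S) :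
    MeasurableSet (edgeSet e S) :=
  measurableSet_Icc.inter ((continuous_edgePt e).measurable hS)

theorem edgeInt_eq (e : Finset Plane) (S : Set Plane) (f : Plane → ℝ) :
    edgeInt e S f = edgeLen e * ∫ t in edgeSet e S, f (edgePt e t) := rfl

theorem subLen_eq (e : Finset Plane) (S : Set Plane) :
    subLen e S = edgeLen e * volume.real (edgeSet e S) := rfl

section Nice

variable (M : Mesh) (I : Interface) (e : Finset Plane)

theorem bddMeas_val (T : Finset Plane) (g : Piece) :
    BddMeas fun t => val I T g (edgePt e t) := by
  have h0 : BddMeas fun t => ev (g true) (edgePt e t) := .of_continuous (by fun_prop)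
  have h1 : BddMeas fun t => ev (g false) (edgePt e t) := .of_continuous (by fun_prop)
  have hm : MeasurableSet {t : ℝ | phase I T (edgePt e t) = true} :=
    ((measurable_phase I T).comp (continuous_edgePt e).measurable) (measurableSet_singleton true)
  have he : (fun t => val I T g (edgePt e t)) = fun t => if phase I T (edgePt e t) = true then
      ev (g true) (edgePt e t) else ev (g false) (edgePt e t) := by
    funext t
    unfold val
    cases phase I T (edgePt e t) <;> simp
  rw [he]
  obtain ⟨C, hC⟩ := h0.2
  obtain ⟨C', hC'⟩ := h1.2
  refine ⟨Measurable.ite hm h0.1 h1.1, max C C', fun t ht => ?_⟩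
  beta_reduce
  split_ifs
  · exact (hC t ht).trans (le_max_left _ _)
  · exact (hC' t ht).trans (le_max_right _ _)

theorem bddMeas_beta (T : Finset Plane) (β : Bool → ℝ) :
    BddMeas fun t => β (phase I T (edgePt e t)) := by
  refine ⟨(measurable_from_top (f := β)).comp
    ((measurable_phase I T).comp (continuous_edgePt e).measurable), |β true| + |β false|,
    fun t _ => ?_⟩
  have h0 := abs_nonneg (β true)
  have h1 := abs_nonneg (β false)
  beta_reduce
  cases phase I T (edgePt e t) <;> linarith

theorem bddMeas_betaE (β : Bool → ℝ) : BddMeas fun t => betaE M I β e (edgePt e t) :=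
  ((bddMeas_beta I e _ β).add (bddMeas_beta I e _ β)).div_const 2

theorem bddMeas_jump (v : MeshFun) : BddMeas fun t => jump M I e v (edgePt e t) :=
  (bddMeas_val I e _ _).sub (bddMeas_val I e _ _)

theorem bddMeas_aver (v : MeshFun) : BddMeas fun t => aver M I e v (edgePt e t) :=
  ((bddMeas_val I e _ _).add (bddMeas_val I e _ _)).div_const 2

theorem bddMeas_jumpN (v : MeshFun) : BddMeas fun t => jumpN M I e v (edgePt e t) :=
  bddMeas_jump M I e _

theorem bddMeas_jumpNN (v : MeshFun) : BddMeas fun t => jumpNN M I e v (edgePt e t) :=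
  bddMeas_jump M I e _

theorem bddMeas_averNN (β : Bool → ℝ) (v : MeshFun) :
    BddMeas fun t => averNN M I β e v (edgePt e t) :=
  bddMeas_aver M I e _

end Nice

/-! ### Linearity of traces -/

theorem dirD_add (a : Plane) (q w : Poly) : dirD a (q + w) = dirD a q + dirD a w := by
  simp [dirD, mul_add, Finset.sum_add_distrib]

theorem dirD_smul (a : Plane) (k : ℝ) (q : Poly) : dirD a (k • q) = k • dirD a q := by
  simp [dirD]

theorem pdir_add (a : Plane) (g k : Piece) : pdir a (g + k) = pdir a g + pdir a k := by
  funext s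
  exact dirD_add a _ _

theorem pdir_smul (a : Plane) (c : ℝ) (g : Piece) : pdir a (c • g) = c • pdir a g := by
  funext s
  exact dirD_smul a c _

theorem pmul_add (β : Bool → ℝ) (g k : Piece) : pmul β (g + k) = pmul β g + pmul β k := by
  funext s
  simp [pmul, mul_add]

theorem pmul_smul (β : Bool → ℝ) (c : ℝ) (g : Piece) : pmul β (c • g) = c • pmul β g := by
  funext s
  simp [pmul]

/-- A family of linear functionals on mesh functions, one for each parameter, measurable and
bounded as a function of the parameter. -/
structure IsTrace (F : MeshFun → ℝ → ℝ) : Prop where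
  add : ∀ u v t, F (u + v) t = F u t + F v t
  smul : ∀ (a : ℝ) v t, F (a • v) t = a * F v t
  nice : ∀ v, BddMeas (F v)

theorem isTrace_jump (M : Mesh) (I : Interface) (e : Finset Plane) :
    IsTrace fun v t => jump M I e v (edgePt e t) where
  add u v t := by simp only [jump, Pi.add_apply, val_add]; ring
  smul a v t := by simp only [jump, Pi.smul_apply, val_smul]; ring
  nice v := bddMeas_jump M I e v

theorem isTrace_jumpN (M : Mesh) (I : Interface) (e : Finset Plane) :
    IsTrace fun v t => jumpN M I e v (edgePt e t) where
  add u v t := by simp only [jumpN, jump, Pi.add_apply, pdir_add, val_add]; ring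
  smul a v t := by simp only [jumpN, jump, Pi.smul_apply, pdir_smul, val_smul]; ring
  nice v := bddMeas_jumpN M I e v

theorem isTrace_jumpNN (M : Mesh) (I : Interface) (e : Finset Plane) :
    IsTrace fun v t => jumpNN M I e v (edgePt e t) where
  add u v t := by simp only [jumpNN, jump, Pi.add_apply, pdir_add, val_add]; ring
  smul a v t := by simp only [jumpNN, jump, Pi.smul_apply, pdir_smul, val_smul]; ring
  nice v := bddMeas_jumpNN M I e v

theorem isTrace_averNN (M : Mesh) (I : Interface) (β : Bool → ℝ) (e : Finset Plane) :
    IsTrace fun v t => averNN M I β e v (edgePt e t) where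
  add u v t := by simp only [averNN, aver, Pi.add_apply, pdir_add, pmul_add, val_add]; ring
  smul a v t := by simp only [averNN, aver, Pi.smul_apply, pdir_smul, pmul_smul, val_smul]; ring
  nice v := bddMeas_averNN M I e β v

theorem edgeInt_mul_add {e : Finset Plane} {F G : MeshFun → Plane → ℝ} {w : Plane → ℝ}
    (hF : IsTrace fun v t => F v (edgePt e t)) (hG : IsTrace fun v t => G v (edgePt e t))
    (hw : BddMeas fun t => w (edgePt e t)) (S : Set Plane) (u u' v : MeshFun) :
    edgeInt e S (fun x => w x * (F (u + u') x * G v x))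
      = edgeInt e S (fun x => w x * (F u x * G v x))
        + edgeInt e S (fun x => w x * (F u' x * G v x)) := by
  rw [edgeInt_eq, edgeInt_eq, edgeInt_eq, ← mul_add, ← integral_add]
  · congr 2
    funext t
    have : F (u + u') (edgePt e t) = F u (edgePt e t) + F u' (edgePt e t) := hF.add u u' t
    rw [this]
    ring
  · exact (hw.mul ((hF.nice u).mul (hG.nice v))).integrableOn (edgeSet_subset e S)
  · exact (hw.mul ((hF.nice u').mul (hG.nice v))).integrableOn (edgeSet_subset e S)

theorem edgeInt_mul_smul {e : Finset Plane} {F G : MeshFun → Plane → ℝ} {w : Plane → ℝ}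
    (hF : IsTrace fun v t => F v (edgePt e t)) (S : Set Plane) (a : ℝ) (u v : MeshFun) :
    edgeInt e S (fun x => w x * (F (a • u) x * G v x))
      = a * edgeInt e S (fun x => w x * (F u x * G v x)) := by
  rw [edgeInt_eq, edgeInt_eq, mul_left_comm, ← integral_const_mul a]
  congr 2
  funext t
  have : F (a • u) (edgePt e t) = a * F u (edgePt e t) := hF.smul a u t
  rw [this]
  ring

theorem edgeInt_add {e : Finset Plane} {F G : MeshFun → Plane → ℝ}
    (hF : IsTrace fun v t => F v (edgePt e t)) (hG : IsTrace fun v t => G v (edgePt e t))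
    (S : Set Plane) (u u' v : MeshFun) :
    edgeInt e S (fun x => F (u + u') x * G v x)
      = edgeInt e S (fun x => F u x * G v x) + edgeInt e S (fun x => F u' x * G v x) := by
  have := edgeInt_mul_add hF hG (w := fun _ => 1) (.of_continuous continuous_const) S u u' v
  simpa only [one_mul] using this

theorem edgeInt_smul {e : Finset Plane} {F G : MeshFun → Plane → ℝ}
    (hF : IsTrace fun v t => F v (edgePt e t)) (S : Set Plane) (a : ℝ) (u v : MeshFun) :
    edgeInt e S (fun x => F (a • u) x * G v x) = a * edgeInt e S (fun x => F u x * G v x) := by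
  have := edgeInt_mul_smul (G := G) hF (w := fun _ => 1) S a u v
  simpa only [one_mul] using this

theorem edgeInt_mul_comm (e : Finset Plane) (S : Set Plane) (f g : Plane → ℝ) :
    edgeInt e S (fun x => f x * g x) = edgeInt e S (fun x => g x * f x) := by
  simp only [mul_comm]

/-! ### Linearity of the integrals over the interface and over the elements -/

namespace Interface

variable (I : Interface)

theorem continuous_coord {f : ℝ → Plane} (hf : Continuous f) (i : Fin 2) :
    Continuous fun t => f t i := by fun_prop

theorem jumpΓ_add (g k : Piece) (t : ℝ) : I.jumpΓ (g + k) t = I.jumpΓ g t + I.jumpΓ k t := by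
  simp only [jumpΓ, Pi.add_apply, ev_add]
  ring

theorem jumpΓ_smul (a : ℝ) (g : Piece) (t : ℝ) : I.jumpΓ (a • g) t = a * I.jumpΓ g t := by
  simp only [jumpΓ, Pi.smul_apply, ev_smul]
  ring

@[fun_prop]
theorem continuous_jumpΓ (g : Piece) : Continuous fun t => I.jumpΓ g t := by
  have h0 : ∀ q : Poly, Continuous fun t => ev q (I.γ t) := fun q =>
    (continuous_ev q).comp I.continuous_γ
  unfold jumpΓ
  exact (h0 _).sub (h0 _)

@[fun_prop]
theorem continuous_jumpΓ_pdir (g : Piece) : Continuous fun t => I.jumpΓ (pdir (I.nor t) g) t := by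
  have h0 : ∀ q : Poly, Continuous fun t => ev q (I.γ t) := fun q =>
    (continuous_ev q).comp I.continuous_γ
  have h1 : ∀ i, Continuous fun t => I.nor t i := fun i =>
    continuous_coord I.continuous_nor i
  have h2 : ∀ s, Continuous fun t => ev (pdir (I.nor t) g s) (I.γ t) := fun s => by
    have a := h0 (MvPolynomial.pderiv 0 (g s))
    have b := h0 (MvPolynomial.pderiv 1 (g s))
    have c := ((h1 0).mul a).add ((h1 1).mul b)
    refine c.congr fun t => ?_
    simp only [pdir, ev_dirD, Pi.add_apply, Pi.mul_apply]
  have a := (h2 true).sub (h2 false)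
  exact a.congr fun t => rfl

theorem integrableOn_curve {f : ℝ → ℝ} (hf : Continuous f) (S : Set Plane) :
    IntegrableOn f (Ico 0 I.len ∩ I.γ ⁻¹' S) :=
  (hf.continuousOn.integrableOn_compact (isCompact_Icc (a := 0) (b := I.len))).mono_set
    (inter_subset_left.trans Ico_subset_Icc_self)

theorem curveInt_add (S : Set Plane) {f g : ℝ → ℝ} (hf : Continuous f) (hg : Continuous g) :
    I.curveInt S (fun t => f t + g t) = I.curveInt S f + I.curveInt S g :=
  integral_add (I.integrableOn_curve hf S) (I.integrableOn_curve hg S)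

theorem curveInt_const_mul (S : Set Plane) (a : ℝ) (f : ℝ → ℝ) :
    I.curveInt S (fun t => a * f t) = a * I.curveInt S f := integral_const_mul _ _

end Interface

theorem hessDot_add (q q' w : Poly) (x : Plane) :
    hessDot (q + q') w x = hessDot q w x + hessDot q' w x := by
  simp only [hessDot, map_add, ev_add, add_mul, Finset.sum_add_distrib]

theorem hessDot_smul (a : ℝ) (q w : Poly) (x : Plane) :
    hessDot (a • q) w x = a * hessDot q w x := by
  simp only [hessDot, Derivation.map_smul, ev_smul, mul_assoc, Finset.mul_sum]

theorem hessDot_comm (q w : Poly) (x : Plane) : hessDot q w x = hessDot w q x := by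
  simp only [hessDot, mul_comm]

theorem integrableOn_hull {f : Plane → ℝ} (hf : Continuous f) (T : Finset Plane) (S : Set Plane) :
    IntegrableOn f (hull T ∩ S) :=
  (hf.continuousOn.integrableOn_compact (isCompact_hull T)).mono_set inter_subset_left

/-! ### The bilinear form -/

section Form

variable (M : Mesh) (I : Interface) (β : Bool → ℝ) (σu σF σn : ℝ)

theorem formA_add (u u' v : MeshFun) : formA M I β (u + u') v = formA M I β u v + formA M I β u' v := by
  simp only [formA, ← Finset.sum_add_distrib, ← mul_add]
  refine Finset.sum_congr rfl fun T _ => Finset.sum_congr rfl fun s _ => ?_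
  rw [← integral_add (integrableOn_hull (continuous_hessDot _ _) T _)
    (integrableOn_hull (continuous_hessDot _ _) T _)]
  simp only [Pi.add_apply, hessDot_add]

theorem formA_smul (a : ℝ) (u v : MeshFun) : formA M I β (a • u) v = a * formA M I β u v := by
  simp only [formA, Finset.mul_sum]
  refine Finset.sum_congr rfl fun T _ => Finset.sum_congr rfl fun s _ => ?_
  rw [mul_left_comm, ← integral_const_mul a]
  simp only [Pi.smul_apply, hessDot_smul]

theorem formA_comm (u v : MeshFun) : formA M I β u v = formA M I β v u := by
  simp only [formA, hessDot_comm]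

theorem formAh_comm (u v : MeshFun) :
    formAh M I β σu σF σn u v = formAh M I β σu σF σn v u := by
  have e1 : ∀ e x, jumpN M I e u x * jumpN M I e v x = jumpN M I e v x * jumpN M I e u x :=
    fun _ _ => mul_comm _ _
  have e2 : ∀ e x, jumpNN M I e u x * jumpNN M I e v x = jumpNN M I e v x * jumpNN M I e u x :=
    fun _ _ => mul_comm _ _
  have e3 : ∀ e x, jump M I e u x * jump M I e v x = jump M I e v x * jump M I e u x :=
    fun _ _ => mul_comm _ _
  have e4 : ∀ T t, I.jumpΓ (pdir (I.nor t) (u T)) t * I.jumpΓ (pdir (I.nor t) (v T)) t =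
      I.jumpΓ (pdir (I.nor t) (v T)) t * I.jumpΓ (pdir (I.nor t) (u T)) t :=
    fun _ _ => mul_comm _ _
  have e5 : ∀ T t, I.jumpΓ (u T) t * I.jumpΓ (v T) t = I.jumpΓ (v T) t * I.jumpΓ (u T) t :=
    fun _ _ => mul_comm _ _
  rw [formAh, formAh, formA_comm, formJu, formJu, formJn, formJn]
  simp only [e1, e2, e3, e4, e5]
  ring

theorem formAh_add (u u' v : MeshFun) :
    formAh M I β σu σF σn (u + u') v
      = formAh M I β σu σF σn u v + formAh M I β σu σF σn u' v := by
  have a1 : ∀ e S, edgeInt e S (fun x => averNN M I β e (u + u') x * jumpN M I e v x) = _ :=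
    fun e S => edgeInt_add (isTrace_averNN M I β e) (isTrace_jumpN M I e) S u u' v
  have a2 : ∀ e S, edgeInt e S (fun x => averNN M I β e v x * jumpN M I e (u + u') x) =
      edgeInt e S (fun x => averNN M I β e v x * jumpN M I e u x) +
      edgeInt e S (fun x => averNN M I β e v x * jumpN M I e u' x) := fun e S => by
    simp only [edgeInt_mul_comm e S (averNN M I β e v)]
    exact edgeInt_add (isTrace_jumpN M I e) (isTrace_averNN M I β e) S u u' v
  have a3 : ∀ e S, edgeInt e S (fun x => betaE M I β e x *
      (jumpN M I e (u + u') x * jumpN M I e v x)) = _ := fun e S =>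
    edgeInt_mul_add (isTrace_jumpN M I e) (isTrace_jumpN M I e) (bddMeas_betaE M I e β) S u u' v
  have a4 : ∀ e S, edgeInt e S (fun x => jumpN M I e (u + u') x * jumpN M I e v x) = _ :=
    fun e S => edgeInt_add (isTrace_jumpN M I e) (isTrace_jumpN M I e) S u u' v
  have a5 : ∀ e S, edgeInt e S (fun x => betaE M I β e x *
      (jumpNN M I e (u + u') x * jumpNN M I e v x)) = _ := fun e S =>
    edgeInt_mul_add (isTrace_jumpNN M I e) (isTrace_jumpNN M I e) (bddMeas_betaE M I e β) S u u' v
  have a6 : ∀ e S, edgeInt e S (fun x => jumpNN M I e (u + u') x * jumpNN M I e v x) = _ :=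
    fun e S => edgeInt_add (isTrace_jumpNN M I e) (isTrace_jumpNN M I e) S u u' v
  have a7 : ∀ e S, edgeInt e S (fun x => jump M I e (u + u') x * jump M I e v x) = _ :=
    fun e S => edgeInt_add (isTrace_jump M I e) (isTrace_jump M I e) S u u' v
  have a8 : ∀ T S, I.curveInt S (fun t => I.jumpΓ (pdir (I.nor t) ((u + u') T)) t *
      I.jumpΓ (pdir (I.nor t) (v T)) t) =
      I.curveInt S (fun t => I.jumpΓ (pdir (I.nor t) (u T)) t *
        I.jumpΓ (pdir (I.nor t) (v T)) t) +
      I.curveInt S (fun t => I.jumpΓ (pdir (I.nor t) (u' T)) t *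
        I.jumpΓ (pdir (I.nor t) (v T)) t) := fun T S => by
    rw [← I.curveInt_add S (by fun_prop) (by fun_prop)]
    simp only [Pi.add_apply, pdir_add, I.jumpΓ_add, add_mul]
  have a9 : ∀ T S, I.curveInt S (fun t => I.jumpΓ ((u + u') T) t * I.jumpΓ (v T) t) =
      I.curveInt S (fun t => I.jumpΓ (u T) t * I.jumpΓ (v T) t) +
      I.curveInt S (fun t => I.jumpΓ (u' T) t * I.jumpΓ (v T) t) := fun T S => by
    rw [← I.curveInt_add S (by fun_prop) (by fun_prop)]
    simp only [Pi.add_apply, I.jumpΓ_add, add_mul]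
  rw [formAh, formAh, formAh, formA_add, formJu, formJu, formJu, formJn, formJn, formJn]
  simp only [a1, a2, a3, a4, a5, a6, a7, a8, a9, mul_add, Finset.sum_add_distrib]
  ring

theorem formAh_smul (a : ℝ) (u v : MeshFun) :
    formAh M I β σu σF σn (a • u) v = a * formAh M I β σu σF σn u v := by
  have a1 : ∀ e S, edgeInt e S (fun x => averNN M I β e (a • u) x * jumpN M I e v x) = _ :=
    fun e S => edgeInt_smul (G := jumpN M I e) (isTrace_averNN M I β e) S a u v
  have a2 : ∀ e S, edgeInt e S (fun x => averNN M I β e v x * jumpN M I e (a • u) x) =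
      a * edgeInt e S (fun x => averNN M I β e v x * jumpN M I e u x) := fun e S => by
    simp only [edgeInt_mul_comm e S (averNN M I β e v)]
    exact edgeInt_smul (G := averNN M I β e) (isTrace_jumpN M I e) S a u v
  have a3 : ∀ e S, edgeInt e S (fun x => betaE M I β e x *
      (jumpN M I e (a • u) x * jumpN M I e v x)) = _ := fun e S =>
    edgeInt_mul_smul (G := jumpN M I e) (isTrace_jumpN M I e) S a u v
  have a4 : ∀ e S, edgeInt e S (fun x => jumpN M I e (a • u) x * jumpN M I e v x) = _ :=
    fun e S => edgeInt_smul (G := jumpN M I e) (isTrace_jumpN M I e) S a u v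
  have a5 : ∀ e S, edgeInt e S (fun x => betaE M I β e x *
      (jumpNN M I e (a • u) x * jumpNN M I e v x)) = _ := fun e S =>
    edgeInt_mul_smul (G := jumpNN M I e) (isTrace_jumpNN M I e) S a u v
  have a6 : ∀ e S, edgeInt e S (fun x => jumpNN M I e (a • u) x * jumpNN M I e v x) = _ :=
    fun e S => edgeInt_smul (G := jumpNN M I e) (isTrace_jumpNN M I e) S a u v
  have a7 : ∀ e S, edgeInt e S (fun x => jump M I e (a • u) x * jump M I e v x) = _ :=
    fun e S => edgeInt_smul (G := jump M I e) (isTrace_jump M I e) S a u v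
  have a8 : ∀ T S, I.curveInt S (fun t => I.jumpΓ (pdir (I.nor t) ((a • u) T)) t *
      I.jumpΓ (pdir (I.nor t) (v T)) t) =
      a * I.curveInt S (fun t => I.jumpΓ (pdir (I.nor t) (u T)) t *
        I.jumpΓ (pdir (I.nor t) (v T)) t) := fun T S => by
    rw [← I.curveInt_const_mul S a]
    simp only [Pi.smul_apply, pdir_smul, I.jumpΓ_smul, mul_assoc]
  have a9 : ∀ T S, I.curveInt S (fun t => I.jumpΓ ((a • u) T) t * I.jumpΓ (v T) t) =
      a * I.curveInt S (fun t => I.jumpΓ (u T) t * I.jumpΓ (v T) t) := fun T S => by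
    rw [← I.curveInt_const_mul S a]
    simp only [Pi.smul_apply, I.jumpΓ_smul, mul_assoc]
  rw [formAh, formAh, formA_smul, formJu, formJu, formJn, formJn]
  simp only [a1, a2, a3, a4, a5, a6, a7, a8, a9, mul_left_comm _ a, ← Finset.mul_sum]
  ring

end Form

end ImmersedIP

namespace ImmersedIP

/-! ### Order properties of the edge integrals -/

theorem edgeLen_nonneg (e : Finset Plane) : 0 ≤ edgeLen e := dist_nonneg

theorem subLen_nonneg (e : Finset Plane) (S : Set Plane) : 0 ≤ subLen e S :=
  mul_nonneg (edgeLen_nonneg e) ENNReal.toReal_nonneg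

theorem subLen_univ (e : Finset Plane) : subLen e univ = edgeLen e := by
  simp [subLen_eq, edgeSet_univ]

theorem edgeInt_nonneg (e : Finset Plane) (S : Set Plane) {f : Plane → ℝ} (hf : ∀ x, 0 ≤ f x) :
    0 ≤ edgeInt e S f :=
  mul_nonneg (edgeLen_nonneg e) (integral_nonneg fun _ => hf _)

theorem edgeInt_mono {e : Finset Plane} {S : Set Plane} (hS : MeasurableSet S) {f g : Plane → ℝ}
    (hf : BddMeas fun t => f (edgePt e t)) (hg : BddMeas fun t => g (edgePt e t))
    (h : ∀ᵐ t : ℝ, t ∈ edgeSet e S → f (edgePt e t) ≤ g (edgePt e t)) :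
    edgeInt e S f ≤ edgeInt e S g := by
  refine mul_le_mul_of_nonneg_left ?_ (edgeLen_nonneg e)
  exact integral_mono_ae (hf.integrableOn (edgeSet_subset e S))
    (hg.integrableOn (edgeSet_subset e S))
    ((ae_restrict_iff' (measurableSet_edgeSet e hS)).2 h)

theorem edgeInt_congr {e : Finset Plane} {S : Set Plane} (hS : MeasurableSet S) {f g : Plane → ℝ}
    (h : ∀ᵐ t : ℝ, t ∈ edgeSet e S → f (edgePt e t) = g (edgePt e t)) :
    edgeInt e S f = edgeInt e S g := by
  rw [edgeInt_eq, edgeInt_eq]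
  congr 1
  exact integral_congr_ae ((ae_restrict_iff' (measurableSet_edgeSet e hS)).2 h)

theorem edgeInt_const_mul (e : Finset Plane) (S : Set Plane) (a : ℝ) (f : Plane → ℝ) :
    edgeInt e S (fun x => a * f x) = a * edgeInt e S f := by
  rw [edgeInt_eq, edgeInt_eq, integral_const_mul]
  ring

theorem edgeInt_const_add_add {e : Finset Plane} (S : Set Plane) {f g : Plane → ℝ}
    (hf : BddMeas fun t => f (edgePt e t)) (hg : BddMeas fun t => g (edgePt e t)) (k a b : ℝ) :
    edgeInt e S (fun x => k + (a * f x + b * g x))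
      = k * subLen e S + (a * edgeInt e S f + b * edgeInt e S g) := by
  have hk : BddMeas fun _ : ℝ => k := .of_continuous continuous_const
  have hf' := (hf.const_mul a).integrableOn (edgeSet_subset e S)
  have hg' := (hg.const_mul b).integrableOn (edgeSet_subset e S)
  simp only [edgeInt_eq, subLen_eq]
  rw [integral_add (hk.integrableOn (edgeSet_subset e S))
    (((hf.const_mul a).add (hg.const_mul b)).integrableOn (edgeSet_subset e S)),
    integral_add hf' hg', integral_const_mul, integral_const_mul, setIntegral_const, smul_eq_mul]
  ring

theorem norm_edgeNormal (M : Mesh) {e : Finset Plane} (he : e.card = 2) :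
    ‖edgeNormal M e‖ = 1 := by
  have h : ‖(edgeLen e)⁻¹ • rot ((ends e).2 - (ends e).1)‖ = 1 := by
    rw [norm_smul, norm_rot, ← edgeLen_eq, norm_inv, Real.norm_of_nonneg (edgeLen_nonneg e),
      inv_mul_cancel₀ (edgeLen_pos he).ne']
  simp only [edgeNormal]
  split_ifs
  · exact h
  · rwa [norm_neg]

/-! ### The inverse trace inequality on a disc next to an edge -/

/-- The square of the `H²` seminorm on the part of an element on one side of the interface. -/
noncomputable def hessEnergy (I : Interface) (v : MeshFun) (T : Finset Plane) (s : Bool) : ℝ :=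
  ∫ x in hull T ∩ I.D s, hessDot (v T s) (v T s) x

theorem hessEnergy_nonneg (I : Interface) (v : MeshFun) (T : Finset Plane) (s : Bool) :
    0 ≤ hessEnergy I v T s :=
  integral_nonneg fun _ => hessDot_self_nonneg _ _

/-- The second normal derivative on an edge is controlled by the Hessian on a disc near it. -/
def TraceBound (p : ℕ) (κ C : ℝ) : Prop :=
  ∀ q : Poly, q.totalDegree ≤ p → ∀ (z x : Plane) (L : ℝ), 0 < L → dist x z ≤ 2 * L →
    L ^ 2 * ev q x ^ 2 ≤ C * ∫ x in Metric.closedBall z (κ * L), ev q x ^ 2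

theorem mem_pieces {p : ℕ} {g : Piece} : g ∈ pieces p ↔ ∀ s, (g s).totalDegree ≤ p := by
  simp [pieces, Submodule.mem_pi, MvPolynomial.mem_restrictTotalDegree]

/-- The trace bound on the disc, combined with ∂ₙₙ² ≤ |∇²|² and with the inclusion of the disc in
the part of T on side s. -/
theorem Mesh.HasDisc.sq_le {I : Interface} {κ L C : ℝ} {p : ℕ} {T : Finset Plane} {s : Bool}
    {S : Set Plane} (h : Mesh.HasDisc I κ L T s S) (hC : TraceBound p κ C) (hC0 : 0 ≤ C)
    (hL : 0 < L) {v : MeshFun} (hv : v T ∈ pieces p) {n : Plane} (hn : ‖n‖ = 1) {x : Plane}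
    (hx : x ∈ S) :
    L ^ 2 * ev (dirD n (dirD n (v T s))) x ^ 2 ≤ C * hessEnergy I v T s := by
  obtain ⟨z, hz, hz'⟩ := h
  refine (hC _ ((totalDegree_dirD_le _ _).trans ((totalDegree_dirD_le _ _).trans
    (mem_pieces.1 hv s))) z x L hL (hz' x hx)).trans (mul_le_mul_of_nonneg_left ?_ hC0)
  have hi := integrableOn_hull (continuous_hessDot (v T s) (v T s)) T (I.D s)
  calc ∫ x in Metric.closedBall z (κ * L), ev (dirD n (dirD n (v T s))) x ^ 2
      ≤ ∫ x in Metric.closedBall z (κ * L), hessDot (v T s) (v T s) x := by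
        refine setIntegral_mono ?_ (hi.mono_set hz) fun x => dirD_dirD_sq_le n hn _ _
        exact ((continuous_ev _).pow 2).continuousOn.integrableOn_compact
          (isCompact_closedBall _ _)
    _ ≤ hessEnergy I v T s := setIntegral_mono_set hi
        (Eventually.of_forall fun _ => hessDot_self_nonneg _ _) hz.eventuallyLE

/-! ### Estimates of the consistency terms -/

theorem two_mul_le_young {a : ℝ} (ha : 0 < a) (x y : ℝ) : 2 * x * y ≤ a * x ^ 2 + a⁻¹ * y ^ 2 := by
  have h : 0 ≤ a⁻¹ * (a * x - y) ^ 2 := by positivity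
  have e : a⁻¹ * (a * x - y) ^ 2 = a * x ^ 2 + a⁻¹ * y ^ 2 - 2 * x * y := by
    field_simp
    ring
  linarith

/-- Here q is the trace from the good element and R, up to sign, the jump of the second derivative,
so that 2q + R is the sum of both traces. The weights L and 1/L are those of the penalties. -/
theorem young_single {δ L E q R J : ℝ} (hδ : 0 < δ) (hL : 0 < L) (hE : L ^ 2 * q ^ 2 ≤ E) :
    2 * q * J + R * J ≤ δ * E / L + ((δ⁻¹ + 1 / 2) / L * J ^ 2 + L / 2 * R ^ 2) := by
  have h1 := two_mul_le_young (mul_pos hδ hL) q J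
  have h2 := two_mul_le_young hL R J
  have h3 : δ * L * q ^ 2 ≤ δ * E / L := by
    rw [le_div_iff₀ hL]
    nlinarith
  have e : (δ⁻¹ + 1 / 2) / L = (δ * L)⁻¹ + 1 / 2 * L⁻¹ := by
    field_simp
  rw [e]
  linarith

theorem young_both {δ L E q J : ℝ} (hδ : 0 < δ) (hL : 0 < L) (hE : L ^ 2 * q ^ 2 ≤ E) :
    q * J ≤ δ * E / L + (δ⁻¹ / 4) / L * J ^ 2 := by
  have h1 := two_mul_le_young (show 0 < 2 * (δ * L) by positivity) q J
  have h3 : δ * L * q ^ 2 ≤ δ * E / L := by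
    rw [le_div_iff₀ hL]
    nlinarith
  have e : (δ⁻¹ / 4) / L = (2 * (δ * L))⁻¹ / 2 := by
    field_simp
    norm_num
  rw [e]
  linarith

section Edge

variable {M : Mesh} {I : Interface} {β : Bool → ℝ} {e : Finset Plane} {v : MeshFun}

theorem averNN_eq (x : Plane) {s₁ s₂ : Bool} (h₁ : phase I (M.T₁ e) x = s₁)
    (h₂ : phase I (M.T₂ e) x = s₂) : averNN M I β e v x =
      (β s₁ * ev (dirD (edgeNormal M e) (dirD (edgeNormal M e) (v (M.T₁ e) s₁))) x
      + β s₂ * ev (dirD (edgeNormal M e) (dirD (edgeNormal M e) (v (M.T₂ e) s₂))) x) / 2 := by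
  simp only [averNN, aver, val, h₁, h₂, pmul, pdir, ev_mul, ev_C]

theorem jumpNN_eq (x : Plane) {s₁ s₂ : Bool} (h₁ : phase I (M.T₁ e) x = s₁)
    (h₂ : phase I (M.T₂ e) x = s₂) : jumpNN M I e v x =
      ev (dirD (edgeNormal M e) (dirD (edgeNormal M e) (v (M.T₁ e) s₁))) x
      - ev (dirD (edgeNormal M e) (dirD (edgeNormal M e) (v (M.T₂ e) s₂))) x := by
  simp only [jumpNN, jump, val, h₁, h₂, pdir]

theorem betaE_eq (x : Plane) {s₁ s₂ : Bool} (h₁ : phase I (M.T₁ e) x = s₁)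
    (h₂ : phase I (M.T₂ e) x = s₂) : betaE M I β e x = (β s₁ + β s₂) / 2 := by
  rw [betaE, h₁, h₂]

theorem betaE_nonneg (hβ : ∀ s, 0 < β s) (x : Plane) : 0 ≤ betaE M I β e x := by
  have h1 := hβ (phase I (M.T₁ e) x)
  have h2 := hβ (phase I (M.T₂ e) x)
  unfold betaE
  positivity

/-- The estimate of the consistency term on a part of an edge that is close to a good disc in one
of the adjacent elements. -/
theorem edgeInt_aver_le_of_single {S : Set Plane} (hS : MeasurableSet S) (hL : 0 < subLen e S)
    (hβ : ∀ s, 0 < β s) {s : Bool} (hs : ∀ᵐ t : ℝ, t ∈ edgeSet e S → edgePt e t ∈ I.D s)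
    {T : Finset Plane} (hT : T = M.T₁ e ∨ T = M.T₂ e) {δ E : ℝ} (hδ : 0 < δ)
    (hE : ∀ t ∈ edgeSet e S, subLen e S ^ 2 *
      ev (dirD (edgeNormal M e) (dirD (edgeNormal M e) (v T s))) (edgePt e t) ^ 2 ≤ E) :
    2 * edgeInt e S (fun x => averNN M I β e v x * jumpN M I e v x) ≤ β s * (δ * E)
      + ((δ⁻¹ + 1 / 2) / subLen e S * edgeInt e S (fun x => betaE M I β e x * jumpN M I e v x ^ 2)
        + subLen e S / 2 * edgeInt e S (fun x => betaE M I β e x * jumpNN M I e v x ^ 2)) := by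
  have hb := bddMeas_betaE M I e β
  have hf := hb.mul (bddMeas_jumpN M I e v).sq
  have hg := hb.mul (bddMeas_jumpNN M I e v).sq
  -- The pointwise estimate contains E divided by the length; integrating this constant over the
  -- part restores E.
  have h0 : β s * (δ * E) = β s * (δ * E) / subLen e S * subLen e S := by
    field_simp
  rw [← edgeInt_const_mul, h0, ← edgeInt_const_add_add S hf hg]
  refine edgeInt_mono hS
    (((bddMeas_averNN M I e β v).mul (bddMeas_jumpN M I e v)).const_mul 2)
    ((BddMeas.of_continuous continuous_const).add ((hf.const_mul _).add (hg.const_mul _))) ?_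
  filter_upwards [hs] with t ht htS
  have hp₁ : phase I (M.T₁ e) (edgePt e t) = s := phase_eq_of_mem (ht htS)
  have hp₂ : phase I (M.T₂ e) (edgePt e t) = s := phase_eq_of_mem (ht htS)
  have hq := hE t htS
  rw [averNN_eq _ hp₁ hp₂, jumpNN_eq _ hp₁ hp₂, betaE_eq _ hp₁ hp₂]
  generalize jumpN M I e v (edgePt e t) = J
  have key : ∀ q₁ q₂ : ℝ, (subLen e S ^ 2 * q₁ ^ 2 ≤ E ∨ subLen e S ^ 2 * q₂ ^ 2 ≤ E) →
      2 * ((β s * q₁ + β s * q₂) / 2 * J) ≤ β s * (δ * E) / subLen e S +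
        ((δ⁻¹ + 1 / 2) / subLen e S * ((β s + β s) / 2 * J ^ 2) +
          subLen e S / 2 * ((β s + β s) / 2 * (q₁ - q₂) ^ 2)) := by
    intro q₁ q₂ h
    -- q₁ + q₂ is 2q₁ + (q₂ − q₁) or 2q₂ + (q₁ − q₂), according to the element that has the disc.
    have h' : (q₁ + q₂) * J ≤ δ * E / subLen e S +
        ((δ⁻¹ + 1 / 2) / subLen e S * J ^ 2 + subLen e S / 2 * (q₁ - q₂) ^ 2) := by
      rcases h with h | h
      · have := young_single (R := q₂ - q₁) (J := J) hδ hL h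
        rw [sub_sq_comm q₂ q₁] at this
        linarith
      · have := young_single (R := q₁ - q₂) (J := J) hδ hL h
        linarith
    have := mul_le_mul_of_nonneg_left h' (hβ s).le
    have e1 : β s * (δ * E) / subLen e S = β s * (δ * E / subLen e S) := by ring
    rw [e1]
    linarith
  refine key _ _ ?_
  rcases hT with rfl | rfl
  · exact Or.inl hq
  · exact Or.inr hq

/-- The estimate of the consistency term on an edge that is close to good discs in both adjacent
elements. -/
theorem edgeInt_aver_le_of_both (he : e.card = 2) (hβ : ∀ s, 0 < β s) {s₁ s₂ : Bool}
    (hs : ∀ t ∈ Ioo (0 : ℝ) 1, phase I (M.T₁ e) (edgePt e t) = s₁ ∧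
      phase I (M.T₂ e) (edgePt e t) = s₂) {δ E₁ E₂ : ℝ} (hδ : 0 < δ)
    (hE₁ : ∀ t ∈ Icc (0 : ℝ) 1, edgeLen e ^ 2 *
      ev (dirD (edgeNormal M e) (dirD (edgeNormal M e) (v (M.T₁ e) s₁))) (edgePt e t) ^ 2 ≤ E₁)
    (hE₂ : ∀ t ∈ Icc (0 : ℝ) 1, edgeLen e ^ 2 *
      ev (dirD (edgeNormal M e) (dirD (edgeNormal M e) (v (M.T₂ e) s₂))) (edgePt e t) ^ 2 ≤ E₂) :
    2 * edgeInt e univ (fun x => averNN M I β e v x * jumpN M I e v x)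
      ≤ β s₁ * (δ * E₁) + β s₂ * (δ * E₂)
      + (δ⁻¹ + 1 / 2) / edgeLen e *
        edgeInt e univ (fun x => betaE M I β e x * jumpN M I e v x ^ 2) := by
  have hL := edgeLen_pos he
  have hf := (bddMeas_betaE M I e β).mul (bddMeas_jumpN M I e v).sq
  -- The term with coefficient 0 only serves to match `edgeInt_const_add_add`: no jump of the second
  -- derivative occurs here.
  have h0 : β s₁ * (δ * E₁) + β s₂ * (δ * E₂) + (δ⁻¹ + 1 / 2) / edgeLen e *
        edgeInt e univ (fun x => betaE M I β e x * jumpN M I e v x ^ 2)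
      = (β s₁ * (δ * E₁) + β s₂ * (δ * E₂)) / edgeLen e * subLen e univ +
        ((δ⁻¹ + 1 / 2) / edgeLen e *
          edgeInt e univ (fun x => betaE M I β e x * jumpN M I e v x ^ 2) + 0 *
          edgeInt e univ (fun x => betaE M I β e x * jumpN M I e v x ^ 2)) := by
    rw [subLen_univ]
    field_simp
    ring
  rw [← edgeInt_const_mul, h0, ← edgeInt_const_add_add univ hf hf]
  refine edgeInt_mono MeasurableSet.univ
    (((bddMeas_averNN M I e β v).mul (bddMeas_jumpN M I e v)).const_mul 2)
    ((BddMeas.of_continuous continuous_const).add ((hf.const_mul _).add (hf.const_mul _))) ?_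
  have h01 : ∀ᵐ t : ℝ, t ≠ 0 ∧ t ≠ 1 :=
    (Measure.ae_ne volume 0).and (Measure.ae_ne volume 1)
  filter_upwards [h01] with t ht htS
  have htI : t ∈ Icc (0 : ℝ) 1 := htS.1
  obtain ⟨hp₁, hp₂⟩ := hs t ⟨lt_of_le_of_ne htI.1 ht.1.symm, lt_of_le_of_ne htI.2 ht.2⟩
  have a₁ := hE₁ t htI
  have a₂ := hE₂ t htI
  rw [averNN_eq _ hp₁ hp₂, betaE_eq _ hp₁ hp₂]
  generalize jumpN M I e v (edgePt e t) = J at *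
  have b₁ := mul_le_mul_of_nonneg_left (young_both (J := J) hδ hL a₁) (hβ s₁).le
  have b₂ := mul_le_mul_of_nonneg_left (young_both (J := J) hδ hL a₂) (hβ s₂).le
  generalize ev (dirD (edgeNormal M e) (dirD (edgeNormal M e) (v (M.T₁ e) s₁))) (edgePt e t) = q₁
    at *
  generalize ev (dirD (edgeNormal M e) (dirD (edgeNormal M e) (v (M.T₂ e) s₂))) (edgePt e t) = q₂
    at *
  -- With two discs the weight δ⁻¹/2 would suffice; the surplus is discarded so that all edges share
  -- the factor δ⁻¹ + 1/2.
  have c₁ : 0 ≤ (β s₁ + β s₂) / 2 * ((δ⁻¹ / 2 + 1 / 2) / edgeLen e * J ^ 2) := by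
    have := hβ s₁
    have := hβ s₂
    positivity
  have e1 : (β s₁ * (δ * E₁) + β s₂ * (δ * E₂)) / edgeLen e
      = β s₁ * (δ * E₁ / edgeLen e) + β s₂ * (δ * E₂ / edgeLen e) := by ring
  have e2 : (δ⁻¹ + 1 / 2) / edgeLen e * ((β s₁ + β s₂) / 2 * J ^ 2)
      = β s₁ * (δ⁻¹ / 4 / edgeLen e * J ^ 2) + β s₂ * (δ⁻¹ / 4 / edgeLen e * J ^ 2)
        + (β s₁ + β s₂) / 2 * ((δ⁻¹ / 2 + 1 / 2) / edgeLen e * J ^ 2) := by ring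
  rw [e1, e2]
  linarith

end Edge

end ImmersedIP

/-! ### Summing the edge estimates -/

namespace ImmersedIP

section Coercive

variable {M : Mesh} {I : Interface} {β : Bool → ℝ} {v : MeshFun}

/-- The energy of a mesh function on an element. -/
noncomputable def elemEnergy (I : Interface) (β : Bool → ℝ) (v : MeshFun) (T : Finset Plane) : ℝ :=
  ∑ s, β s * hessEnergy I v T s

theorem elemEnergy_nonneg (hβ : ∀ s, 0 < β s) (T : Finset Plane) : 0 ≤ elemEnergy I β v T :=
  Finset.sum_nonneg fun s _ => mul_nonneg (hβ s).le (hessEnergy_nonneg I v T s)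

theorem mul_hessEnergy_le (hβ : ∀ s, 0 < β s) (T : Finset Plane) (s : Bool) :
    β s * hessEnergy I v T s ≤ elemEnergy I β v T :=
  Finset.single_le_sum (f := fun s => β s * hessEnergy I v T s)
    (fun s _ => mul_nonneg (hβ s).le (hessEnergy_nonneg I v T s)) (Finset.mem_univ s)

theorem mul_hessEnergy_le_add (hβ : ∀ s, 0 < β s) {e T : Finset Plane}
    (hT : T = M.T₁ e ∨ T = M.T₂ e) (s : Bool) : β s * hessEnergy I v T s ≤
      β s * hessEnergy I v (M.T₁ e) s + β s * hessEnergy I v (M.T₂ e) s := by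
  have h1 := mul_nonneg (hβ s).le (hessEnergy_nonneg I v (M.T₁ e) s)
  have h2 := mul_nonneg (hβ s).le (hessEnergy_nonneg I v (M.T₂ e) s)
  rcases hT with rfl | rfl <;> linarith

/-- After exchanging the sums, each element is counted at most once for each of its three edges. -/
theorem sum_elemEnergy_le (hβ : ∀ s, 0 < β s) :
    ∑ e ∈ M.intEdges, (elemEnergy I β v (M.T₁ e) + elemEnergy I β v (M.T₂ e))
      ≤ 3 * ∑ T ∈ M.tri, elemEnergy I β v T := by
  classical
  calc ∑ e ∈ M.intEdges, (elemEnergy I β v (M.T₁ e) + elemEnergy I β v (M.T₂ e))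
      ≤ ∑ e ∈ M.intEdges, ∑ T ∈ M.tri.filter (fun T => e ⊆ T), elemEnergy I β v T := by
        refine Finset.sum_le_sum fun e he => ?_
        obtain ⟨h1, h2, hne, h3, h4⟩ := M.adj e he
        rw [← Finset.sum_pair hne]
        refine Finset.sum_le_sum_of_subset_of_nonneg ?_ fun T _ _ => elemEnergy_nonneg hβ T
        intro T hT
        rcases Finset.mem_insert.1 hT with rfl | hT
        · exact Finset.mem_filter.2 ⟨h1, h3⟩
        · rw [Finset.mem_singleton.1 hT]
          exact Finset.mem_filter.2 ⟨h2, h4⟩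
    _ = ∑ T ∈ M.tri, ∑ e ∈ M.intEdges.filter (fun e => e ⊆ T), elemEnergy I β v T := by
        refine Finset.sum_comm' fun e T => ?_
        simp only [Finset.mem_filter]
        tauto
    _ ≤ ∑ T ∈ M.tri, 3 * elemEnergy I β v T := by
        refine Finset.sum_le_sum fun T hT => ?_
        rw [Finset.sum_const, nsmul_eq_mul]
        refine mul_le_mul_of_nonneg_right ?_ (elemEnergy_nonneg hβ T)
        have h1 : M.intEdges.filter (fun e => e ⊆ T) ⊆ T.powersetCard 2 := by
          intro e he
          rw [Finset.mem_filter] at he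
          exact Finset.mem_powersetCard.2 ⟨he.2, Mesh.card_of_mem_intEdges he.1⟩
        have h2 := Finset.card_le_card h1
        rw [Finset.card_powersetCard, M.card_tri T hT] at h2
        exact_mod_cast h2
    _ = 3 * ∑ T ∈ M.tri, elemEnergy I β v T := by rw [Finset.mul_sum]

/-! ### The square of the norm -/

section Terms

variable (M I β v)

/-- The penalty on the normal derivative on a cut edge. -/
noncomputable def cutPenN (e : Finset Plane) : ℝ :=
  ∑ s, β s / subLen e (I.D s) * edgeInt e (I.D s) fun x => jumpN M I e v x ^ 2

/-- The penalty on the second normal derivative on a cut edge. -/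
noncomputable def cutPenNN (e : Finset Plane) : ℝ :=
  ∑ s, subLen e (I.D s) * β s * edgeInt e (I.D s) fun x => jumpNN M I e v x ^ 2

/-- The weighted square of the jump of the normal derivative on an edge. -/
noncomputable def edgeSqN (e : Finset Plane) : ℝ :=
  edgeInt e univ fun x => betaE M I β e x * jumpN M I e v x ^ 2

/-- The weighted square of the jump of the second normal derivative on an edge. -/
noncomputable def edgeSqNN (e : Finset Plane) : ℝ :=
  edgeInt e univ fun x => betaE M I β e x * jumpNN M I e v x ^ 2

/-- The square of the jump on an edge. -/
noncomputable def edgeSq (e : Finset Plane) : ℝ := edgeInt e univ fun x => jump M I e v x ^ 2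

/-- The square of the jump of the normal derivative on the interface within an element. -/
noncomputable def curveSqN (T : Finset Plane) : ℝ :=
  I.curveInt (hull T) fun t => I.jumpΓ (pdir (I.nor t) (v T)) t ^ 2

/-- The square of the jump on the interface within an element. -/
noncomputable def curveSq (T : Finset Plane) : ℝ := I.curveInt (hull T) fun t => I.jumpΓ (v T) t ^ 2

/-- The consistency term of an edge. -/
noncomputable def consist (e : Finset Plane) : ℝ :=
  edgeInt e univ fun x => averNN M I β e v x * jumpN M I e v x

/-- The square of the mesh-dependent norm. -/
noncomputable def normSq (σu σF σn : ℝ) : ℝ :=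
  (∑ T ∈ M.tri, elemEnergy I β v T)
  + (∑ e ∈ M.intEdgesN I, σu / edgeLen e * edgeSqN M I β v e)
  + (∑ T ∈ M.ifTri I, σu * betaAv β / diamT T * curveSqN I v T)
  + σu * (∑ e ∈ M.intEdgesI I, cutPenN M I β v e)
  + (∑ e ∈ M.intEdgesNF I, σF * edgeLen e * edgeSqNN M I β v e)
  + σF * (∑ e ∈ M.intEdgesI I, cutPenNN M I β v e)
  + (∑ e ∈ M.intEdgesI I, σn * betaAv β / edgeLen e ^ 3 * edgeSq M I v e)
  + (∑ T ∈ M.ifTri I, σn * betaAv β / diamT T ^ 3 * curveSq I v T)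

theorem normH_eq (σu σF σn : ℝ) :
    normH M I β σu σF σn v = Real.sqrt (normSq M I β v σu σF σn) := by
  simp only [normSq, cutPenN, cutPenNN, Finset.mul_sum]
  rfl

theorem formAh_self (σu σF σn : ℝ) : formAh M I β σu σF σn v v =
    normSq M I β v σu σF σn - 2 * ∑ e ∈ M.intEdges, consist M I β v e := by
  have h1 : ∀ e s, σu * β s / subLen e (I.D s) * (edgeInt e (I.D s) fun x => jumpN M I e v x ^ 2)
      = σu * (β s / subLen e (I.D s) * edgeInt e (I.D s) fun x => jumpN M I e v x ^ 2) :=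
    fun _ _ => by ring
  have h2 : ∀ e s, σF * subLen e (I.D s) * β s *
      (edgeInt e (I.D s) fun x => jumpNN M I e v x ^ 2)
      = σF * (subLen e (I.D s) * β s * edgeInt e (I.D s) fun x => jumpNN M I e v x ^ 2) :=
    fun _ _ => by ring
  rw [two_mul]
  simp only [formAh, formA, formJu, formJn, ← sq, normSq, cutPenN, cutPenNN, elemEnergy,
    hessEnergy, edgeSqN, edgeSqNN, edgeSq, curveSqN, curveSq, consist, h1, h2, Finset.mul_sum]
  ring

variable {M I β v}

theorem edgeSqN_nonneg (hβ : ∀ s, 0 < β s) (e : Finset Plane) : 0 ≤ edgeSqN M I β v e :=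
  edgeInt_nonneg _ _ fun _ => mul_nonneg (betaE_nonneg hβ _) (sq_nonneg _)

theorem edgeSqNN_nonneg (hβ : ∀ s, 0 < β s) (e : Finset Plane) : 0 ≤ edgeSqNN M I β v e :=
  edgeInt_nonneg _ _ fun _ => mul_nonneg (betaE_nonneg hβ _) (sq_nonneg _)

theorem edgeSq_nonneg (e : Finset Plane) : 0 ≤ edgeSq M I v e :=
  edgeInt_nonneg _ _ fun _ => sq_nonneg _

theorem curveSqN_nonneg (T : Finset Plane) : 0 ≤ curveSqN I v T :=
  integral_nonneg fun _ => sq_nonneg _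

theorem curveSq_nonneg (T : Finset Plane) : 0 ≤ curveSq I v T :=
  integral_nonneg fun _ => sq_nonneg _

theorem cutPenN_nonneg (hβ : ∀ s, 0 < β s) (e : Finset Plane) : 0 ≤ cutPenN M I β v e :=
  Finset.sum_nonneg fun s _ => mul_nonneg (div_nonneg (hβ s).le (subLen_nonneg _ _))
    (edgeInt_nonneg _ _ fun _ => sq_nonneg _)

theorem cutPenNN_nonneg (hβ : ∀ s, 0 < β s) (e : Finset Plane) : 0 ≤ cutPenNN M I β v e :=
  Finset.sum_nonneg fun s _ => mul_nonneg (mul_nonneg (subLen_nonneg _ _) (hβ s).le)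
    (edgeInt_nonneg _ _ fun _ => sq_nonneg _)

theorem betaAv_pos (hβ : ∀ s, 0 < β s) : 0 < betaAv β := by
  have := hβ true
  have := hβ false
  unfold betaAv
  positivity

theorem diamT_nonneg (T : Finset Plane) : 0 ≤ diamT T := Metric.diam_nonneg

end Terms

/-! ### Coercivity -/

variable {ρ r : ℝ} {p : ℕ} {C : ℝ}

/-- The set of parameters is squeezed between an open and a closed interval with the same ends. This
identifies the scale of the disc with the length of the part that enters the penalties. -/
theorem subLen_eq_of_Ioo {e : Finset Plane} {S : Set Plane} {a b : ℝ} (ha : 0 ≤ a) (hab : a < b)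
    (hb : b ≤ 1) (h : ∀ t ∈ Ioo a b, edgePt e t ∈ S)
    (h' : ∀ t ∈ Icc (0 : ℝ) 1, edgePt e t ∈ S → t ∈ Icc a b) :
    subLen e S = (b - a) * edgeLen e := by
  have h1 : Ioo a b ⊆ edgeSet e S := fun t ht =>
    ⟨⟨ha.trans ht.1.le, ht.2.le.trans hb⟩, h t ht⟩
  have h2 : edgeSet e S ⊆ Icc a b := fun t ht => h' t ht.1 ht.2
  have h3 : volume (edgeSet e S) = ENNReal.ofReal (b - a) :=
    le_antisymm ((measure_mono h2).trans_eq Real.volume_Icc)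
      (Real.volume_Ioo.symm.trans_le (measure_mono h1))
  rw [subLen_eq, measureReal_def, h3, ENNReal.toReal_ofReal (by linarith)]
  ring

/-- Each of the two parts of the edge is an interval with its own disc, at the scale of its own
length and possibly in a different element for each part, so `edgeInt_aver_le_of_single` applies to
them separately. The coefficient is constant on a part. -/
theorem consist_cut_le (hI : M.Admissible I r) (hM : M.ShapeRegular ρ) {c : ℝ} (hc : 0 < c)
    (hcρ : c ≤ ρ) (hc4 : c ≤ 1 / 4) (hβ : ∀ s, 0 < β s) (hC : TraceBound p (c / 16) C)
    (hC0 : 0 < C) (hv : ∀ T, v T ∈ pieces p) {δ : ℝ} (hδ : 0 < δ) {e : Finset Plane}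
    (he : e ∈ M.intEdgesI I) :
    2 * consist M I β v e ≤ δ * C * (elemEnergy I β v (M.T₁ e) + elemEnergy I β v (M.T₂ e))
      + ((δ⁻¹ + 1 / 2) * cutPenN M I β v e + 1 / 2 * cutPenNN M I β v e) := by
  obtain ⟨hei, hcut⟩ := Mesh.mem_intEdgesI.1 he
  have hcard := Mesh.card_of_mem_intEdges hei
  have hed := (Mesh.mem_intEdges.1 hei).1
  have hnorm := norm_edgeNormal M hcard
  have hside : ∀ s, 2 * edgeInt e (I.D s) (fun x => averNN M I β e v x * jumpN M I e v x) ≤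
      δ * C * (β s * hessEnergy I v (M.T₁ e) s + β s * hessEnergy I v (M.T₂ e) s)
      + ((δ⁻¹ + 1 / 2) * (β s / subLen e (I.D s) *
          edgeInt e (I.D s) fun x => jumpN M I e v x ^ 2)
        + 1 / 2 * (subLen e (I.D s) * β s *
          edgeInt e (I.D s) fun x => jumpNN M I e v x ^ 2)) := by
    intro s
    obtain ⟨a, b, ha, hab, hb, h1, h2, -⟩ := hI.exists_Ioo_of_isCut hed hcut s
    have hLen := subLen_eq_of_Ioo ha hab hb h1 h2
    have hL : 0 < subLen e (I.D s) := by
      rw [hLen]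
      exact mul_pos (sub_pos.2 hab) (edgeLen_pos hcard)
    obtain ⟨u, hu⟩ := nonempty_Ioo.2 hab
    obtain ⟨T, hT, hdisc⟩ := hI.exists_hasDisc hM hc hcρ hc4 hei ha hab hb (s := s)
      (fun t ht h => by
        have := I.disjoint_D' (h1 t ht) h
        cases s <;> simp at this) ⟨u, hu, h1 u hu⟩
    have hmeas := (I.isOpen_D s).measurableSet
    have key := edgeInt_aver_le_of_single (β := β) (v := v) hmeas hL hβ
      (Eventually.of_forall fun t ht => ht.2) hT hδ (E := C * hessEnergy I v T s) (by
        intro t ht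
        rw [hLen]
        exact hdisc.sq_le hC hC0.le (hLen ▸ hL) (hv T) hnorm ⟨t, h2 t ht.1 ht.2, rfl⟩)
    have hb : ∀ f : Plane → ℝ, edgeInt e (I.D s) (fun x => betaE M I β e x * f x)
        = β s * edgeInt e (I.D s) f := by
      intro f
      rw [← edgeInt_const_mul]
      refine edgeInt_congr hmeas (Eventually.of_forall fun t ht => ?_)
      rw [betaE_eq _ (phase_eq_of_mem ht.2) (phase_eq_of_mem ht.2), add_self_div_two]
    rw [hb, hb] at key
    have h3 := mul_le_mul_of_nonneg_left (mul_hessEnergy_le_add (I := I) (v := v) hβ hT s)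
      (mul_pos hδ hC0).le
    refine key.trans ?_
    have e1 : β s * (δ * (C * hessEnergy I v T s)) = δ * C * (β s * hessEnergy I v T s) := by ring
    rw [e1]
    refine add_le_add h3 (le_of_eq ?_)
    ring
  -- The two parts cover the edge except for its ends and the crossing point, which form a null set.
  have hsplit : consist M I β v e =
      ∑ s, edgeInt e (I.D s) (fun x => averNN M I β e v x * jumpN M I e v x) := by
    obtain ⟨a, b, ha, hab, hb, h1, h2, τ, -, hτ⟩ := hI.exists_Ioo_of_isCut hed hcut true
    have hae : edgeSet e univ =ᵐ[volume] (edgeSet e (I.D true) ∪ edgeSet e (I.D false) : Set ℝ) := by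
      have h01 : ∀ᵐ t : ℝ, t ≠ 0 ∧ t ≠ 1 ∧ t ≠ τ :=
        (Measure.ae_ne volume 0).and ((Measure.ae_ne volume 1).and (Measure.ae_ne volume τ))
      filter_upwards [h01] with t ht
      refine propext ⟨fun h => ?_, ?_⟩
      · have h' : t ∈ Icc (0 : ℝ) 1 := h.1
        obtain ⟨s, hs⟩ := (I.notMem_Γ_iff _).1 (hτ t ⟨lt_of_le_of_ne h'.1 ht.1.symm,
          lt_of_le_of_ne h'.2 ht.2.1⟩ ht.2.2)
        cases s
        · exact Or.inr ⟨h', hs⟩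
        · exact Or.inl ⟨h', hs⟩
      · rintro (h | h)
        · exact ⟨h.1, mem_univ _⟩
        · exact ⟨h.1, mem_univ _⟩
    have hbd := (bddMeas_averNN M I e β v).mul (bddMeas_jumpN M I e v)
    rw [Fintype.sum_bool, consist, edgeInt_eq, edgeInt_eq, edgeInt_eq, setIntegral_congr_set hae,
      setIntegral_union _ (measurableSet_edgeSet e (I.isOpen_D false).measurableSet)
      (hbd.integrableOn (edgeSet_subset _ _)) (hbd.integrableOn (edgeSet_subset _ _)), mul_add]
    exact Set.disjoint_left.2 fun t h h' => by simpa using I.disjoint_D' h.2 h'.2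
  have h3 := hside true
  have h4 := hside false
  rw [hsplit]
  simp only [Fintype.sum_bool, cutPenN, cutPenNN, elemEnergy]
  linarith

-- When only one disc is available, `Admissible.hasDisc_of_not_isCut` guarantees that the edge
-- belongs to an interface element, where the jump of the second normal derivative is penalised;
-- this is the conditional term.
open scoped Classical in
theorem consist_noncut_le (hI : M.Admissible I r) (hM : M.ShapeRegular ρ) {c : ℝ} (hc : 0 < c)
    (hcρ : c ≤ ρ) (hc4 : c ≤ 1 / 4) (hβ : ∀ s, 0 < β s) (hC : TraceBound p (c / 16) C)
    (hC0 : 0 < C) (hv : ∀ T, v T ∈ pieces p) {δ : ℝ} (hδ : 0 < δ) {e : Finset Plane}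
    (he : e ∈ M.intEdgesN I) :
    2 * consist M I β v e ≤ δ * C * (elemEnergy I β v (M.T₁ e) + elemEnergy I β v (M.T₂ e))
      + ((δ⁻¹ + 1 / 2) / edgeLen e * edgeSqN M I β v e +
        if e ∈ M.intEdgesNF I then 1 / 2 * (edgeLen e * edgeSqNN M I β v e) else 0) := by
  obtain ⟨hei, -⟩ := Mesh.mem_intEdgesN.1 he
  have hcard := Mesh.card_of_mem_intEdges hei
  have hnorm := norm_edgeNormal M hcard
  have hL := edgeLen_pos hcard
  rcases hI.hasDisc_of_not_isCut hM hc hcρ hc4 he with ⟨s₁, s₂, hph, hd₁, hd₂⟩ | ⟨hNF, s, hs, T, hT, hd⟩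
  · have key := edgeInt_aver_le_of_both (β := β) (v := v) hcard hβ hph hδ
      (fun t ht => hd₁.sq_le hC hC0.le hL (hv _) hnorm ⟨t, ht, rfl⟩)
      (fun t ht => hd₂.sq_le hC hC0.le hL (hv _) hnorm ⟨t, ht, rfl⟩)
    have h1 := mul_le_mul_of_nonneg_left (mul_hessEnergy_le (I := I) (v := v) hβ (M.T₁ e) s₁)
      (mul_pos hδ hC0).le
    have h2 := mul_le_mul_of_nonneg_left (mul_hessEnergy_le (I := I) (v := v) hβ (M.T₂ e) s₂)
      (mul_pos hδ hC0).le
    have h3 : (0 : ℝ) ≤ if e ∈ M.intEdgesNF I then 1 / 2 * (edgeLen e * edgeSqNN M I β v e)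
        else 0 := by
      have := edgeSqNN_nonneg (M := M) (I := I) (v := v) hβ e
      split_ifs <;> positivity
    unfold consist edgeSqN
    linarith
  · obtain ⟨τ, hτ⟩ := hs
    have key := edgeInt_aver_le_of_single (e := e) (β := β) (v := v) (M := M) (I := I)
      MeasurableSet.univ
      (by rwa [subLen_univ]) hβ (s := s) (by
        have h01 : ∀ᵐ t : ℝ, t ≠ 0 ∧ t ≠ 1 ∧ t ≠ τ :=
          (Measure.ae_ne volume 0).and ((Measure.ae_ne volume 1).and (Measure.ae_ne volume τ))
        filter_upwards [h01] with t ht h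
        have h' : t ∈ Icc (0 : ℝ) 1 := h.1
        exact hτ t ⟨lt_of_le_of_ne h'.1 ht.1.symm, lt_of_le_of_ne h'.2 ht.2.1⟩ ht.2.2) hT hδ
      (E := C * hessEnergy I v T s) (by
        intro t ht
        rw [subLen_univ]
        exact hd.sq_le hC hC0.le hL (hv T) hnorm ⟨t, ht.1, rfl⟩)
    rw [subLen_univ] at key
    have h1 := mul_le_mul_of_nonneg_left ((mul_hessEnergy_le_add (I := I) (v := v) hβ hT s).trans
      (add_le_add (mul_hessEnergy_le hβ _ s) (mul_hessEnergy_le hβ _ s))) (mul_pos hδ hC0).le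
    rw [if_pos hNF]
    unfold consist edgeSqN edgeSqNN
    linarith

theorem half_normSq_le_formAh (hI : M.Admissible I r) (hM : M.ShapeRegular ρ) {c : ℝ} (hc : 0 < c)
    (hcρ : c ≤ ρ) (hc4 : c ≤ 1 / 4) (hβ : ∀ s, 0 < β s) (hC : TraceBound p (c / 16) C)
    (hC0 : 0 < C) (hv : ∀ T, v T ∈ pieces p) {σn : ℝ} (hσ : 0 < σn) :
    1 / 2 * normSq M I β v (3 * (4 * C + 1 / 3)) 1 σn
      ≤ formAh M I β (3 * (4 * C + 1 / 3)) 1 σn v v := by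
  classical
  -- With three edges per element the energy is charged 3δC = 1/2 of itself. The value of σu is then
  -- the one for which δ⁻¹ + 1/2 is half of it, and the 1/2 in front of the jumps of ∂ₙₙ is half of
  -- σF = 1.
  set δ : ℝ := (6 * C)⁻¹ with hδ_def
  have hδ : 0 < δ := by positivity
  have hδC : δ * C = 1 / 6 := by
    rw [hδ_def]
    field_simp
  have hδi : δ⁻¹ + 1 / 2 = 1 / 2 * (3 * (4 * C + 1 / 3)) := by
    rw [hδ_def, inv_inv]
    ring
  set σu : ℝ := 3 * (4 * C + 1 / 3) with hσu
  have hσu0 : 0 < σu := by positivity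
  have h1 := Finset.sum_le_sum fun e (he : e ∈ M.intEdgesI I) =>
    consist_cut_le hI hM hc hcρ hc4 hβ hC hC0 hv hδ he
  have h2 := Finset.sum_le_sum fun e (he : e ∈ M.intEdgesN I) =>
    consist_noncut_le hI hM hc hcρ hc4 hβ hC hC0 hv hδ he
  have hsplit : ∀ f : Finset Plane → ℝ, ∑ e ∈ M.intEdges, f e
      = ∑ e ∈ M.intEdgesI I, f e + ∑ e ∈ M.intEdgesN I, f e := fun f =>
    (Finset.sum_filter_add_sum_filter_not M.intEdges (Mesh.IsCut I) f).symm
  have h3 := sum_elemEnergy_le (M := M) (I := I) (v := v) hβ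
  rw [hsplit] at h3
  have h4 : ∑ e ∈ M.intEdgesN I, (if e ∈ M.intEdgesNF I then
      1 / 2 * (edgeLen e * edgeSqNN M I β v e) else 0)
      = 1 / 2 * ∑ e ∈ M.intEdgesNF I, 1 * edgeLen e * edgeSqNN M I β v e := by
    rw [← Finset.sum_filter, Finset.mul_sum]
    refine Finset.sum_congr ?_ fun e _ => by ring
    ext e
    rw [Finset.mem_filter]
    exact ⟨fun h => h.2, fun h => ⟨(Mesh.mem_intEdgesNF.1 h).1, h⟩⟩
  have h5 : ∑ e ∈ M.intEdgesN I, (δ⁻¹ + 1 / 2) / edgeLen e * edgeSqN M I β v e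
      = 1 / 2 * ∑ e ∈ M.intEdgesN I, σu / edgeLen e * edgeSqN M I β v e := by
    rw [hδi, Finset.mul_sum]
    exact Finset.sum_congr rfl fun e _ => by ring
  simp only [Finset.sum_add_distrib, ← Finset.mul_sum] at h1 h2 h3
  have h6 : 0 ≤ ∑ T ∈ M.ifTri I, σu * betaAv β / diamT T * curveSqN I v T :=
    Finset.sum_nonneg fun T _ => mul_nonneg (div_nonneg (mul_pos hσu0 (betaAv_pos hβ)).le
      (diamT_nonneg T)) (curveSqN_nonneg T)
  have h7 : 0 ≤ ∑ T ∈ M.ifTri I, σn * betaAv β / diamT T ^ 3 * curveSq I v T :=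
    Finset.sum_nonneg fun T _ => mul_nonneg (div_nonneg (mul_pos hσ (betaAv_pos hβ)).le
      (pow_nonneg (diamT_nonneg T) 3)) (curveSq_nonneg T)
  have h8 : 0 ≤ ∑ e ∈ M.intEdgesI I, σn * betaAv β / edgeLen e ^ 3 * edgeSq M I v e :=
    Finset.sum_nonneg fun e _ => mul_nonneg (div_nonneg (mul_pos hσ (betaAv_pos hβ)).le
      (pow_nonneg (edgeLen_nonneg e) 3)) (edgeSq_nonneg e)
  rw [formAh_self, hsplit, normSq]
  rw [hδC, hδi] at h1
  rw [hδC] at h2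
  linarith

end Coercive

end ImmersedIP

namespace ImmersedIP

/-! ### Mesh functions of vanishing norm -/

theorem eqOn_zero_of_setIntegral_eq_zero {X : Type*} [TopologicalSpace X] [MeasurableSpace X]
    [BorelSpace X] {μ : Measure X} [μ.IsOpenPosMeasure] {f : X → ℝ} (hf : Continuous f)
    (h0 : ∀ x, 0 ≤ f x) {S U : Set X} (hi : IntegrableOn f S μ) (h : ∫ x in S, f x ∂μ = 0)
    (hU : IsOpen U) (hUS : U ⊆ S) : ∀ x ∈ U, f x = 0 := by
  have h1 : f =ᵐ[μ.restrict S] 0 := (integral_eq_zero_iff_of_nonneg h0 hi).1 h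
  exact Measure.eqOn_open_of_ae_eq (ae_restrict_of_ae_restrict_of_subset hUS h1) hU
    hf.continuousOn continuousOn_const

theorem pderiv_pderiv_eq_zero_of_hessEnergy {I : Interface} {v : MeshFun} {T : Finset Plane}
    {s : Bool} (h : hessEnergy I v T s = 0) (hne : (interior (hull T) ∩ I.D s).Nonempty)
    (i j : Fin 2) : MvPolynomial.pderiv i (MvPolynomial.pderiv j (v T s)) = 0 := by
  have hU : IsOpen (interior (hull T) ∩ I.D s) := isOpen_interior.inter (I.isOpen_D s)
  have h1 := eqOn_zero_of_setIntegral_eq_zero (continuous_hessDot (v T s) (v T s))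
    (fun x => hessDot_self_nonneg _ x) (integrableOn_hull (continuous_hessDot _ _) T (I.D s)) h hU
    (inter_subset_inter_left _ interior_subset)
  refine eq_zero_of_ev_eq_zero_on_open hU hne fun x hx => ?_
  have h2 := h1 x hx
  rw [hessDot, Finset.sum_eq_zero_iff_of_nonneg
    fun _ _ => Finset.sum_nonneg fun _ _ => mul_self_nonneg _] at h2
  have h3 := (Finset.sum_eq_zero_iff_of_nonneg fun _ _ => mul_self_nonneg _).1
    (h2 i (Finset.mem_univ i)) j (Finset.mem_univ j)
  exact mul_self_eq_zero.1 h3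

/-- An affine polynomial, with its values and directional derivatives. -/
theorem exists_affine {q : Poly}
    (h : ∀ i j, MvPolynomial.pderiv i (MvPolynomial.pderiv j q) = 0) :
    ∃ (a : ℝ) (b : Plane), (∀ x, ev q x = a + inner ℝ b x) ∧
      (∀ n x, ev (dirD n q) x = inner ℝ b n) ∧ (a = 0 → b = 0 → q = 0) := by
  obtain ⟨a, b, rfl⟩ := exists_affine_of_pderiv_pderiv_eq_zero h
  refine ⟨a, b, fun x => ?_, fun n x => ?_, ?_⟩
  · rw [inner_eq]
    simp only [ev_add, ev_mul, ev_C, ev_X]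
    ring
  · rw [inner_eq, ev_dirD]
    simp [MvPolynomial.pderiv_X]
    ring
  · rintro rfl rfl
    simp

/-- A mesh function that is given on `T` by a single affine polynomial. -/
def IsAffineOn (v : MeshFun) (T : Finset Plane) : Prop :=
  (∀ s, v T s = v T true) ∧
    ∀ i j, MvPolynomial.pderiv i (MvPolynomial.pderiv j (v T true)) = 0

theorem IsAffineOn.val_eq {v : MeshFun} {T : Finset Plane} (h : IsAffineOn v T) (I : Interface)
    (x : Plane) : val I T (v T) x = ev (v T true) x := by
  rw [val, h.1]

theorem IsAffineOn.val_pdir_eq {v : MeshFun} {T : Finset Plane} (h : IsAffineOn v T)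
    (I : Interface) (n x : Plane) :
    val I T (pdir n (v T)) x = ev (dirD n (v T true)) x := by
  rw [val, pdir, h.1]

theorem dirD_sub (a : Plane) (q w : Poly) : dirD a (q - w) = dirD a q - dirD a w := by
  simp [dirD, mul_sub, Finset.sum_sub_distrib]

theorem pderiv_pderiv_sub {q w : Poly}
    (hq : ∀ i j, MvPolynomial.pderiv i (MvPolynomial.pderiv j q) = 0)
    (hw : ∀ i j, MvPolynomial.pderiv i (MvPolynomial.pderiv j w) = 0) (i j : Fin 2) :
    MvPolynomial.pderiv i (MvPolynomial.pderiv j (q - w)) = 0 := by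
  rw [map_sub, map_sub, hq, hw, sub_zero]

/-- Both parts have interior, because every point of the interface is adherent to both sides, so
both polynomials are affine. Their difference a + b·x vanishes along an arc, which gives b·t = 0 by
differentiation; the normal jump gives b·n = 0. Hence b = 0, and then a = 0. -/
theorem isAffineOn_of_interface {I : Interface} {M : Mesh} {v : MeshFun} {T : Finset Plane}
    (hT : M.IsInterfaceElt I T) (h : ∀ s, hessEnergy I v T s = 0) (h0 : curveSq I v T = 0)
    (h1 : curveSqN I v T = 0) : IsAffineOn v T := by
  obtain ⟨x, hx, t₀, rfl⟩ := hT.2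
  have hne : ∀ s, (interior (hull T) ∩ I.D s).Nonempty := fun s => by
    have hcl : I.γ t₀ ∈ closure (I.D s) := by
      have : I.γ t₀ ∈ frontier (I.D s) := by
        rw [I.frontier_D]
        exact mem_range_self t₀
      exact this.1
    exact mem_closure_iff.1 hcl _ isOpen_interior hx
  have haff := fun s => pderiv_pderiv_eq_zero_of_hessEnergy (h s) (hne s)
  obtain ⟨a, b, hev, hdir, h00⟩ := exists_affine
    (pderiv_pderiv_sub (haff true) (haff false))
  have hW : IsOpen (Ioo 0 I.len ∩ I.γ ⁻¹' interior (hull T)) :=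
    isOpen_Ioo.inter (isOpen_interior.preimage I.continuous_γ)
  -- The parameter in the base period may be 0, which is not in the open interval; a nearby one is
  -- then taken by density.
  have hWne : (Ioo 0 I.len ∩ I.γ ⁻¹' interior (hull T)).Nonempty := by
    obtain ⟨t, ht, hteq⟩ := I.periodic.exists_mem_Ico₀ I.len_pos t₀
    have hcl : t ∈ closure (Ioo 0 I.len) := by
      rw [closure_Ioo I.len_pos.ne]
      exact Ico_subset_Icc_self ht
    have := mem_closure_iff.1 hcl _ (isOpen_interior.preimage I.continuous_γ)
      (show I.γ t ∈ interior (hull T) from hteq ▸ hx)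
    rwa [inter_comm] at this
  have hWS : Ioo 0 I.len ∩ I.γ ⁻¹' interior (hull T) ⊆ Ico 0 I.len ∩ I.γ ⁻¹' hull T :=
    inter_subset_inter Ioo_subset_Ico_self (preimage_mono interior_subset)
  have hj : ∀ t ∈ Ioo 0 I.len ∩ I.γ ⁻¹' interior (hull T), a + inner ℝ b (I.γ t) = 0 := by
    intro t ht
    have := eqOn_zero_of_setIntegral_eq_zero ((I.continuous_jumpΓ (v T)).pow 2)
      (fun t => sq_nonneg _) (I.integrableOn_curve ((I.continuous_jumpΓ (v T)).pow 2) (hull T)) h0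
      hW hWS t ht
    rw [← hev, ev_sub]
    exact pow_eq_zero_iff two_ne_zero |>.1 this
  have hjn : ∀ t ∈ Ioo 0 I.len ∩ I.γ ⁻¹' interior (hull T), inner ℝ b (I.nor t) = 0 := by
    intro t ht
    have := eqOn_zero_of_setIntegral_eq_zero ((I.continuous_jumpΓ_pdir (v T)).pow 2)
      (fun t => sq_nonneg _) (I.integrableOn_curve ((I.continuous_jumpΓ_pdir (v T)).pow 2) (hull T))
      h1 hW hWS t ht
    rw [← hdir (I.nor t) (I.γ t), dirD_sub, ev_sub]
    exact pow_eq_zero_iff two_ne_zero |>.1 this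
  obtain ⟨t, ht⟩ := hWne
  have htan : inner ℝ b (I.tang t) = 0 := by
    have hd : HasDerivAt (fun t => a + inner ℝ b (I.γ t)) (inner ℝ b (I.tang t)) t := by
      have := ((hasDerivAt_const t b).inner ℝ (I.hasDerivAt t)).const_add a
      simpa using this
    have hz : HasDerivAt (fun t => a + inner ℝ b (I.γ t)) 0 t :=
      (hasDerivAt_const t (0 : ℝ)).congr_of_eventuallyEq
        (by filter_upwards [hW.mem_nhds ht] with u hu using hj u hu)
    exact hd.unique hz
  have hb : b = 0 := by
    have := I.sq_add_sq t b
    rw [htan, hjn t ht] at this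
    simpa using this.symm
  have ha : a = 0 := by simpa [hb] using hj t ht
  refine ⟨fun s => ?_, haff true⟩
  cases s
  · exact (sub_eq_zero.1 (h00 ha hb)).symm
  · rfl

theorem mem_single {p : ℕ} {g : Piece} (h : g ∈ single p) :
    (∀ s, g s = g true) ∧ (g true).totalDegree ≤ p := by
  obtain ⟨q, hq, rfl⟩ := h
  exact ⟨fun s => rfl, (MvPolynomial.mem_restrictTotalDegree _ _ _).1 hq⟩

theorem isAffineOn_of_single {I : Interface} {M : Mesh} {v : MeshFun} {T : Finset Plane}
    (hT : T ∈ M.tri) (hT' : ¬ M.IsInterfaceElt I T) (hint : (interior (hull T)).Nonempty)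
    (h : ∀ s, hessEnergy I v T s = 0) (hs : ∀ s, v T s = v T true) : IsAffineOn v T := by
  obtain ⟨x, hx⟩ := hint
  obtain ⟨s, hxs⟩ := (I.notMem_Γ_iff x).1 fun hΓ => hT' ⟨hT, x, hx, hΓ⟩
  refine ⟨hs, ?_⟩
  rw [← hs s]
  exact pderiv_pderiv_eq_zero_of_hessEnergy (h s) ⟨x, hx, hxs⟩

/-! ### Continuity across the edges -/

theorem exists_edgeNormal_eq (M : Mesh) {e : Finset Plane} (he : e.card = 2) :
    ∃ k : ℝ, k ≠ 0 ∧ edgeNormal M e = k • rot ((ends e).2 - (ends e).1) := by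
  have h := inv_ne_zero (edgeLen_pos he).ne'
  simp only [edgeNormal]
  split_ifs
  · exact ⟨_, h, rfl⟩
  · exact ⟨_, neg_ne_zero.2 h, (neg_smul _ _).symm⟩

/-- Vanishing along the edge kills the tangential part of the gradient. The normal derivative of an
affine function is constant, so a single zero of it kills the rest. -/
theorem eq_zero_of_edge {M : Mesh} {e : Finset Plane} (he : e.card = 2) {q : Poly}
    (hq : ∀ i j, MvPolynomial.pderiv i (MvPolynomial.pderiv j q) = 0)
    (h0 : ∀ᵐ t ∂(volume.restrict (Icc (0 : ℝ) 1)), ev q (edgePt e t) = 0)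
    (h1 : ∃ t, ev (dirD (edgeNormal M e) q) (edgePt e t) = 0) : q = 0 := by
  obtain ⟨a, b, hev, hdir, h00⟩ := exists_affine hq
  have hae : ∀ t ∈ Ioo (0 : ℝ) 1, ev q (edgePt e t) = 0 := by
    have h2 : (fun t => ev q (edgePt e t)) =ᵐ[volume.restrict (Ioo (0 : ℝ) 1)] fun _ => 0 :=
      ae_restrict_of_ae_restrict_of_subset Ioo_subset_Icc_self h0
    exact Measure.eqOn_open_of_ae_eq h2 isOpen_Ioo
      ((continuous_ev q).comp (continuous_edgePt e)).continuousOn continuousOn_const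
  have e1 := hae (1 / 4) (by norm_num)
  have e2 := hae (3 / 4) (by norm_num)
  rw [hev] at e1 e2
  have e3 : inner ℝ b (edgePt e (3 / 4) - edgePt e (1 / 4)) = 0 := by
    rw [inner_sub_right]
    linarith
  rw [edgePt_sub, inner_smul_right] at e3
  have e4 : inner ℝ b ((ends e).2 - (ends e).1) = 0 := by
    refine (mul_eq_zero.1 e3).resolve_left ?_
    norm_num
  obtain ⟨t, ht⟩ := h1
  obtain ⟨k, hk, hkn⟩ := exists_edgeNormal_eq M he
  rw [hdir, hkn, inner_smul_right, real_inner_comm, inner_rot] at ht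
  have e5 : cr ((ends e).2 - (ends e).1) b = 0 := by
    simpa using (mul_eq_zero.1 ht).resolve_left hk
  have hne : (ends e).2 - (ends e).1 ≠ 0 := sub_ne_zero.2 (ends_spec he).1.symm
  have hb : b = 0 := by
    have := norm_sq_mul_norm_sq ((ends e).2 - (ends e).1) b
    rw [e5, real_inner_comm, e4] at this
    have h4 : ‖(ends e).2 - (ends e).1‖ ^ 2 ≠ 0 := by positivity
    have h5 : ‖b‖ ^ 2 = 0 := by
      refine (mul_eq_zero.1 (this.trans ?_)).resolve_left h4
      norm_num
    simpa using h5
  refine h00 ?_ hb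
  rw [hb, inner_zero_left] at e1
  linarith

theorem exists_eq_zero_of_edgeInt {e : Finset Plane} (he : e.card = 2) {S : Set Plane}
    (hS : MeasurableSet S) (hL : subLen e S ≠ 0) {f : Plane → ℝ} (hf : ∀ x, 0 ≤ f x)
    (hb : BddMeas fun t => f (edgePt e t)) (h : edgeInt e S f = 0) :
    ∃ t, f (edgePt e t) = 0 := by
  have h1 : ∫ t in edgeSet e S, f (edgePt e t) = 0 :=
    (mul_eq_zero.1 h).resolve_left (edgeLen_pos he).ne'
  have h2 := (integral_eq_zero_iff_of_nonneg (fun t => hf (edgePt e t))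
    (hb.integrableOn (edgeSet_subset e S))).1 h1
  by_contra! hne
  have h3 : volume (edgeSet e S) = 0 := by
    have h4 := (ae_restrict_iff' (measurableSet_edgeSet e hS)).1 h2
    have h5 : ∀ᵐ t : ℝ, t ∉ edgeSet e S := h4.mono fun t ht htS => hne t (ht htS)
    simpa [ae_iff] using h5
  exact hL (by rw [subLen_eq, measureReal_def, h3, ENNReal.toReal_zero, mul_zero])

theorem ae_eq_zero_of_edgeInt {e : Finset Plane} (he : e.card = 2) {f : Plane → ℝ}
    (hf : ∀ x, 0 ≤ f x) (hb : BddMeas fun t => f (edgePt e t)) (h : edgeInt e univ f = 0) :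
    ∀ᵐ t ∂(volume.restrict (Icc (0 : ℝ) 1)), f (edgePt e t) = 0 := by
  have h1 : ∫ t in edgeSet e univ, f (edgePt e t) = 0 :=
    (mul_eq_zero.1 h).resolve_left (edgeLen_pos he).ne'
  have h2 := (integral_eq_zero_iff_of_nonneg (fun t => hf (edgePt e t))
    (hb.integrableOn (edgeSet_subset e univ))).1 h1
  rw [edgeSet_univ] at h2
  exact h2

end ImmersedIP

/-! ### Definiteness of the norm -/

namespace ImmersedIP

variable {M : Mesh} {I : Interface} {β : Bool → ℝ} {v : MeshFun} {ρ r : ℝ}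

theorem jump_eq_ev (h : ∀ T ∈ M.tri, IsAffineOn v T) {e : Finset Plane} (he : e ∈ M.intEdges)
    (x : Plane) : jump M I e v x = ev (v (M.T₁ e) true - v (M.T₂ e) true) x := by
  obtain ⟨h1, h2, -⟩ := M.adj e he
  rw [jump, (h _ h1).val_eq, (h _ h2).val_eq, ev_sub]

theorem jumpN_eq_ev (h : ∀ T ∈ M.tri, IsAffineOn v T) {e : Finset Plane} (he : e ∈ M.intEdges)
    (x : Plane) : jumpN M I e v x =
      ev (dirD (edgeNormal M e) (v (M.T₁ e) true - v (M.T₂ e) true)) x := by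
  obtain ⟨h1, h2, -⟩ := M.adj e he
  rw [jumpN, jump, (h _ h1).val_pdir_eq, (h _ h2).val_pdir_eq, dirD_sub, ev_sub]

theorem betaE_pos (hβ : ∀ s, 0 < β s) (e : Finset Plane) (x : Plane) : 0 < betaE M I β e x := by
  have h1 := hβ (phase I (M.T₁ e) x)
  have h2 := hβ (phase I (M.T₂ e) x)
  unfold betaE
  positivity

/-- All the terms of the norm that bear on a mesh function vanish. -/
structure NormZero (M : Mesh) (I : Interface) (β : Bool → ℝ) (v : MeshFun) : Prop where
  hess : ∀ T ∈ M.tri, ∀ s, hessEnergy I v T s = 0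
  edgeN : ∀ e ∈ M.intEdgesN I, edgeSqN M I β v e = 0
  curveN : ∀ T ∈ M.ifTri I, curveSqN I v T = 0
  cutN : ∀ e ∈ M.intEdgesI I, ∀ s, edgeInt e (I.D s) (fun x => jumpN M I e v x ^ 2) = 0
  cut : ∀ e ∈ M.intEdgesI I, edgeSq M I v e = 0
  curve : ∀ T ∈ M.ifTri I, curveSq I v T = 0

theorem Mesh.Admissible.subLen_pos (hI : M.Admissible I r) {e : Finset Plane}
    (he : e ∈ M.intEdgesI I) (s : Bool) : 0 < subLen e (I.D s) := by
  obtain ⟨hei, hcut⟩ := Mesh.mem_intEdgesI.1 he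
  obtain ⟨a, b, ha, hab, hb, h1, h2, -⟩ :=
    hI.exists_Ioo_of_isCut (Mesh.mem_intEdges.1 hei).1 hcut s
  rw [subLen_eq_of_Ioo ha hab hb h1 h2]
  exact mul_pos (sub_pos.2 hab) (edgeLen_pos (Mesh.card_of_mem_intEdges hei))

theorem Mesh.mem_ifTri {T : Finset Plane} : T ∈ M.ifTri I ↔ M.IsInterfaceElt I T := by
  classical
  exact ⟨fun h => (Finset.mem_filter.1 h).2, fun h => Finset.mem_filter.2 ⟨h.1, h⟩⟩

theorem Mesh.exists_cr_pos {T : Finset Plane} (hT : T ∈ M.tri) :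
    ∃ A B C, T = {A, B, C} ∧ 0 < cr (B - A) (C - A) := by
  obtain ⟨A, B, C, hAB, -, -, rfl⟩ := Finset.card_eq_three.1 (M.card_tri T hT)
  rcases onLeft_or hT hAB (by simp) (by simp) with ⟨C', h, h'⟩ | ⟨C', h, h'⟩
  · exact ⟨_, _, _, h, h'⟩
  · exact ⟨_, _, _, h, h'⟩

theorem Mesh.interior_hull_nonempty {T : Finset Plane} (hT : T ∈ M.tri) :
    (interior (hull T)).Nonempty := by
  obtain ⟨A, B, C, rfl, hD⟩ := Mesh.exists_cr_pos hT
  have e1 : cr (B - A) ((1 / 3 : ℝ) • (A + B + C) - A) = 1 / 3 * cr (B - A) (C - A) := by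
    simp [cr]
    ring
  have e2 : cr (C - B) ((1 / 3 : ℝ) • (A + B + C) - B) = 1 / 3 * cr (B - A) (C - A) := by
    simp [cr]
    ring
  have e3 : cr (A - C) ((1 / 3 : ℝ) • (A + B + C) - C) = 1 / 3 * cr (B - A) (C - A) := by
    simp [cr]
    ring
  exact ⟨(1 / 3 : ℝ) • (A + B + C), mem_interior_hull hD (by linarith) (by linarith)
    (by linarith)⟩

theorem Mesh.diamT_pos {T : Finset Plane} (hT : T ∈ M.tri) : 0 < diamT T := by
  obtain ⟨A, B, C, hAB, -, -, rfl⟩ := Finset.card_eq_three.1 (M.card_tri T hT)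
  exact (dist_pos.2 hAB).trans_le (dist_le_diamT (subset_hull _ (by simp))
    (subset_hull _ (by simp)))

theorem normZero_of_normSq (hI : M.Admissible I r) (hβ : ∀ s, 0 < β s) {σu σn : ℝ} (hu : 0 < σu)
    (hn : 0 < σn) (h : normSq M I β v σu 1 σn = 0) : NormZero M I β v := by
  have hb := betaAv_pos hβ
  have k1 : ∀ T ∈ M.tri, 0 ≤ elemEnergy I β v T := fun T _ => elemEnergy_nonneg hβ T
  have k2 : ∀ e ∈ M.intEdgesN I, 0 ≤ σu / edgeLen e * edgeSqN M I β v e := fun e _ =>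
    mul_nonneg (div_nonneg hu.le (edgeLen_nonneg e)) (edgeSqN_nonneg hβ e)
  have k3 : ∀ T ∈ M.ifTri I, 0 ≤ σu * betaAv β / diamT T * curveSqN I v T := fun T _ =>
    mul_nonneg (div_nonneg (mul_pos hu hb).le (diamT_nonneg T)) (curveSqN_nonneg T)
  have k4 : ∀ e ∈ M.intEdgesI I, 0 ≤ cutPenN M I β v e := fun e _ => cutPenN_nonneg hβ e
  have k5 : ∀ e ∈ M.intEdgesNF I, 0 ≤ 1 * edgeLen e * edgeSqNN M I β v e := fun e _ =>
    mul_nonneg (mul_nonneg zero_le_one (edgeLen_nonneg e)) (edgeSqNN_nonneg hβ e)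
  have k6 : ∀ e ∈ M.intEdgesI I, 0 ≤ cutPenNN M I β v e := fun e _ => cutPenNN_nonneg hβ e
  have k7 : ∀ e ∈ M.intEdgesI I, 0 ≤ σn * betaAv β / edgeLen e ^ 3 * edgeSq M I v e := fun e _ =>
    mul_nonneg (div_nonneg (mul_pos hn hb).le (pow_nonneg (edgeLen_nonneg e) 3)) (edgeSq_nonneg e)
  have k8 : ∀ T ∈ M.ifTri I, 0 ≤ σn * betaAv β / diamT T ^ 3 * curveSq I v T := fun T _ =>
    mul_nonneg (div_nonneg (mul_pos hn hb).le (pow_nonneg (diamT_nonneg T) 3)) (curveSq_nonneg T)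
  have s1 := Finset.sum_nonneg k1
  have s2 := Finset.sum_nonneg k2
  have s3 := Finset.sum_nonneg k3
  have s4 := Finset.sum_nonneg k4
  have s5 := Finset.sum_nonneg k5
  have s6 := Finset.sum_nonneg k6
  have s7 := Finset.sum_nonneg k7
  have s8 := Finset.sum_nonneg k8
  have s4' := mul_nonneg hu.le s4
  rw [normSq] at h
  have z1 := (Finset.sum_eq_zero_iff_of_nonneg k1).1 (by linarith)
  have z2 := (Finset.sum_eq_zero_iff_of_nonneg k2).1 (by linarith)
  have z3 := (Finset.sum_eq_zero_iff_of_nonneg k3).1 (by linarith)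
  have z4 := (Finset.sum_eq_zero_iff_of_nonneg k4).1
    ((mul_eq_zero.1 (by linarith : σu * _ = 0)).resolve_left hu.ne')
  have z7 := (Finset.sum_eq_zero_iff_of_nonneg k7).1 (by linarith)
  have z8 := (Finset.sum_eq_zero_iff_of_nonneg k8).1 (by linarith)
  have hif : ∀ {T}, T ∈ M.ifTri I → 0 < diamT T := fun hT =>
    Mesh.diamT_pos (Mesh.mem_ifTri.1 hT).1
  have hlen : ∀ {e}, e ∈ M.intEdges → 0 < edgeLen e := fun he =>
    edgeLen_pos (Mesh.card_of_mem_intEdges he)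
  refine ⟨fun T hT s => ?_, fun e he => ?_, fun T hT => ?_, fun e he s => ?_, fun e he => ?_,
    fun T hT => ?_⟩
  · have := (Finset.sum_eq_zero_iff_of_nonneg fun s _ =>
      mul_nonneg (hβ s).le (hessEnergy_nonneg I v T s)).1 (z1 T hT) s (Finset.mem_univ s)
    exact (mul_eq_zero.1 this).resolve_left (hβ s).ne'
  · exact (mul_eq_zero.1 (z2 e he)).resolve_left
      (div_pos hu (hlen (Mesh.mem_intEdgesN.1 he).1)).ne'
  · exact (mul_eq_zero.1 (z3 T hT)).resolve_left (div_pos (mul_pos hu hb) (hif hT)).ne'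
  · have := (Finset.sum_eq_zero_iff_of_nonneg fun s _ => mul_nonneg (div_nonneg (hβ s).le
      (subLen_nonneg _ _)) (edgeInt_nonneg _ _ fun _ => sq_nonneg _)).1 (z4 e he) s
      (Finset.mem_univ s)
    exact (mul_eq_zero.1 this).resolve_left (div_pos (hβ s) (hI.subLen_pos he s)).ne'
  · exact (mul_eq_zero.1 (z7 e he)).resolve_left
      (div_pos (mul_pos hn hb) (pow_pos (hlen (Mesh.mem_intEdgesI.1 he).1) 3)).ne'
  · exact (mul_eq_zero.1 (z8 T hT)).resolve_left
      (div_pos (mul_pos hn hb) (pow_pos (hif hT) 3)).ne'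

variable {p : ℕ} {φ : Finset Plane → Plane → Piece}

theorem localSpace_le_pieces {ω : Fin 4 → ℝ} {lam : ℝ} (hφ : IsShapeFamily M I β ω lam p φ)
    (T : Finset Plane) : localSpace M I p φ T ≤ pieces p := by
  unfold localSpace
  split_ifs with hT
  · rw [Submodule.span_le]
    rintro _ ⟨A, hA, rfl⟩
    exact (hφ T hT A hA).1
  · intro g hg
    obtain ⟨h1, h2⟩ := mem_single hg
    exact mem_pieces.2 fun s => (h1 s).symm ▸ h2

theorem mem_pieces_of_mem_ifeSpace {ω : Fin 4 → ℝ} {lam : ℝ} (hφ : IsShapeFamily M I β ω lam p φ)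
    (hv : v ∈ ifeSpace M I p φ) (T : Finset Plane) : v T ∈ pieces p := by
  by_cases hT : T ∈ M.tri
  · exact localSpace_le_pieces hφ T (hv.2.1 T hT)
  · rw [hv.1 T hT]
    exact zero_mem _

theorem NormZero.isAffineOn (h : NormZero M I β v) (hv : v ∈ ifeSpace M I p φ) {T : Finset Plane}
    (hT : T ∈ M.tri) : IsAffineOn v T := by
  by_cases hTi : T ∈ M.ifTri I
  · exact isAffineOn_of_interface (Mesh.mem_ifTri.1 hTi) (h.hess T hT) (h.curve T hTi)
      (h.curveN T hTi)
  · have h1 := hv.2.1 T hT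
    rw [localSpace, if_neg hTi] at h1
    exact isAffineOn_of_single hT (fun h' => hTi (Mesh.mem_ifTri.2 h'))
      (Mesh.interior_hull_nonempty hT) (h.hess T hT) (mem_single h1).1

/-- The jump of v vanishes by the penalty on a cut edge and by continuity on any other edge; the
jump of the normal derivative is penalised on both kinds. `eq_zero_of_edge` then applies to the
difference of the two affine polynomials. -/
theorem NormZero.eq_of_intEdge (h : NormZero M I β v) (hI : M.Admissible I r)
    (hβ : ∀ s, 0 < β s) (hv : v ∈ ifeSpace M I p φ) {e : Finset Plane} (he : e ∈ M.intEdges) :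
    v (M.T₁ e) true = v (M.T₂ e) true := by
  have haff : ∀ T ∈ M.tri, IsAffineOn v T := fun T hT => h.isAffineOn hv hT
  obtain ⟨hT₁, hT₂, -⟩ := M.adj e he
  have hcard := Mesh.card_of_mem_intEdges he
  refine sub_eq_zero.1 (eq_zero_of_edge (M := M) hcard
    (pderiv_pderiv_sub (haff _ hT₁).2 (haff _ hT₂).2) ?_ ?_)
  · simp only [← jump_eq_ev (I := I) haff he]
    by_cases hcut : Mesh.IsCut I e
    · have := ae_eq_zero_of_edgeInt hcard (fun _ => sq_nonneg _) (bddMeas_jump M I e v).sq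
        (h.cut e (Mesh.mem_intEdgesI.2 ⟨he, hcut⟩))
      filter_upwards [this] with t ht
      exact pow_eq_zero_iff two_ne_zero |>.1 ht
    · filter_upwards [hv.2.2.1 e (Mesh.mem_intEdgesN.2 ⟨he, hcut⟩)] with t ht
      rw [jump, ht, sub_self]
  · simp only [← jumpN_eq_ev (I := I) haff he]
    by_cases hcut : Mesh.IsCut I e
    · have hcut' := Mesh.mem_intEdgesI.2 ⟨he, hcut⟩
      obtain ⟨t, ht⟩ := exists_eq_zero_of_edgeInt hcard (I.isOpen_D true).measurableSet
        (hI.subLen_pos hcut' true).ne' (fun _ => sq_nonneg _) (bddMeas_jumpN M I e v).sq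
        (h.cutN e hcut' true)
      exact ⟨t, pow_eq_zero_iff two_ne_zero |>.1 ht⟩
    · obtain ⟨t, ht⟩ := exists_eq_zero_of_edgeInt hcard MeasurableSet.univ
        (f := fun x => betaE M I β e x * jumpN M I e v x ^ 2)
        (by rw [subLen_univ]; exact (edgeLen_pos hcard).ne')
        (fun _ => mul_nonneg (betaE_nonneg hβ _) (sq_nonneg _))
        ((bddMeas_betaE M I e β).mul (bddMeas_jumpN M I e v).sq)
        (h.edgeN e (Mesh.mem_intEdgesN.2 ⟨he, hcut⟩))
      exact ⟨t, pow_eq_zero_iff two_ne_zero |>.1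
        ((mul_eq_zero.1 ht).resolve_left (betaE_pos hβ e _).ne')⟩

/-! ### An affine function on a connected part of the mesh that vanishes on its boundary -/

/-- A boundary point of a triangle that is not a vertex is in the relative interior of an edge. -/
theorem exists_mem_openSegment_of_mem_hull {A B C y : Plane} (hD : 0 < cr (B - A) (C - A))
    (hy : y ∈ hull {A, B, C}) (hyA : y ≠ A) (hyB : y ≠ B) (h0 : cr (B - A) (y - A) = 0) :
    y ∈ openSegment ℝ A B := by
  obtain ⟨-, h1, h2⟩ := (mem_hull_iff hD).1 hy
  have hne : B - A ≠ 0 := by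
    intro h
    simp [h, cr] at hD
  have hyk := eq_add_smul_of_cr_eq_zero hne h0
  generalize inner ℝ (B - A) (y - A) / ‖B - A‖ ^ 2 = k at hyk
  obtain rfl : y = A + k • (B - A) := by rw [← hyk]; abel
  have e1 : cr (C - B) (A + k • (B - A) - B) = (1 - k) * cr (B - A) (C - A) := by
    simp [cr]
    ring
  have e2 : cr (A - C) (A + k • (B - A) - C) = k * cr (B - A) (C - A) := by
    simp [cr]
    ring
  rw [e1] at h1
  rw [e2] at h2
  have hk0 : 0 ≤ k := nonneg_of_mul_nonneg_left h2 hD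
  have hk1 : 0 ≤ 1 - k := nonneg_of_mul_nonneg_left h1 hD
  have hk0' : k ≠ 0 := by
    rintro rfl
    simp at hyA
  have hk1' : k ≠ 1 := by
    rintro rfl
    simp at hyB
  rw [openSegment_eq_image']
  exact ⟨k, ⟨lt_of_le_of_ne hk0 hk0'.symm, lt_of_le_of_ne (by linarith) hk1'⟩, rfl⟩

theorem Mesh.exists_onLeft_of_notMem_interior {T : Finset Plane} (hT : T ∈ M.tri) {y : Plane}
    (hy : y ∈ hull T) (hyi : y ∉ interior (hull T)) (hyT : y ∉ T) :
    ∃ A B, OnLeft A B T ∧ y ∈ openSegment ℝ A B := by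
  obtain ⟨A, B, C, rfl, hD⟩ := Mesh.exists_cr_pos hT
  have e1 : ({A, B, C} : Finset Plane) = {B, C, A} := by
    ext x
    simp only [Finset.mem_insert, Finset.mem_singleton]
    tauto
  have e2 : ({A, B, C} : Finset Plane) = {C, A, B} := by
    ext x
    simp only [Finset.mem_insert, Finset.mem_singleton]
    tauto
  have hD1 : 0 < cr (C - B) (A - B) := by
    have : cr (C - B) (A - B) = cr (B - A) (C - A) := by
      simp [cr]
      ring
    rwa [this]
  have hD2 : 0 < cr (A - C) (B - C) := by
    have : cr (A - C) (B - C) = cr (B - A) (C - A) := by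
      simp [cr]
      ring
    rwa [this]
  obtain ⟨h1, h2, h3⟩ := (mem_hull_iff hD).1 hy
  simp only [Finset.mem_insert, Finset.mem_singleton, not_or] at hyT
  obtain ⟨hA, hB, hC⟩ := hyT
  rcases h1.eq_or_lt with h1 | h1
  · exact ⟨A, B, ⟨C, rfl, hD⟩, exists_mem_openSegment_of_mem_hull hD hy hA hB h1.symm⟩
  rcases h2.eq_or_lt with h2 | h2
  · exact ⟨B, C, ⟨A, e1, hD1⟩, exists_mem_openSegment_of_mem_hull hD1 (e1 ▸ hy) hB hC h2.symm⟩
  rcases h3.eq_or_lt with h3 | h3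
  · exact ⟨C, A, ⟨B, e2, hD2⟩, exists_mem_openSegment_of_mem_hull hD2 (e2 ▸ hy) hC hA h3.symm⟩
  exact absurd (mem_interior_hull hD h1 h2 h3) hyi

theorem Mesh.ShapeRegular.exists_neighbour (hM : M.ShapeRegular ρ) (hρ : 0 < ρ)
    (heq : ∀ e ∈ M.intEdges, v (M.T₁ e) true = v (M.T₂ e) true) {T : Finset Plane}
    (hT : T ∈ M.tri) {A B : Plane} (hl : OnLeft A B T) (he : {A, B} ∈ M.intEdges) :
    ∃ T' ∈ M.tri, OnLeft B A T' ∧ v T' true = v T true := by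
  obtain ⟨L, R, hL, hR, hL', hR', hLR⟩ := hM.exists_left_right hρ he
  have hv : v L true = v R true := by
    rcases hLR with ⟨rfl, rfl⟩ | ⟨rfl, rfl⟩
    · exact heq _ he
    · exact (heq _ he).symm
  obtain ⟨hne, hends⟩ := ends_spec (Mesh.card_of_mem_intEdges he)
  -- `ends` orders the vertices by choice, so either orientation may occur.
  have hpair : ((ends {A, B}).1 = A ∧ (ends {A, B}).2 = B) ∨
      ((ends {A, B}).1 = B ∧ (ends {A, B}).2 = A) := by
    have h1 : (ends {A, B}).1 ∈ ({A, B} : Finset Plane) :=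
      ends_fst_mem (Mesh.card_of_mem_intEdges he)
    have h2 : (ends {A, B}).2 ∈ ({A, B} : Finset Plane) :=
      ends_snd_mem (Mesh.card_of_mem_intEdges he)
    simp only [Finset.mem_insert, Finset.mem_singleton] at h1 h2
    rcases h1 with h1 | h1 <;> rcases h2 with h2 | h2
    · exact absurd (h1.trans h2.symm) hne
    · exact Or.inl ⟨h1, h2⟩
    · exact Or.inr ⟨h1, h2⟩
    · exact absurd (h1.trans h2.symm) hne
  rcases hpair with ⟨h1, h2⟩ | ⟨h1, h2⟩ <;> rw [h1, h2] at hL hR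
  · obtain rfl := hM.eq_of_onLeft hρ hT hL' hl hL
    exact ⟨R, hR', hR, hv.symm⟩
  · obtain rfl := hM.eq_of_onLeft hρ hT hR' hl hR
    exact ⟨L, hL', hL, hv⟩

/-- There is a point of a nonempty open set at which a nonzero polynomial does not vanish and that
is on no line with a given direction through one of finitely many points. -/
theorem exists_generic_point {U : Set Plane} (hU : IsOpen U) (hne : U.Nonempty) {q : Poly}
    (hq : q ≠ 0) {d : Plane} (hd : d ≠ 0) (S : Finset Plane) :
    ∃ x ∈ U, ev q x ≠ 0 ∧ ∀ V ∈ S, cr d (V - x) ≠ 0 := by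
  let l : Plane → Poly := fun V => MvPolynomial.C (d 0) *
      (MvPolynomial.C (V 1) - MvPolynomial.X 1)
    - MvPolynomial.C (d 1) * (MvPolynomial.C (V 0) - MvPolynomial.X 0)
  have hl : ∀ V x, ev (l V) x = cr d (V - x) := fun V x => by simp [l, cr]
  have hl0 : ∀ V, l V ≠ 0 := by
    intro V h
    have h1 := hl V (V + rot d)
    have h2 := cr_neg_rot_pos hd
    rw [h, ev_zero, sub_add_cancel_left] at h1
    exact h2.ne h1
  -- All the conditions are non-vanishing of nonzero polynomials, so their product, a nonzero
  -- polynomial, is nonzero somewhere in U.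
  have hP : q * ∏ V ∈ S, l V ≠ 0 := mul_ne_zero hq (Finset.prod_ne_zero_iff.2 fun V _ => hl0 V)
  obtain ⟨x, hx, hx'⟩ : ∃ x ∈ U, ev (q * ∏ V ∈ S, l V) x ≠ 0 := by
    by_contra! h
    exact hP (eq_zero_of_ev_eq_zero_on_open hU hne h)
  rw [ev_mul] at hx'
  refine ⟨x, hx, left_ne_zero_of_mul hx', fun V hV h0 => right_ne_zero_of_mul hx' ?_⟩
  rw [ev, map_prod]
  exact Finset.prod_eq_zero hV ((hl V x).trans h0)

theorem exists_level_direction {q : Poly}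
    (hq : ∀ i j, MvPolynomial.pderiv i (MvPolynomial.pderiv j q) = 0) :
    ∃ d : Plane, d ≠ 0 ∧ ∀ x (t : ℝ), ev q (x + t • d) = ev q x := by
  obtain ⟨a, b, hev, -, -⟩ := exists_affine hq
  by_cases hb : b = 0
  · refine ⟨!₂[1, 0], fun h => ?_, fun x t => ?_⟩
    · have := congrArg (fun z : Plane => z 0) h
      simp at this
    · rw [hev, hev, hb, inner_zero_left, inner_zero_left]
  · refine ⟨rot b, fun h => hb ?_, fun x t => ?_⟩
    · rw [← norm_eq_zero, ← norm_rot, h, norm_zero]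
    · have : inner ℝ b (rot b) = 0 := by
        rw [real_inner_comm, inner_rot]
        simp [cr]
        ring
      rw [hev, hev, inner_add_right, inner_smul_right, this, mul_zero, add_zero]

/-- Suppose the polynomial q on T₀ is nonzero. Start at an interior point with q ≠ 0 and follow the
level line of q, chosen to avoid all vertices, to its last point in the union of the triangles that
carry q. This point is in the relative interior of an edge. Across an interior edge the neighbour
carries q as well and the line would go on; on a boundary edge q is zero, against its constancy
along the line. Connectedness of the mesh plays no role. -/
theorem eq_zero_of_vanishing_boundary (hM : M.ShapeRegular ρ) (hρ : 0 < ρ)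
    (haff : ∀ T ∈ M.tri, IsAffineOn v T)
    (heq : ∀ e ∈ M.intEdges, v (M.T₁ e) true = v (M.T₂ e) true)
    (hbd : ∀ e ∈ M.bdEdges, ∀ T ∈ M.tri, e ⊆ T → ∀ x ∈ hull e, ev (v T true) x = 0)
    {T₀ : Finset Plane} (hT₀ : T₀ ∈ M.tri) : v T₀ true = 0 := by
  classical
  by_contra hq
  obtain ⟨d, hd, hlev⟩ := exists_level_direction (haff T₀ hT₀).2
  obtain ⟨x₀, hx₀, hqx, hgen⟩ := exists_generic_point isOpen_interior
    (Mesh.interior_hull_nonempty hT₀) hq hd (M.tri.biUnion id)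
  set F := M.tri.filter fun T => v T true = v T₀ true with hF
  have hFm : ∀ {T}, T ∈ F ↔ T ∈ M.tri ∧ v T true = v T₀ true := by simp [hF]
  set U : Set Plane := ⋃ T ∈ F, hull T with hU
  have hUc : IsCompact U := F.finite_toSet.isCompact_biUnion fun T _ => isCompact_hull T
  have hUm : ∀ {T x}, T ∈ F → x ∈ hull T → x ∈ U := fun hT hx => mem_biUnion hT hx
  set K : Set ℝ := {t | x₀ + t • d ∈ U} with hK
  have hline : Continuous fun t : ℝ => x₀ + t • d := by fun_prop
  have hKc : IsCompact K := by
    refine Metric.isCompact_of_isClosed_isBounded (hUc.isClosed.preimage hline) ?_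
    obtain ⟨R, hR⟩ := isBounded_iff_forall_norm_le.1 hUc.isBounded
    refine isBounded_iff_forall_norm_le.2 ⟨(R + ‖x₀‖) / ‖d‖, fun t ht => ?_⟩
    rw [le_div_iff₀ (norm_pos_iff.2 hd), ← norm_smul]
    have h1 := hR _ ht
    have h2 := norm_sub_le (x₀ + t • d) x₀
    rw [add_sub_cancel_left] at h2
    linarith
  have hKne : K.Nonempty := ⟨0, by
    rw [hK, mem_ofPred_eq, zero_smul, add_zero]
    exact hUm (hFm.2 ⟨hT₀, rfl⟩) (interior_subset hx₀)⟩
  obtain ⟨t, htK, htmax⟩ := hKc.exists_isGreatest hKne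
  -- By the maximality of t, the line cannot continue from its last point into a triangle that
  -- carries q.
  have hstep : ∀ T ∈ F, ¬ ∀ᶠ ε in 𝓝[>] (0 : ℝ), x₀ + t • d + ε • d ∈ hull T := by
    intro T hT h
    obtain ⟨ε, h1, h2⟩ := (h.and self_mem_nhdsWithin).exists
    have h3 : t + ε ∈ K := by
      rw [hK, mem_ofPred_eq, add_smul, ← add_assoc]
      exact hUm hT h1
    have h4 : (0 : ℝ) < ε := h2
    linarith [htmax h3]
  obtain ⟨T, hTF, hyT⟩ : ∃ T ∈ F, x₀ + t • d ∈ hull T := by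
    simpa only [hK, hU, mem_ofPred_eq, mem_iUnion, exists_prop] using htK
  obtain ⟨hT, hTq⟩ := hFm.1 hTF
  set y := x₀ + t • d with hy
  have hcry : ∀ V, cr d (V - y) = cr d (V - x₀) := by
    intro V
    simp [hy, cr]
    ring
  have hyi : y ∉ interior (hull T) := by
    intro h
    refine hstep T hTF ?_
    have hc : Continuous fun ε : ℝ => y + ε • d := by fun_prop
    have : ∀ᶠ ε in 𝓝 (0 : ℝ), y + ε • d ∈ interior (hull T) :=
      hc.continuousAt.eventually_mem (isOpen_interior.mem_nhds (by simpa using h))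
    exact (this.filter_mono nhdsWithin_le_nhds).mono fun ε hε => interior_subset hε
  have hyV : y ∉ T := by
    intro h
    refine hgen y (Finset.mem_biUnion.2 ⟨T, hT, h⟩) ?_
    rw [← hcry, sub_self]
    simp [cr]
  obtain ⟨A, B, hl, hyAB⟩ := Mesh.exists_onLeft_of_notMem_interior hT hyT hyi hyV
  have hAB : A ≠ B := by
    rintro rfl
    obtain ⟨C, -, hD⟩ := hl
    simp [cr] at hD
  have hA : A ∈ T := by
    obtain ⟨C, rfl, -⟩ := hl
    simp
  have hB : B ∈ T := by
    obtain ⟨C, rfl, -⟩ := hl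
    simp
  have hsub : ({A, B} : Finset Plane) ⊆ T := Finset.insert_subset hA (Finset.singleton_subset_iff.2 hB)
  have he : ({A, B} : Finset Plane) ∈ M.edges :=
    Mesh.mem_edges.2 ⟨T, hT, hsub, Finset.card_pair hAB⟩
  by_cases hei : ({A, B} : Finset Plane) ∈ M.intEdges
  · obtain ⟨T', hT', hl', hv'⟩ := hM.exists_neighbour hρ heq hT hl hei
    have hT'F : T' ∈ F := hFm.2 ⟨hT', hv'.trans hTq⟩
    -- The line goes on into the neighbour T', runs along the edge, or goes on inside T. The second
    -- case would take it through the vertex A, which the choice of x₀ excludes.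
    rcases lt_trichotomy (cr (B - A) d) 0 with h | h | h
    · refine hstep T' hT'F ?_
      have h' : 0 < cr (A - B) d := by
        have : cr (A - B) d = -cr (B - A) d := by
          simp [cr]
          ring
        linarith
      rw [openSegment_symm] at hyAB
      filter_upwards [eventually_mem_flatTri hρ hAB.symm hyAB h'] with ε hε
      exact interior_subset (hM.flatTri_subset hρ.le hT' hl' le_rfl hε)
    · refine hgen A (Finset.mem_biUnion.2 ⟨T, hT, hA⟩) ?_
      rw [← hcry]
      have h1 := (of_mem_openSegment (sub_ne_zero.2 hAB.symm) hyAB).1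
      have h2 := eq_add_smul_of_cr_eq_zero (sub_ne_zero.2 hAB.symm) h1
      have h3 : A - y = -((inner ℝ (B - A) (y - A) / ‖B - A‖ ^ 2) • (B - A)) := by
        rw [← h2]
        abel
      generalize inner ℝ (B - A) (y - A) / ‖B - A‖ ^ 2 = k at h3
      have h4 : cr d (-(k • (B - A))) = k * cr (B - A) d := by
        simp [cr]
        ring
      rw [h3, h4, h, mul_zero]
    · refine hstep T hTF ?_
      filter_upwards [eventually_mem_flatTri hρ hAB hyAB h] with ε hε
      exact interior_subset (hM.flatTri_subset hρ.le hT hl le_rfl hε)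
  · refine hqx ?_
    rw [← hlev x₀ t, ← hTq]
    refine hbd {A, B} (Finset.mem_sdiff.2 ⟨he, hei⟩) T hT hsub _ ?_
    rw [hull_pair]
    exact openSegment_subset_segment _ _ _ hyAB

theorem NormZero.eq_zero (h : NormZero M I β v) (hM : M.ShapeRegular ρ) (hρ : 0 < ρ)
    (hI : M.Admissible I r) (hβ : ∀ s, 0 < β s) (hv : v ∈ ifeSpace M I p φ) : v = 0 := by
  have haff : ∀ T ∈ M.tri, IsAffineOn v T := fun T hT => h.isAffineOn hv hT
  funext T
  by_cases hT : T ∈ M.tri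
  · funext s
    rw [(haff T hT).1 s]
    refine eq_zero_of_vanishing_boundary hM hρ haff
      (fun e he => h.eq_of_intEdge hI hβ hv he) (fun e he T hT heT x hx => ?_) hT
    rw [← (haff T hT).val_eq I]
    exact hv.2.2.2.2 e he T hT heT x hx
  · exact hv.1 T hT

end ImmersedIP

namespace ImmersedIP

variable {M : Mesh} {I : Interface} {β : Bool → ℝ} {v : MeshFun} {ρ r : ℝ} {p : ℕ}
  {φ : Finset Plane → Plane → Piece}

/-! ### Well-posedness -/

theorem normSq_nonneg (hβ : ∀ s, 0 < β s) {σu σn : ℝ} (hu : 0 < σu) (hn : 0 < σn) :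
    0 ≤ normSq M I β v σu 1 σn := by
  have hb := betaAv_pos hβ
  have s1 : 0 ≤ ∑ T ∈ M.tri, elemEnergy I β v T :=
    Finset.sum_nonneg fun T _ => elemEnergy_nonneg hβ T
  have s2 : 0 ≤ ∑ e ∈ M.intEdgesN I, σu / edgeLen e * edgeSqN M I β v e :=
    Finset.sum_nonneg fun e _ =>
      mul_nonneg (div_nonneg hu.le (edgeLen_nonneg e)) (edgeSqN_nonneg hβ e)
  have s3 : 0 ≤ ∑ T ∈ M.ifTri I, σu * betaAv β / diamT T * curveSqN I v T :=
    Finset.sum_nonneg fun T _ =>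
      mul_nonneg (div_nonneg (mul_pos hu hb).le (diamT_nonneg T)) (curveSqN_nonneg T)
  have s4 : 0 ≤ σu * ∑ e ∈ M.intEdgesI I, cutPenN M I β v e :=
    mul_nonneg hu.le (Finset.sum_nonneg fun e _ => cutPenN_nonneg hβ e)
  have s5 : 0 ≤ ∑ e ∈ M.intEdgesNF I, 1 * edgeLen e * edgeSqNN M I β v e :=
    Finset.sum_nonneg fun e _ =>
      mul_nonneg (mul_nonneg zero_le_one (edgeLen_nonneg e)) (edgeSqNN_nonneg hβ e)
  have s6 : 0 ≤ 1 * ∑ e ∈ M.intEdgesI I, cutPenNN M I β v e :=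
    mul_nonneg zero_le_one (Finset.sum_nonneg fun e _ => cutPenNN_nonneg hβ e)
  have s7 : 0 ≤ ∑ e ∈ M.intEdgesI I, σn * betaAv β / edgeLen e ^ 3 * edgeSq M I v e :=
    Finset.sum_nonneg fun e _ => mul_nonneg (div_nonneg (mul_pos hn hb).le
      (pow_nonneg (edgeLen_nonneg e) 3)) (edgeSq_nonneg e)
  have s8 : 0 ≤ ∑ T ∈ M.ifTri I, σn * betaAv β / diamT T ^ 3 * curveSq I v T :=
    Finset.sum_nonneg fun T _ => mul_nonneg (div_nonneg (mul_pos hn hb).le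
      (pow_nonneg (diamT_nonneg T) 3)) (curveSq_nonneg T)
  unfold normSq
  positivity

/-- A member vanishes off the mesh, so its finitely many polynomials of degree at most p determine
it. -/
theorem finiteDimensional_ifeSpace (h : ∀ v ∈ ifeSpace M I p φ, ∀ T, v T ∈ pieces p) :
    FiniteDimensional ℝ (ifeSpace M I p φ) := by
  let R := MvPolynomial.restrictTotalDegree (Fin 2) ℝ p
  let g : ifeSpace M I p φ →ₗ[ℝ] (M.tri → Bool → R) :=
    LinearMap.pi fun T => LinearMap.pi fun s =>
      LinearMap.codRestrict R
        ((LinearMap.proj s).comp ((LinearMap.proj (R := ℝ) (φ := fun _ : Finset Plane => Piece)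
          T.1).comp (ifeSpace M I p φ).subtype))
        fun v => (MvPolynomial.mem_restrictTotalDegree _ _ _).2 (mem_pieces.1 (h v v.2 T) s)
  refine Module.Finite.of_injective g fun u v huv => Subtype.ext (funext fun T => ?_)
  by_cases hT : T ∈ M.tri
  · funext s
    exact congrArg Subtype.val (congrFun (congrFun huv ⟨T, hT⟩) s)
  · rw [u.2.1 T hT, v.2.1 T hT]

/-- On a bounded set L² is contained in L¹. Only the interior of an element is known to be in Ω, but
the frontier of a convex set is null. -/
theorem integrableOn_load {f : Plane → ℝ} (hf : MemLp f 2 (volume.restrict M.Ω))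
    {T : Finset Plane} (hT : T ∈ M.tri) (q : Poly) (S : Set Plane) :
    IntegrableOn (fun x => f x * ev q x) (hull T ∩ S) := by
  have hsub : interior (hull T) ⊆ M.Ω := interior_mono (subset_biUnion_of_mem hT)
  have hfin : IsFiniteMeasure (volume.restrict (interior (hull T))) :=
    ⟨by
      rw [Measure.restrict_apply_univ]
      exact (measure_mono interior_subset).trans_lt (isCompact_hull T).measure_lt_top⟩
  have h1 : IntegrableOn f (interior (hull T)) :=
    (hf.mono_measure (Measure.restrict_mono hsub le_rfl)).integrable one_le_two
  have h2 : IntegrableOn f (hull T) := h1.congr_set_ae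
    (interior_ae_eq_of_null_frontier ((convex_hull T).addHaar_frontier volume)).symm
  exact (h2.mul_continuousOn (continuous_ev q).continuousOn (isCompact_hull T)).mono_set
    inter_subset_left

theorem load_add {f : Plane → ℝ} (hf : MemLp f 2 (volume.restrict M.Ω)) (u v : MeshFun) :
    load M I f (u + v) = load M I f u + load M I f v := by
  simp only [load, ← Finset.sum_add_distrib]
  refine Finset.sum_congr rfl fun T hT => Finset.sum_congr rfl fun s _ => ?_
  rw [← integral_add (integrableOn_load hf hT _ _) (integrableOn_load hf hT _ _)]
  simp only [Pi.add_apply, ev_add, mul_add]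

theorem load_smul (f : Plane → ℝ) (a : ℝ) (v : MeshFun) :
    load M I f (a • v) = a * load M I f v := by
  simp only [load, Finset.mul_sum, ← integral_const_mul a]
  refine Finset.sum_congr rfl fun T _ => Finset.sum_congr rfl fun s _ => ?_
  simp only [Pi.smul_apply, ev_smul, mul_left_comm]

/-- Definiteness makes the map from the space to its dual injective; the dimensions agree, so it is
surjective too. -/
theorem existsUnique_of_definite {σu σF σn : ℝ}
    (hfin : FiniteDimensional ℝ (ifeSpace M I p φ))
    (hdef : ∀ u ∈ ifeSpace M I p φ, formAh M I β σu σF σn u u = 0 → u = 0)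
    {f : Plane → ℝ} (hf : MemLp f 2 (volume.restrict M.Ω)) :
    ∃! u : MeshFun, u ∈ ifeSpace M I p φ ∧
      ∀ v ∈ ifeSpace M I p φ, formAh M I β σu σF σn u v = load M I f v := by
  have hadd : ∀ u v v', formAh M I β σu σF σn u (v + v')
      = formAh M I β σu σF σn u v + formAh M I β σu σF σn u v' := fun u v v' => by
    rw [formAh_comm, formAh_add, formAh_comm, formAh_comm M I β σu σF σn v']
  have hsmul : ∀ (a : ℝ) u v, formAh M I β σu σF σn u (a • v)
      = a * formAh M I β σu σF σn u v := fun a u v => by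
    rw [formAh_comm, formAh_smul, formAh_comm]
  let W := ifeSpace M I p φ
  let A : W →ₗ[ℝ] Module.Dual ℝ W := LinearMap.mk₂ ℝ
    (fun u v : W => formAh M I β σu σF σn u v)
    (fun u u' v => formAh_add M I β σu σF σn u u' v)
    (fun a u v => formAh_smul M I β σu σF σn a u v)
    (fun u v v' => hadd u v v')
    (fun a u v => hsmul a u v)
  have hA : ∀ u v : W, A u v = formAh M I β σu σF σn u v := fun _ _ => rfl
  let L : Module.Dual ℝ W :=
    { toFun := fun v => load M I f v
      map_add' := fun u v => load_add hf u v
      map_smul' := fun a v => load_smul f a v }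
  have hinj : Function.Injective A := by
    rw [injective_iff_map_eq_zero]
    intro u hu
    refine Subtype.ext (hdef u u.2 ?_)
    rw [← hA, hu, LinearMap.zero_apply]
  have hsurj : Function.Surjective A :=
    (LinearMap.injective_iff_surjective_of_finrank_eq_finrank
      Subspace.dual_finrank_eq.symm).1 hinj
  obtain ⟨u, hu⟩ := hsurj L
  refine ⟨u, ⟨u.2, fun v hv => ?_⟩, fun w hw => ?_⟩
  · exact LinearMap.congr_fun hu (⟨v, hv⟩ : W)
  · have : A ⟨w, hw.1⟩ = A u := by
      rw [hu]
      exact LinearMap.ext fun v => hw.2 v v.2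
    exact congrArg Subtype.val (hinj this)

end ImmersedIP

/-! ### The theorem -/

open ImmersedIP in
theorem mainTheorem2 (p : ℕ) (hp : 1 ≤ p) (ρ : ℝ) (hρ : 0 < ρ) :
    ∃ C : ℝ, 0 < C ∧ ∃ c : ℝ, 0 < c ∧
      ∀ (M : Mesh) (I : Interface) (r : ℝ) (β : Bool → ℝ) (σn lam : ℝ) (ω : Fin 4 → ℝ)
        (φ : Finset Plane → Plane → Piece),
        M.ShapeRegular ρ → M.Admissible I r → (∀ s, 0 < β s) → 0 < σn → 1 ≤ lam →
        (∀ k, 0 < ω k) → IsShapeFamily M I β ω lam p φ →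
        (∀ v ∈ ifeSpace M I p φ,
          c * normH M I β (3 * C) 1 σn v ^ 2 ≤ formAh M I β (3 * C) 1 σn v v) ∧
        (∀ f : Plane → ℝ, MemLp f 2 (volume.restrict M.Ω) →
          ∃! u : MeshFun, u ∈ ifeSpace M I p φ ∧
            ∀ v ∈ ifeSpace M I p φ, formAh M I β (3 * C) 1 σn u v = load M I f v) := by
  -- The slope of the flat triangles: at most ρ, so that they fit into the elements, and at most
  -- 1/4, so that no short arc meets both. Their discs have radius c/16 times the length of the
  -- base.
  have hc : 0 < min ρ (1 / 4) := lt_min hρ (by norm_num)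
  obtain ⟨C₀, hC₀, hT⟩ := exists_sq_ev_le_integral_closedBall p
    (show 0 < min ρ (1 / 4) / 16 by positivity)
  -- C is determined by 3C = 2(6C₀ + 1/2), which is twice the factor of the normal jumps left by
  -- Young's inequality with δ = 1/(6C₀).
  refine ⟨4 * C₀ + 1 / 3, by positivity, 1 / 2, by norm_num, ?_⟩
  intro M I r β σn lam ω φ hM hI hβ hσ _ _ hφ
  have hpc : ∀ v ∈ ifeSpace M I p φ, ∀ T, v T ∈ pieces p := fun v hv T =>
    mem_pieces_of_mem_ifeSpace hφ hv T
  have hu : 0 < 3 * (4 * C₀ + 1 / 3) := by positivity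
  have hcoer : ∀ v ∈ ifeSpace M I p φ, 1 / 2 * normSq M I β v (3 * (4 * C₀ + 1 / 3)) 1 σn
      ≤ formAh M I β (3 * (4 * C₀ + 1 / 3)) 1 σn v v := fun v hv =>
    half_normSq_le_formAh hI hM hc (min_le_left _ _) (min_le_right _ _) hβ hT hC₀ (hpc v hv) hσ
  refine ⟨fun v hv => ?_, fun f hf => ?_⟩
  · rw [normH_eq, Real.sq_sqrt (normSq_nonneg hβ hu hσ)]
    exact hcoer v hv
  · refine existsUnique_of_definite (finiteDimensional_ifeSpace hpc) (fun u hu' h0 => ?_) hf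
    have h1 := hcoer u hu'
    have h2 := normSq_nonneg (M := M) (I := I) (v := u) hβ hu hσ
    exact (normZero_of_normSq hI hβ hu hσ (by linarith)).eq_zero hM hρ hI hβ hu'
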